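/- Let $N\ge 2$, let $\Omega\subset\mathbb R^N$ be a nonempty bounded connected open set with $C^2$ boundary, let $\nu$ be the outer unit normal to $\partial\Omega$, and let $\beta\in\mathbb R\setminus\{0\}$. Let $u\in C^2(\overline\Omega)$ be a solution of the Robin torsion problem $$\Delta u=N\ \text{ in }\Omega,\qquad \frac{\partial u}{\partial\nu}+\beta u=0\ \text{ on }\partial\Omega .$$ Write $P=\tfrac12|\nabla u|^2-u$ on $\overline\Omega$, $\nabla^\tau u=\nabla u-\langle\nabla u,\nu\rangle\nu$ for the tangential gradient on $\partial\Omega$, $\nabla\nu$ for the derivative of $\nu$ along $\partial\Omega$ (the shape operator, extended by $(\nabla\nu)\nu=0$), and $\mathcal M=\frac1{N-1}\sum_{i=1}^{N-1}\kappa_i$ for the mean curvature of $\partial\Omega$, where $\kappa_1,\dots,\kappa_{N-1}$ are the principal curvatures, i.e. the eigenvalues of the shape operator on the tangent space (with this orientation a ball of radius $r$ has $\kappa_i=1/r$). Let $$R=\frac{N|\Omega|}{|\partial\Omega|},\qquad \mathcal M_0=\frac1R,$$ where $|\Omega|$ is the Lebesgue measure of $\Omega$ and $|\partial\Omega|=\mathcal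 H^{N-1}(\partial\Omega)$. Then $0<|\partial\Omega|<\infty$, $R>0$, $P\in C^2(\Omega)$, all the integrals below converge absolutely, and $$\int_\Omega\Delta P\,dx+(N-1)\int_{\partial\Omega}\Big(\langle\nabla u,\nu\rangle-R\Big)^2\mathcal M_0\,d\mathcal H^{N-1}$$ $$=-\int_{\partial\Omega}\langle(\nabla\nu)\nabla^\tau u,\nabla^\tau u\rangle\,d\mathcal H^{N-1}-2\beta\int_{\partial\Omega}|\nabla^\tau u|^2\,d\mathcal H^{N-1}-(N-1)\int_{\partial\Omega}\langle\nabla u,\nu\rangle^2\big(\mathcal M-\mathcal M_0\big)\,d\mathcal H^{N-1}.$$ -/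

import Mathlib

open MeasureTheory Set Filter Topology InnerProductSpace

noncomputable section

namespace RobinTorsion

/-- `ρ` is a local `C²` defining function of `Ω` at the boundary point `x`: near `x` the set `Ω` is
exactly `{ρ < 0}`, and `∇ρ(x) ≠ 0`. By the implicit function theorem this says that near `x` the set
`Ω` is, in suitable Cartesian coordinates, the region strictly below the graph of a `C²` function. -/
structure IsDefiningFunctionAt {N : ℕ} (Ω : Set (EuclideanSpace ℝ (Fin N)))
    (x : EuclideanSpace ℝ (Fin N)) (ρ : EuclideanSpace ℝ (Fin N) → ℝ) : Prop where
  contDiffAt : ContDiffAt ℝ 2 ρ x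
  gradient_ne_zero : gradient ρ x ≠ 0
  eq_zero : ρ x = 0
  eventually_mem_iff : ∀ᶠ y in 𝓝 x, (y ∈ Ω ↔ ρ y < 0)

/-- `Ω` has `C²` boundary. -/
def HasC2Boundary {N : ℕ} (Ω : Set (EuclideanSpace ℝ (Fin N))) : Prop :=
  ∀ x ∈ frontier Ω, ∃ ρ, IsDefiningFunctionAt Ω x ρ

open Classical in
/-- The outer unit normal `ν = ∇ρ / |∇ρ|`, where `ρ` is any local defining function at `x`
(the result does not depend on `ρ`, see `outerNormal_eq`). It is `0` where there is none. -/
def outerNormal {N : ℕ} (Ω : Set (EuclideanSpace ℝ (Fin N))) (x : EuclideanSpace ℝ (Fin N)) :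
    EuclideanSpace ℝ (Fin N) :=
  if h : ∃ ρ, IsDefiningFunctionAt Ω x ρ then
    ‖gradient h.choose x‖⁻¹ • gradient h.choose x
  else 0

theorem IsDefiningFunctionAt.hasDerivAt_line {N : ℕ} {Ω : Set (EuclideanSpace ℝ (Fin N))}
    {x : EuclideanSpace ℝ (Fin N)} {ρ : EuclideanSpace ℝ (Fin N) → ℝ}
    (h : IsDefiningFunctionAt Ω x ρ) (w : EuclideanSpace ℝ (Fin N)) :
    HasDerivAt (fun t : ℝ => ρ (x + t • w)) (inner ℝ (gradient ρ x) w) 0 := by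
  have hd : DifferentiableAt ℝ ρ x := h.contDiffAt.differentiableAt (by norm_num)
  have hg := hd.hasGradientAt.hasFDerivAt
  have hl : HasDerivAt (fun t : ℝ => x + t • w) w 0 := by
    simpa using ((hasDerivAt_id (0 : ℝ)).smul_const w).const_add x
  have hg' : HasFDerivAt ρ (toDual ℝ (EuclideanSpace ℝ (Fin N)) (gradient ρ x))
      (x + (0 : ℝ) • w) := by simpa using hg
  exact hg'.comp_hasDerivAt (0 : ℝ) hl

theorem IsDefiningFunctionAt.inner_nonpos {N : ℕ} {Ω : Set (EuclideanSpace ℝ (Fin N))}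
    {x : EuclideanSpace ℝ (Fin N)} {ρ σ : EuclideanSpace ℝ (Fin N) → ℝ}
    (h : IsDefiningFunctionAt Ω x ρ) (k : IsDefiningFunctionAt Ω x σ)
    {w : EuclideanSpace ℝ (Fin N)} (hw : inner ℝ (gradient ρ x) w < 0) :
    inner ℝ (gradient σ x) w ≤ 0 := by
  by_contra! hc
  have h1 := (hasDerivAt_iff_tendsto_slope.1 (h.hasDerivAt_line w)).eventually_lt_const hw
  have h2 := (hasDerivAt_iff_tendsto_slope.1 (k.hasDerivAt_line w)).eventually_const_lt hc
  have hcont : Tendsto (fun t : ℝ => x + t • w) (𝓝 0) (𝓝 x) := by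
    have : Continuous (fun t : ℝ => x + t • w) := by fun_prop
    simpa using this.tendsto 0
  have hle : 𝓝[>] (0 : ℝ) ≤ 𝓝[≠] 0 := nhdsWithin_mono _ (fun t ht => ne_of_gt ht)
  have h3 := (hcont.eventually (h.eventually_mem_iff.and k.eventually_mem_iff)).filter_mono
    (nhdsWithin_le_nhds : 𝓝[>] (0 : ℝ) ≤ 𝓝 0)
  obtain ⟨t, ⟨⟨⟨ht1, ht2⟩, ht3⟩, ht⟩⟩ :=
    (((h1.filter_mono hle).and (h2.filter_mono hle)).and h3 |>.and self_mem_nhdsWithin).exists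
  have ht : 0 < t := ht
  simp only [slope_def_field, zero_smul, add_zero, sub_zero, h.eq_zero, k.eq_zero] at ht1 ht2
  have h4 : ρ (x + t • w) < 0 := by
    by_contra! hh
    exact absurd ht1 (not_lt.2 (div_nonneg hh ht.le))
  have h5 := ht3.2.1 (ht3.1.2 h4)
  exact absurd ht2 (not_lt.2 (div_nonpos_of_nonpos_of_nonneg h5.le ht.le))

/-- The outer unit normal may be computed with any local defining function. -/
theorem outerNormal_eq {N : ℕ} {Ω : Set (EuclideanSpace ℝ (Fin N))}
    {x : EuclideanSpace ℝ (Fin N)} {ρ : EuclideanSpace ℝ (Fin N) → ℝ}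
    (h : IsDefiningFunctionAt Ω x ρ) :
    outerNormal Ω x = ‖gradient ρ x‖⁻¹ • gradient ρ x := by
  have hex : ∃ σ, IsDefiningFunctionAt Ω x σ := ⟨ρ, h⟩
  rw [outerNormal, dif_pos hex]
  have k := hex.choose_spec
  generalize hex.choose = σ at k
  have n1 : ‖(‖gradient ρ x‖⁻¹ • gradient ρ x)‖ = 1 := by
    rw [norm_smul, norm_inv, norm_norm, inv_mul_cancel₀ (norm_ne_zero_iff.2 h.gradient_ne_zero)]
  have n2 : ‖(‖gradient σ x‖⁻¹ • gradient σ x)‖ = 1 := by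
    rw [norm_smul, norm_inv, norm_norm, inv_mul_cancel₀ (norm_ne_zero_iff.2 k.gradient_ne_zero)]
  have p1 : 0 < ‖gradient ρ x‖⁻¹ := inv_pos.2 (norm_pos_iff.2 h.gradient_ne_zero)
  have p2 : 0 < ‖gradient σ x‖⁻¹ := inv_pos.2 (norm_pos_iff.2 k.gradient_ne_zero)
  have key : ∀ w, inner ℝ (‖gradient ρ x‖⁻¹ • gradient ρ x) w < 0 →
      inner ℝ (‖gradient σ x‖⁻¹ • gradient σ x) w ≤ 0 := by
    intro w hw
    rw [real_inner_smul_left] at hw ⊢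
    exact mul_nonpos_of_nonneg_of_nonpos p2.le (h.inner_nonpos k (by
      by_contra! hh
      exact absurd hw (not_lt.2 (mul_nonneg p1.le hh))))
  set a := ‖gradient ρ x‖⁻¹ • gradient ρ x
  set b := ‖gradient σ x‖⁻¹ • gradient σ x
  refine (inner_eq_one_iff_of_norm_eq_one (𝕜 := ℝ) n2 n1).1 (le_antisymm ?_ ?_)
  · simpa [n1, n2] using real_inner_le_norm b a
  · by_contra! hlt
    have h1 := key (b - a) (by
      rw [inner_sub_right, real_inner_self_eq_norm_sq, n1, real_inner_comm]; linarith)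
    rw [inner_sub_right, real_inner_self_eq_norm_sq, n2] at h1
    linarith

/-- The tangent space of `∂Ω` at `x`, i.e. the orthogonal complement of `ν(x)`. -/
def tangentSpace {N : ℕ} (Ω : Set (EuclideanSpace ℝ (Fin N))) (x : EuclideanSpace ℝ (Fin N)) :
    Submodule ℝ (EuclideanSpace ℝ (Fin N)) :=
  (Submodule.span ℝ {outerNormal Ω x})ᗮ

/-- The matrix `∇ν` at a boundary point: on tangent vectors it is the derivative of `ν` along `∂Ω`,
and `(∇ν)ν = 0`. This is the Jacobian matrix of the unit extension of `ν` that is constant along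
normal lines, that is, of the gradient of the signed distance to `∂Ω` (negative inside `Ω`). -/
def gradNormal {N : ℕ} (Ω : Set (EuclideanSpace ℝ (Fin N))) (x : EuclideanSpace ℝ (Fin N)) :
    EuclideanSpace ℝ (Fin N) →L[ℝ] EuclideanSpace ℝ (Fin N) :=
  (fderivWithin ℝ (outerNormal Ω) (frontier Ω) x).comp (tangentSpace Ω x).starProjection

/-- The shape operator (Weingarten map) of `∂Ω` at `x` with respect to the outer normal, with the
sign for which convex sets have nonnegative principal curvatures. -/
def shapeOperator {N : ℕ} (Ω : Set (EuclideanSpace ℝ (Fin N))) (x : EuclideanSpace ℝ (Fin N)) :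
    tangentSpace Ω x →ₗ[ℝ] tangentSpace Ω x :=
  (((tangentSpace Ω x).orthogonalProjectionOnto).comp
    ((gradNormal Ω x).comp (tangentSpace Ω x).subtypeL)).toLinearMap

/-- The principal curvatures `κ₁, …, κ_{N-1}` of `∂Ω` at `x`: the eigenvalues of the shape operator,
counted with multiplicity. -/
def principalCurvatures {N : ℕ} (Ω : Set (EuclideanSpace ℝ (Fin N)))
    (x : EuclideanSpace ℝ (Fin N)) : Multiset ℝ :=
  (shapeOperator Ω x).charpoly.roots

/-- The mean curvature `𝓜 = (κ₁ + ⋯ + κ_{N-1}) / (N - 1)`. -/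
def meanCurvature {N : ℕ} (Ω : Set (EuclideanSpace ℝ (Fin N))) (x : EuclideanSpace ℝ (Fin N)) : ℝ :=
  1 / ((N : ℝ) - 1) * (principalCurvatures Ω x).sum

/-- The gradient of a function on the closed set `closure Ω`, up to the boundary. -/
def grad {N : ℕ} (Ω : Set (EuclideanSpace ℝ (Fin N))) (u : EuclideanSpace ℝ (Fin N) → ℝ)
    (x : EuclideanSpace ℝ (Fin N)) : EuclideanSpace ℝ (Fin N) :=
  gradientWithin u (closure Ω) x

/-- The normal derivative `∂u/∂ν = ⟨∇u, ν⟩`. -/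
def normalDeriv {N : ℕ} (Ω : Set (EuclideanSpace ℝ (Fin N))) (u : EuclideanSpace ℝ (Fin N) → ℝ)
    (x : EuclideanSpace ℝ (Fin N)) : ℝ :=
  inner ℝ (grad Ω u x) (outerNormal Ω x)

/-- The tangential gradient `∇^τ u = ∇u - ⟨∇u, ν⟩ ν`. -/
def tangentialGrad {N : ℕ} (Ω : Set (EuclideanSpace ℝ (Fin N)))
    (u : EuclideanSpace ℝ (Fin N) → ℝ) (x : EuclideanSpace ℝ (Fin N)) :
    EuclideanSpace ℝ (Fin N) :=
  grad Ω u x - normalDeriv Ω u x • outerNormal Ω x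

/-- The function `P = |∇u|²/2 - u`. -/
def pFunction {N : ℕ} (Ω : Set (EuclideanSpace ℝ (Fin N))) (u : EuclideanSpace ℝ (Fin N) → ℝ)
    (x : EuclideanSpace ℝ (Fin N)) : ℝ :=
  1 / 2 * ‖grad Ω u x‖ ^ 2 - u x

/-- `u ∈ C²(closure Ω)` solves `Δu = N` in `Ω`, `∂u/∂ν + β u = 0` on `∂Ω`. -/
structure IsRobinTorsionSolution {N : ℕ} (Ω : Set (EuclideanSpace ℝ (Fin N))) (β : ℝ)
    (u : EuclideanSpace ℝ (Fin N) → ℝ) : Prop where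
  contDiffOn : ContDiffOn ℝ 2 u (closure Ω)
  laplacian_eq : ∀ x ∈ Ω, Laplacian.laplacian u x = N
  robin : ∀ x ∈ frontier Ω, normalDeriv Ω u x + β * u x = 0

/-- The surface measure `𝓗^{N-1}` (normalized so that it is `(N-1)`-dimensional Lebesgue measure on
hyperplanes) restricted to `∂Ω`. -/
def surfaceMeasure {N : ℕ} (Ω : Set (EuclideanSpace ℝ (Fin N))) :
    Measure (EuclideanSpace ℝ (Fin N)) :=
  (Measure.euclideanHausdorffMeasure (N - 1)).restrict (frontier Ω)

/-- `R = N |Ω| / |∂Ω|`. -/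
def refRadius {N : ℕ} (Ω : Set (EuclideanSpace ℝ (Fin N))) : ℝ :=
  N * volume.real Ω / (surfaceMeasure Ω).real univ

/-- `𝓜₀ = 1 / R`. -/
def refCurvature {N : ℕ} (Ω : Set (EuclideanSpace ℝ (Fin N))) : ℝ :=
  1 / refRadius Ω

end RobinTorsion

end

namespace RobinTorsion

open scoped ENNReal NNReal

/-! ### Hausdorff measure of embedded images: the area formula -/

section AreaFormula

/-! Write `u_ν`, `u_νν` for `⟨∇u, ν⟩`, `⟨D²u ν, ν⟩`. Since `∇P = D²u ∇u - ∇u`, the divergence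
theorem turns the integral of `ΔP` into the boundary integral of `u_ν u_νν + ⟨D²u ∇^τ u, ν⟩ - u_ν`.
Differentiating the Robin condition in the direction `∇^τ u` gives `⟨D²u ∇^τ u, ν⟩ = -⟨(∇ν)∇^τ u,
∇^τ u⟩ - β|∇^τ u|²` (`IsRobinTorsionSolution.inner_hess_tangentialGrad`).

The term `u_ν u_νν` is removed by integrating by parts on `∂Ω`. The field `u ∇u` has tangential
divergence `u (N - u_νν) + |∇^τ u|²`, and by the first variation formula (`integral_firstVariation`)
this has the same integral as `(N-1) 𝓜 u u_ν`. Multiplying by `β` and replacing `β u` by `-u_ν`, one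
finds that `u_ν u_νν + (N-1) 𝓜 u_ν² + β|∇^τ u|² - N u_ν` has integral zero
(`IsRobinTorsionSolution.integral_robinVariation`). This supplies the second `β|∇^τ u|²` and leaves
`(N-1) u_ν`. Because `∫ u_ν = N|Ω| = R|∂Ω|` and `R 𝓜₀ = 1`, expanding `(u_ν - R)² 𝓜₀` absorbs that
last term.

The difficulty is low regularity. As `u` is only `C²` up to the boundary, `∇P` is merely continuous
there, so `setIntegral_divergence` treats fields that are continuous on the closure and `C¹` inside
with integrable divergence. That `∇P` is `C¹` inside follows from interior smoothness of `u`
(`contDiffAt_of_laplacian_eq_const`, through a mean value formula). Its divergence is `tr (D²u)² -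
N`, which extends continuously to the closure because the third derivatives cancel.

The surface measure is a Hausdorff measure; the area formula `comap_euclideanHausdorffMeasure`
expresses it in graph charts. After a partition of unity, the divergence theorem and the first
variation formula both rest on one fact on a hyperplane: the divergence of a compactly supported
`C¹` field integrates to zero (`integral_opTrace_eq_zero`). -/

theorem euclideanHausdorffMeasure_image_le_of_edist_le {α Y Z : Type*}
    [EMetricSpace Y] [MeasurableSpace Y] [BorelSpace Y]
    [EMetricSpace Z] [MeasurableSpace Z] [BorelSpace Z]
    {f : α → Y} {g : α → Z} {K : ℝ≥0} {s : Set α}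
    (h : ∀ x ∈ s, ∀ y ∈ s, edist (f x) (f y) ≤ K * edist (g x) (g y)) (d : ℕ) :
    Measure.euclideanHausdorffMeasure d (f '' s) ≤
      (K : ℝ≥0∞) ^ d * Measure.euclideanHausdorffMeasure d (g '' s) := by
  rcases s.eq_empty_or_nonempty with rfl | ⟨x0, hx0⟩
  · simp
  classical
  -- `r` picks a point of `s` in each fibre of `g`. Points with the same `g`-value have the same
  -- `f`-value, so `f ∘ r` is a well-defined `K`-Lipschitz map from `g '' s` onto `f '' s`; `x0` is
  -- only a default.
  let r : Z → α := fun z => if hz : ∃ x ∈ s, g x = z then hz.choose else x0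
  have hr : ∀ x ∈ s, r (g x) ∈ s ∧ g (r (g x)) = g x := by
    intro x hx
    have hz : ∃ y ∈ s, g y = g x := ⟨x, hx, rfl⟩
    simp only [r, dif_pos hz]
    exact hz.choose_spec
  have hfr : ∀ x ∈ s, f (r (g x)) = f x := by
    intro x hx
    have := h _ (hr x hx).1 x hx
    rw [(hr x hx).2, edist_self, mul_zero] at this
    exact edist_le_zero.1 this
  have hl : LipschitzOnWith K (f ∘ r) (g '' s) := by
    rintro _ ⟨x, hx, rfl⟩ _ ⟨y, hy, rfl⟩
    simp only [Function.comp, hfr x hx, hfr y hy]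
    exact h x hx y hy
  have him : f '' s = (f ∘ r) '' (g '' s) := by
    rw [image_image]
    exact image_congr fun x hx => (hfr x hx).symm
  rw [him]
  simp only [Measure.euclideanHausdorffMeasure_def, Measure.smul_apply, ENNReal.smul_def,
    smul_eq_mul]
  rw [mul_left_comm]
  gcongr
  have := hl.hausdorffMeasure_image_le (d := (d : ℝ)) (by positivity)
  simpa using this

variable {V E : Type*} [NormedAddCommGroup V] [InnerProductSpace ℝ V] [FiniteDimensional ℝ V]
  [MeasurableSpace V] [BorelSpace V] [NormedAddCommGroup E] [InnerProductSpace ℝ E]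
  [MeasurableSpace E] [BorelSpace E]

/-- Near `x` the distances `‖f y - f z‖` and `‖L y - L z‖` agree up to factors `1 + ε` and `(1 -
ε)⁻¹`, because `L` is bounded below. Lipschitz comparison in both directions then reduces the claim
to the linear image, whose measure is `normDet` times the volume. -/
theorem image_measure_bounds_of_hasStrictFDerivAt {f : V → E} {L : V →L[ℝ] E} {x : V}
    (hf : HasStrictFDerivAt f L x) (hL : Function.Injective L) {ε : ℝ≥0} (hε : 0 < ε)
    (hε1 : ε < 1) :
    ∃ U ∈ 𝓝 x, ∀ s ⊆ U,
      Measure.euclideanHausdorffMeasure (Module.finrank ℝ V) (f '' s) ≤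
        ((1 + ε : ℝ≥0) : ℝ≥0∞) ^ Module.finrank ℝ V *
          (ENNReal.ofReal (L : V →ₗ[ℝ] E).normDet * volume s) ∧
      ENNReal.ofReal (L : V →ₗ[ℝ] E).normDet * volume s ≤
        (((1 - ε)⁻¹ : ℝ≥0) : ℝ≥0∞) ^ Module.finrank ℝ V *
          Measure.euclideanHausdorffMeasure (Module.finrank ℝ V) (f '' s) := by
  obtain ⟨K, hK, hLK⟩ := (L : V →ₗ[ℝ] E).injective_iff_antilipschitz.1 hL
  -- With `K` the antilipschitz constant of `L`, the error `ε K⁻¹ ‖y - z‖` is at most `ε ‖L y - L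
  -- z‖`: the absolute error becomes a relative one.
  obtain ⟨U, hU, hfU⟩ := hf.approximates_deriv_on_nhds (c := ε * K⁻¹)
    (Or.inr (by positivity))
  refine ⟨U, hU, fun s hs => ?_⟩
  have hb : ∀ y ∈ s, ∀ z ∈ s, ‖f y - f z - L (y - z)‖ ≤ ε * ‖L y - L z‖ := by
    intro y hy z hz
    refine (hfU y (hs hy) z (hs hz)).trans ?_
    have := hLK.le_mul_dist y z
    rw [dist_eq_norm, dist_eq_norm] at this
    push_cast
    rw [mul_assoc]
    gcongr
    rw [inv_mul_le_iff₀ (by positivity)]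
    exact this
  have hvol : Measure.euclideanHausdorffMeasure (Module.finrank ℝ V) (L '' s) =
      ENNReal.ofReal (L : V →ₗ[ℝ] E).normDet * volume s :=
    (L : V →ₗ[ℝ] E).euclideanHausdorffMeasure_image_eq_normDet_mul_volume s
  rw [← hvol]
  constructor
  · refine euclideanHausdorffMeasure_image_le_of_edist_le (fun y hy z hz => ?_) _
    have h1 : ‖f y - f z‖ ≤ (1 + ε) * ‖L y - L z‖ := by
      have h2 := hb y hy z hz
      have h3 := norm_add_le (f y - f z - L (y - z)) (L (y - z))
      rw [sub_add_cancel] at h3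
      rw [map_sub] at h2 h3
      linarith
    rw [edist_eq_enorm_sub, edist_eq_enorm_sub, enorm_eq_nnnorm, enorm_eq_nnnorm]
    exact_mod_cast h1
  · refine euclideanHausdorffMeasure_image_le_of_edist_le (fun y hy z hz => ?_) _
    have h1 : ‖L y - L z‖ ≤ ((1 - ε)⁻¹ : ℝ≥0) * ‖f y - f z‖ := by
      have h2 := hb y hy z hz
      have h3 := norm_sub_le (f y - f z) (f y - f z - L (y - z))
      rw [sub_sub_cancel] at h3
      rw [map_sub] at h2 h3
      have h4 : (0 : ℝ) < 1 - ε := by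
        have : (ε : ℝ) < 1 := by exact_mod_cast hε1
        linarith
      rw [NNReal.coe_inv, NNReal.coe_sub hε1.le, NNReal.coe_one, ← div_eq_inv_mul,
        le_div_iff₀ h4]
      nlinarith
    rw [edist_eq_enorm_sub, edist_eq_enorm_sub, enorm_eq_nnnorm, enorm_eq_nnnorm]
    exact_mod_cast h1

/-- Area formula for `C¹` embeddings of Euclidean spaces. -/
theorem comap_euclideanHausdorffMeasure {f : V → E} (hf : ContDiff ℝ 1 f)
    (hinj : ∀ x, Function.Injective (fderiv ℝ f x)) (hemb : MeasurableEmbedding f) :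
    (Measure.euclideanHausdorffMeasure (Module.finrank ℝ V)).comap f =
      volume.withDensity fun x => ENNReal.ofReal (fderiv ℝ f x : V →ₗ[ℝ] E).normDet := by
  set d := Module.finrank ℝ V
  set ρ := (Measure.euclideanHausdorffMeasure d : Measure E).comap f with hρ
  have hst : ∀ x, HasStrictFDerivAt f (fderiv ℝ f x) x := fun x =>
    hf.contDiffAt.hasStrictFDerivAt (by norm_num)
  have happ : ∀ s, ρ s = Measure.euclideanHausdorffMeasure d (f '' s) := fun s =>
    hemb.comap_apply _ s
  -- Local finiteness lets the Besicovitch differentiation theorem apply to `ρ`; absolute continuity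
  -- then recovers `ρ` from its density. Any fixed `ε < 1` does for both.
  have hloc : IsLocallyFiniteMeasure ρ := by
    refine ⟨fun x => ?_⟩
    obtain ⟨U, hU, hUs⟩ := image_measure_bounds_of_hasStrictFDerivAt (hst x) (hinj x)
      (ε := 2⁻¹) (by norm_num) (by rw [← NNReal.coe_lt_coe]; norm_num)
    refine ⟨U ∩ Metric.ball x 1, inter_mem hU (Metric.ball_mem_nhds x one_pos), ?_⟩
    rw [happ]
    refine (hUs _ inter_subset_left).1.trans_lt ?_
    refine ENNReal.mul_lt_top (by finiteness) (ENNReal.mul_lt_top (by finiteness) ?_)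
    exact (measure_mono inter_subset_right).trans_lt measure_ball_lt_top
  have hac : ρ ≪ volume := by
    intro s hs
    refine measure_null_of_locally_null s fun x _ => ?_
    obtain ⟨U, hU, hUs⟩ := image_measure_bounds_of_hasStrictFDerivAt (hst x) (hinj x)
      (ε := 2⁻¹) (by norm_num) (by rw [← NNReal.coe_lt_coe]; norm_num)
    refine ⟨s ∩ U, inter_mem self_mem_nhdsWithin (mem_nhdsWithin_of_mem_nhds hU), ?_⟩
    rw [happ]
    have := (hUs (s ∩ U) inter_subset_right).1
    rw [measure_mono_null inter_subset_left hs] at this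
    simpa using this
  -- The density is almost everywhere the limit of `ρ a / volume a` along the Vitali family. These
  -- ratios lie between `(1 - ε)^d c` and `(1 + ε)^d c` for every small `ε`, so the limit is `c`.
  have hrn : ρ.rnDeriv volume =ᵐ[volume]
      fun x => ENNReal.ofReal (fderiv ℝ f x : V →ₗ[ℝ] E).normDet := by
    let v := Besicovitch.vitaliFamily (volume : Measure V)
    filter_upwards [v.ae_tendsto_rnDeriv ρ] with x hx
    refine tendsto_nhds_unique hx ?_
    set c := ENNReal.ofReal (fderiv ℝ f x : V →ₗ[ℝ] E).normDet
    have hc : c ≠ ∞ := by finiteness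
    have hev : ∀ {ε : ℝ≥0}, 0 < ε → ε < 1 → ∀ᶠ a in v.filterAt x,
        ρ a / volume a ≤ ((1 + ε : ℝ≥0) : ℝ≥0∞) ^ d * c ∧
        ((1 - ε : ℝ≥0) : ℝ≥0∞) ^ d * c ≤ ρ a / volume a := by
      intro ε hε hε1
      obtain ⟨U, hU, hUs⟩ := image_measure_bounds_of_hasStrictFDerivAt (hst x) (hinj x) hε hε1
      filter_upwards [v.eventually_filterAt_subset_of_nhds hU,
        v.eventually_filterAt_subset_closedBall x one_pos,
        v.eventually_filterAt_mem_setsAt x] with a ha ha1 ha2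
      have hpos : volume a ≠ 0 := by
        have := v.nonempty_interior x a ha2
        exact ((isOpen_interior.measure_pos volume this).trans_le (measure_mono interior_subset)).ne'
      have hfin : volume a ≠ ∞ :=
        ((measure_mono ha1).trans_lt measure_closedBall_lt_top).ne
      rw [happ]
      obtain ⟨h1, h2⟩ := hUs a ha
      constructor
      · rw [ENNReal.div_le_iff hpos hfin, mul_assoc]
        exact h1
      · rw [ENNReal.le_div_iff_mul_le (Or.inl hpos) (Or.inl hfin), mul_assoc]
        have h3 : (1 - ε : ℝ≥0) ≠ 0 := (tsub_pos_of_lt hε1).ne'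
        calc ((1 - ε : ℝ≥0) : ℝ≥0∞) ^ d * (c * volume a)
            ≤ ((1 - ε : ℝ≥0) : ℝ≥0∞) ^ d * ((((1 - ε)⁻¹ : ℝ≥0) : ℝ≥0∞) ^ d *
              Measure.euclideanHausdorffMeasure d (f '' a)) := by gcongr
          _ = Measure.euclideanHausdorffMeasure d (f '' a) := by
              rw [← mul_assoc, ← mul_pow, ← ENNReal.coe_mul, mul_inv_cancel₀ h3]
              simp
    have hup : Tendsto (fun ε : ℝ≥0 => ((1 + ε : ℝ≥0) : ℝ≥0∞) ^ d * c) (𝓝[>] 0) (𝓝 c) := by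
      have h1 : Tendsto (fun ε : ℝ≥0 => (((1 + ε) ^ d : ℝ≥0) : ℝ≥0∞) * c) (𝓝 0)
          (𝓝 ((((1 + 0) ^ d : ℝ≥0) : ℝ≥0∞) * c)) := by
        refine ENNReal.Tendsto.mul_const ?_ (Or.inr hc)
        exact (ENNReal.continuous_coe.comp (by fun_prop :
          Continuous fun ε : ℝ≥0 => (1 + ε) ^ d)).tendsto 0
      simpa using h1.mono_left nhdsWithin_le_nhds
    have hlow : Tendsto (fun ε : ℝ≥0 => ((1 - ε : ℝ≥0) : ℝ≥0∞) ^ d * c) (𝓝[>] 0) (𝓝 c) := by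
      have h1 : Tendsto (fun ε : ℝ≥0 => (((1 - ε) ^ d : ℝ≥0) : ℝ≥0∞) * c) (𝓝 0)
          (𝓝 ((((1 - 0) ^ d : ℝ≥0) : ℝ≥0∞) * c)) := by
        refine ENNReal.Tendsto.mul_const ?_ (Or.inr hc)
        exact (ENNReal.continuous_coe.comp (by fun_prop :
          Continuous fun ε : ℝ≥0 => (1 - ε) ^ d)).tendsto 0
      simpa using h1.mono_left nhdsWithin_le_nhds
    have hsmall : ∀ᶠ ε : ℝ≥0 in 𝓝[>] 0, 0 < ε ∧ ε < 1 :=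
      inter_mem self_mem_nhdsWithin (mem_nhdsWithin_of_mem_nhds (Iio_mem_nhds one_pos))
    refine tendsto_order.2 ⟨fun b hb => ?_, fun b hb => ?_⟩
    · obtain ⟨ε, hε, hε0, hε1⟩ := ((hlow.eventually_const_lt hb).and hsmall).exists
      filter_upwards [hev hε0 hε1] with a ha using hε.trans_le ha.2
    · obtain ⟨ε, hε, hε0, hε1⟩ := ((hup.eventually_lt_const hb).and hsmall).exists
      filter_upwards [hev hε0 hε1] with a ha using ha.1.trans_lt hε
  rw [← Measure.withDensity_rnDeriv_eq ρ volume hac]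
  exact withDensity_congr_ae hrn

end AreaFormula

end RobinTorsion

namespace RobinTorsion

open scoped ENNReal NNReal

/-! ### Graphs over a hyperplane and their area element -/

section Graph

variable {E : Type*} [NormedAddCommGroup E] [InnerProductSpace ℝ E]

/-- The parametrization `v ↦ v + g(v) e` of the graph of `g` over the hyperplane `e^⊥`. -/
def graphMap (e : E) (g : (ℝ ∙ e)ᗮ → ℝ) (v : (ℝ ∙ e)ᗮ) : E := (v : E) + g v • e

/-- The orthogonal projection onto the hyperplane `e^⊥`. -/
noncomputable def hyperProj (e : E) : E →L[ℝ] (ℝ ∙ e)ᗮ :=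
  (ℝ ∙ e)ᗮ.orthogonalProjectionOnto

variable {e : E} {g : (ℝ ∙ e)ᗮ → ℝ}

theorem inner_coe_hyperplane (v : (ℝ ∙ e)ᗮ) : inner ℝ e (v : E) = 0 :=
  Submodule.mem_orthogonal_singleton_iff_inner_right.1 v.2

theorem inner_coe_hyperplane' (v : (ℝ ∙ e)ᗮ) : inner ℝ (v : E) e = 0 :=
  Submodule.mem_orthogonal_singleton_iff_inner_left.1 v.2

theorem hyperProj_coe (v : (ℝ ∙ e)ᗮ) : hyperProj e (v : E) = v :=
  Submodule.orthogonalProjectionOnto_mem_subspace_eq_self v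

theorem hyperProj_self : hyperProj e e = 0 :=
  Submodule.orthogonalProjectionOnto_orthogonalComplement_singleton_eq_zero e

theorem inner_hyperProj (v : (ℝ ∙ e)ᗮ) (y : E) :
    inner ℝ v (hyperProj e y) = inner ℝ (v : E) y := by
  rw [hyperProj, Submodule.inner_orthogonalProjectionOnto_eq_of_mem_left]

theorem coe_hyperProj_add (he : ‖e‖ = 1) (y : E) :
    (hyperProj e y : E) + (inner ℝ e y : ℝ) • e = y := by
  have h := (ℝ ∙ e).starProjection_orthogonal_val y
  rw [Submodule.starProjection_unit_singleton ℝ he] at h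
  exact eq_sub_iff_add_eq.1 h

theorem inner_self_of_norm_one (he : ‖e‖ = 1) : inner ℝ e e = (1 : ℝ) := by
  rw [real_inner_self_eq_norm_sq, he, one_pow]

theorem inner_graphMap (he : ‖e‖ = 1) (v : (ℝ ∙ e)ᗮ) : inner ℝ e (graphMap e g v) = g v := by
  rw [graphMap, inner_add_right, inner_coe_hyperplane, inner_smul_right,
    inner_self_of_norm_one he]
  ring

theorem hyperProj_graphMap (v : (ℝ ∙ e)ᗮ) : hyperProj e (graphMap e g v) = v := by
  rw [graphMap, map_add, hyperProj_coe, map_smul, hyperProj_self, smul_zero, add_zero]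

theorem mem_range_graphMap (he : ‖e‖ = 1) {y : E} :
    y ∈ range (graphMap e g) ↔ inner ℝ e y = g (hyperProj e y) := by
  constructor
  · rintro ⟨v, rfl⟩
    rw [inner_graphMap he, hyperProj_graphMap]
  · intro h
    exact ⟨hyperProj e y, by rw [graphMap, ← h, coe_hyperProj_add he]⟩

theorem continuous_graphMap (hg : Continuous g) : Continuous (graphMap e g) := by
  unfold graphMap; fun_prop

theorem isClosedEmbedding_graphMap (hg : Continuous g) : IsClosedEmbedding (graphMap e g) :=
  Function.LeftInverse.isClosedEmbedding (f := hyperProj e) hyperProj_graphMap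
    (hyperProj e).continuous (continuous_graphMap hg)

theorem contDiff_graphMap {n : WithTop ℕ∞} (hg : ContDiff ℝ n g) :
    ContDiff ℝ n (graphMap e g) :=
  ((ℝ ∙ e)ᗮ.subtypeL.contDiff).add (hg.smul contDiff_const)

variable [FiniteDimensional ℝ E]

/-- The upward normal `e - ∇g` of the graph of `g`. -/
noncomputable def graphNormal (e : E) (g : (ℝ ∙ e)ᗮ → ℝ) (v : (ℝ ∙ e)ᗮ) : E :=
  e - ((gradient g v : (ℝ ∙ e)ᗮ) : E)

theorem norm_graphNormal_sq (he : ‖e‖ = 1) (v : (ℝ ∙ e)ᗮ) :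
    ‖graphNormal e g v‖ ^ 2 = 1 + ‖gradient g v‖ ^ 2 := by
  rw [graphNormal, norm_sub_sq_real, inner_coe_hyperplane, he, Submodule.coe_norm]
  ring

theorem norm_graphNormal_pos (he : ‖e‖ = 1) (v : (ℝ ∙ e)ᗮ) : 0 < ‖graphNormal e g v‖ := by
  have := norm_graphNormal_sq (g := g) he v
  by_contra! h
  have h0 : ‖graphNormal e g v‖ = 0 := le_antisymm h (norm_nonneg _)
  rw [h0] at this
  nlinarith [sq_nonneg ‖gradient g v‖]

/-- The derivative of `graphMap`. -/
noncomputable def graphDeriv (e : E) (g : (ℝ ∙ e)ᗮ → ℝ) (v : (ℝ ∙ e)ᗮ) : (ℝ ∙ e)ᗮ →L[ℝ] E :=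
  (ℝ ∙ e)ᗮ.subtypeL + (innerSL ℝ (gradient g v)).smulRight e

theorem graphDeriv_apply (v k : (ℝ ∙ e)ᗮ) :
    graphDeriv e g v k = (k : E) + (inner ℝ (gradient g v) k : ℝ) • e := rfl

theorem hasFDerivAt_graphMap {v : (ℝ ∙ e)ᗮ} (hg : DifferentiableAt ℝ g v) :
    HasFDerivAt (graphMap e g) (graphDeriv e g v) v := by
  have h := hg.hasGradientAt.hasFDerivAt
  exact ((ℝ ∙ e)ᗮ.subtypeL.hasFDerivAt).add (h.smul_const e)

theorem injective_graphDeriv (v : (ℝ ∙ e)ᗮ) : Function.Injective (graphDeriv e g v) := by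
  intro k l h
  have := congrArg (hyperProj e) h
  simpa [graphDeriv_apply, hyperProj_coe, hyperProj_self] using this

theorem inner_graphNormal_graphDeriv (he : ‖e‖ = 1) (v k : (ℝ ∙ e)ᗮ) :
    inner ℝ (graphNormal e g v) (graphDeriv e g v k) = (0 : ℝ) := by
  rw [graphNormal, graphDeriv_apply, inner_sub_left, inner_add_right, inner_add_right,
    inner_smul_right, inner_smul_right, inner_coe_hyperplane, inner_coe_hyperplane',
    inner_self_of_norm_one he, Submodule.coe_inner]
  ring

/-- The Gram operator of the parametrization is the identity plus the rank-one operator `∇g ⊗ ∇g`.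
This is a transvection of determinant `1 + |∇g|²`, the squared length of `e - ∇g`. -/
theorem normDet_graphDeriv (he : ‖e‖ = 1) (v : (ℝ ∙ e)ᗮ) :
    (graphDeriv e g v : (ℝ ∙ e)ᗮ →ₗ[ℝ] E).normDet = ‖graphNormal e g v‖ := by
  rw [← sq_eq_sq₀ (LinearMap.normDet_nonneg _) (norm_nonneg _), norm_graphNormal_sq he]
  have h := LinearMap.normDet_sq (graphDeriv e g v : (ℝ ∙ e)ᗮ →ₗ[ℝ] E)
  have h2 : (graphDeriv e g v : (ℝ ∙ e)ᗮ →ₗ[ℝ] E).adjoint ∘ₗ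
      (graphDeriv e g v : (ℝ ∙ e)ᗮ →ₗ[ℝ] E) =
      LinearMap.transvection (innerSL ℝ (gradient g v) : (ℝ ∙ e)ᗮ →ₗ[ℝ] ℝ) (gradient g v) := by
    ext1 k
    refine ext_inner_left ℝ fun l => ?_
    rw [LinearMap.comp_apply, LinearMap.adjoint_inner_right, LinearMap.transvection.apply,
      inner_add_right, inner_smul_right]
    simp only [ContinuousLinearMap.coe_coe, graphDeriv_apply, innerSL_apply_apply]
    rw [inner_add_left, inner_add_right, inner_add_right, inner_smul_left, inner_smul_left,
      inner_smul_right, inner_smul_right, inner_coe_hyperplane, inner_coe_hyperplane',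
      inner_self_of_norm_one he, Submodule.coe_inner, real_inner_comm l]
    simp
    ring
  rw [h2, LinearMap.transvection.det] at h
  simpa using h

variable [MeasurableSpace E] [BorelSpace E]

/-- The surface measure of a graph. -/
theorem euclideanHausdorffMeasure_restrict_range_graphMap (he : ‖e‖ = 1) (hg : ContDiff ℝ 1 g) :
    (Measure.euclideanHausdorffMeasure (Module.finrank ℝ (ℝ ∙ e)ᗮ)).restrict
        (range (graphMap e g)) =
      (volume.withDensity fun v => ENNReal.ofReal ‖graphNormal e g v‖).map (graphMap e g) := by
  have hemb := (isClosedEmbedding_graphMap hg.continuous).measurableEmbedding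
  have hd : ∀ v, fderiv ℝ (graphMap e g) v = graphDeriv e g v := fun v =>
    (hasFDerivAt_graphMap (hg.differentiable (by norm_num) v)).fderiv
  have h := comap_euclideanHausdorffMeasure (contDiff_graphMap hg)
    (fun v => by rw [hd]; exact injective_graphDeriv v) hemb
  simp only [hd, normDet_graphDeriv he] at h
  rw [← h, hemb.map_comap]

end Graph

end RobinTorsion

namespace RobinTorsion

open scoped ENNReal NNReal

/-! ### Graph charts of a domain with `C²` boundary -/

section Chart

variable {E : Type*} [NormedAddCommGroup E] [InnerProductSpace ℝ E]

/-- In the open set `U`, the set `Ω` is the region strictly below the graph of the `C²` function `g`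
over the hyperplane `e^⊥`. -/
structure IsGraphChart (Ω : Set E) (e : E) (g : (ℝ ∙ e)ᗮ → ℝ) (U : Set E) : Prop where
  norm_eq_one : ‖e‖ = 1
  contDiff : ContDiff ℝ 2 g
  isOpen : IsOpen U
  mem_iff : ∀ y ∈ U, (y ∈ Ω ↔ inner ℝ e y < g (hyperProj e y))

namespace IsGraphChart

variable {Ω U : Set E} {e : E} {g : (ℝ ∙ e)ᗮ → ℝ}

theorem tendsto_add_smul (e y : E) : Tendsto (fun s : ℝ => y + s • e) (𝓝 0) (𝓝 y) := by
  have : Continuous fun s : ℝ => y + s • e := by fun_prop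
  simpa using this.tendsto 0

theorem continuous_height (h : IsGraphChart Ω e g U) :
    Continuous fun y : E => g (hyperProj e y) :=
  h.contDiff.continuous.comp (hyperProj e).continuous

theorem hyperProj_add_smul (y : E) (s : ℝ) : hyperProj e (y + s • e) = hyperProj e y := by
  rw [map_add, map_smul, hyperProj_self, smul_zero, add_zero]

theorem inner_add_smul (he : ‖e‖ = 1) (y : E) (s : ℝ) :
    inner ℝ e (y + s • e) = (inner ℝ e y : ℝ) + s := by
  rw [inner_add_right, inner_smul_right, inner_self_of_norm_one he, mul_one]

theorem mem_closure_iff (h : IsGraphChart Ω e g U) {y : E} (hy : y ∈ U) :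
    y ∈ closure Ω ↔ inner ℝ e y ≤ g (hyperProj e y) := by
  constructor
  · intro hc
    by_contra! hlt
    have h1 : ∀ᶠ z in 𝓝 y, g (hyperProj e z) < inner ℝ e z :=
      (h.continuous_height.tendsto y).eventually_lt
        ((continuous_const.inner continuous_id).tendsto y) hlt
    obtain ⟨z, ⟨hz1, hz2⟩, hz3⟩ :=
      mem_closure_iff_nhds.1 hc _ (inter_mem h1 (h.isOpen.mem_nhds hy))
    exact absurd ((h.mem_iff z hz2).1 hz3) (not_lt.2 (le_of_lt hz1))
  · intro hle
    -- Sliding down along `-e` keeps the horizontal projection and strictly lowers the height, so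
    -- points on or below the graph are limits of points of `Ω`.
    have ht : Tendsto (fun s : ℝ => y + s • e) (𝓝[<] 0) (𝓝 y) :=
      (tendsto_add_smul e y).mono_left nhdsWithin_le_nhds
    refine mem_closure_of_tendsto ht ?_
    filter_upwards [self_mem_nhdsWithin, ht (h.isOpen.mem_nhds hy)] with s hs hsU
    rw [h.mem_iff _ hsU, hyperProj_add_smul, inner_add_smul h.norm_eq_one]
    have : s < 0 := hs
    linarith

theorem mem_frontier_iff (h : IsGraphChart Ω e g U) (hΩ : IsOpen Ω) {y : E} (hy : y ∈ U) :
    y ∈ frontier Ω ↔ inner ℝ e y = g (hyperProj e y) := by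
  rw [hΩ.frontier_eq, Set.mem_sdiff, h.mem_closure_iff hy, h.mem_iff y hy, not_lt]
  exact ⟨fun hh => le_antisymm hh.1 hh.2, fun hh => ⟨hh.le, hh.ge⟩⟩

theorem frontier_inter (h : IsGraphChart Ω e g U) (hΩ : IsOpen Ω) :
    frontier Ω ∩ U = range (graphMap e g) ∩ U := by
  ext y
  refine and_congr_left fun hy => ?_
  rw [h.mem_frontier_iff hΩ hy, mem_range_graphMap h.norm_eq_one]

theorem graphMap_mem_frontier (h : IsGraphChart Ω e g U) (hΩ : IsOpen Ω) {v : (ℝ ∙ e)ᗮ}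
    (hv : graphMap e g v ∈ U) : graphMap e g v ∈ frontier Ω :=
  ((h.frontier_inter hΩ).symm.subset ⟨mem_range_self v, hv⟩).1

theorem eventually_mem (h : IsGraphChart Ω e g U) {v : (ℝ ∙ e)ᗮ}
    (hv : graphMap e g v ∈ U) : ∀ᶠ w in 𝓝 v, graphMap e g w ∈ U :=
  (continuous_graphMap h.contDiff.continuous).continuousAt (h.isOpen.mem_nhds hv)

end IsGraphChart

variable [CompleteSpace E]

/-- A set that is locally the negative set of a `C²` function with nonzero gradient is locally the
region below a graph. -/
theorem exists_isGraphChart {Ω : Set E} {ρ : E → ℝ} {x : E} (hρ : ContDiffAt ℝ 2 ρ x)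
    (hgrad : gradient ρ x ≠ 0) (h0 : ρ x = 0) (hmem : ∀ᶠ y in 𝓝 x, (y ∈ Ω ↔ ρ y < 0)) :
    ∃ (e : E) (g : (ℝ ∙ e)ᗮ → ℝ) (U : Set E), IsGraphChart Ω e g U ∧ x ∈ U := by
  set e : E := ‖gradient ρ x‖⁻¹ • gradient ρ x with he_def
  have hnpos : 0 < ‖gradient ρ x‖ := norm_pos_iff.2 hgrad
  have he : ‖e‖ = 1 := by
    rw [he_def, norm_smul, norm_inv, norm_norm, inv_mul_cancel₀ hnpos.ne']
  have hst : HasStrictFDerivAt ρ (fderiv ℝ ρ x) x := hρ.hasStrictFDerivAt (by norm_num)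
  have hde : fderiv ℝ ρ x e = ‖gradient ρ x‖ := by
    rw [← inner_gradient_left, he_def, inner_smul_right, real_inner_self_eq_norm_sq]
    field_simp
  set lam := ‖gradient ρ x‖
  let T : (ℝ ∙ e)ᗮ × ℝ →L[ℝ] E :=
    ((ℝ ∙ e)ᗮ.subtypeL.comp (ContinuousLinearMap.fst ℝ _ ℝ)) +
      (ContinuousLinearMap.snd ℝ _ ℝ).smulRight e
  have hT : ∀ v t, T (v, t) = (v : E) + t • e := fun v t => rfl
  set u0 : (ℝ ∙ e)ᗮ × ℝ := (hyperProj e x, inner ℝ e x) with hu0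
  have hTu : T u0 = x := coe_hyperProj_add he x
  have hf : ContDiffAt ℝ 2 (ρ ∘ T) u0 := by
    refine ContDiffAt.comp u0 ?_ T.contDiff.contDiffAt
    rw [hTu]; exact hρ
  have hfd : fderiv ℝ (ρ ∘ T) u0 = (fderiv ℝ ρ x).comp T := by
    have h1 : HasFDerivAt ρ (fderiv ℝ ρ x) (T u0) := by rw [hTu]; exact hst.hasFDerivAt
    exact (h1.comp u0 T.hasFDerivAt).fderiv
  have hinv : (fderiv ℝ (ρ ∘ T) u0 ∘L .inr ℝ (ℝ ∙ e)ᗮ ℝ).IsInvertible := by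
    refine ⟨ContinuousLinearEquiv.unitsEquivAut ℝ (Units.mk0 lam hnpos.ne'), ?_⟩
    rw [hfd]
    ext
    simp [T, hde]
  have h2 : (2 : WithTop ℕ∞) ≠ 0 := by norm_num
  -- In the coordinates `v + t e` the `t`-derivative of `ρ` at `x` is `lam = |∇ρ(x)| > 0`, so the
  -- zero set is locally the graph of `ψ`.
  set ψ := hf.implicitFunction h2 hinv with hψ
  have hψ0 : ψ u0.1 = u0.2 := hf.implicitFunction_apply_self h2 hinv
  have hψz : ∀ᶠ v : (ℝ ∙ e)ᗮ in 𝓝 u0.1, ρ ((v : E) + ψ v • e) = 0 := by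
    filter_upwards [hf.eventually_apply_implicitFunction h2 hinv] with v hv
    have : ρ (T (v, ψ v)) = ρ (T u0) := hv
    rw [hTu, h0] at this
    exact this
  have hψC : ContDiffAt ℝ 2 ψ u0.1 := hf.contDiffAt_implicitFunction h2 hinv
  obtain ⟨B, hB, hBC⟩ := hψC.contDiffOn (m := 2) le_rfl (by simp)
  obtain ⟨r, hr, hrB⟩ := Metric.nhds_basis_closedBall.mem_iff.1 (interior_mem_nhds.2 hB)
  -- `ψ` is `C²` only near the base point; the cutoff makes `χ ψ` globally `C²` without changing it
  -- there.
  let χ : ContDiffBump u0.1 := ⟨r / 2, r, half_pos hr, half_lt_self hr⟩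
  have hχ1 : ∀ᶠ v in 𝓝 u0.1, χ v = 1 := χ.eventuallyEq_one
  refine ⟨e, fun v => χ v * ψ v, ?_⟩
  have hgC : ContDiff ℝ 2 fun v => χ v * ψ v := by
    rw [contDiff_iff_contDiffAt]
    intro v
    by_cases hv : v ∈ tsupport χ
    · rw [χ.tsupport_eq] at hv
      exact χ.contDiff.contDiffAt.mul (hBC.contDiffAt (mem_interior_iff_mem_nhds.1 (hrB hv)))
    · have : (fun v => χ v * ψ v) =ᶠ[𝓝 v] fun _ => 0 := by
        filter_upwards [notMem_tsupport_iff_eventuallyEq.1 hv] with w hw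
        rw [hw, Pi.zero_apply, zero_mul]
      exact contDiffAt_const.congr_of_eventuallyEq this
  have hev : ∀ᶠ y in 𝓝 x, (y ∈ Ω ↔ inner ℝ e y < χ (hyperProj e y) * ψ (hyperProj e y)) := by
    -- Compare `y` with the point of the zero set on the same vertical line, at signed height
    -- difference `d`. Strict differentiability gives `|ρ y - lam d| ≤ (lam / 2)|d|`, so `ρ y` and
    -- `d` have the same sign.
    have hlo := (hasStrictFDerivAt_iff_isLittleO.1 hst).bound (half_pos hnpos)
    have hπ : Tendsto (hyperProj e) (𝓝 x) (𝓝 u0.1) := (hyperProj e).continuous.tendsto x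
    have hΨ : Tendsto (fun y => ((hyperProj e y : (ℝ ∙ e)ᗮ) : E) + ψ (hyperProj e y) • e)
        (𝓝 x) (𝓝 x) := by
      have h3 : ContinuousAt (fun v : (ℝ ∙ e)ᗮ => (v : E) + ψ v • e) u0.1 :=
        (continuous_subtype_val.continuousAt).add (hψC.continuousAt.smul continuousAt_const)
      have h4 := h3.tendsto.comp hπ
      have h5 : (u0.1 : E) + ψ u0.1 • e = x := by rw [hψ0]; exact hTu
      rw [h5] at h4
      exact h4
    have hpair := (tendsto_id (x := 𝓝 x)).prodMk_nhds hΨ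
    filter_upwards [hmem, hπ.eventually hχ1, hπ.eventually hψz, hpair.eventually hlo]
      with y hy1 hy2 hy3 hy4
    rw [hy1, hy2, one_mul]
    simp only [id] at hy4
    have h6 : y - (((hyperProj e y : (ℝ ∙ e)ᗮ) : E) + ψ (hyperProj e y) • e) =
        ((inner ℝ e y : ℝ) - ψ (hyperProj e y)) • e := by
      conv_lhs => enter [1]; rw [← coe_hyperProj_add he y]
      rw [sub_smul]; abel
    rw [h6, hy3, map_smul, hde, norm_smul, he, mul_one, sub_zero, smul_eq_mul,
      Real.norm_eq_abs, Real.norm_eq_abs] at hy4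
    set d := (inner ℝ e y : ℝ) - ψ (hyperProj e y)
    have h7 : inner ℝ e y < ψ (hyperProj e y) ↔ d < 0 := sub_neg.symm
    rw [h7]
    obtain ⟨h8, h9⟩ := abs_le.1 hy4
    constructor
    · intro hneg
      by_contra! hd
      rw [abs_of_nonneg hd] at h8
      nlinarith
    · intro hneg
      rw [abs_of_neg hneg] at h9
      nlinarith
  obtain ⟨U, hU, hUo, hxU⟩ := mem_nhds_iff.1 hev
  exact ⟨U, ⟨he, hgC, hUo, fun y hy => hU hy⟩, hxU⟩

end Chart

end RobinTorsion

namespace RobinTorsion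

open scoped ENNReal NNReal

/-! ### Traces and divergence -/

section Trace

variable {E : Type*} [NormedAddCommGroup E] [InnerProductSpace ℝ E] [FiniteDimensional ℝ E]

/-- The trace as a continuous linear functional. -/
noncomputable def opTrace : (E →L[ℝ] E) →L[ℝ] ℝ :=
  LinearMap.toContinuousLinearMap ((LinearMap.trace ℝ E) ∘ₗ (ContinuousLinearMap.coeLM ℝ))

theorem opTrace_apply (A : E →L[ℝ] E) :
    opTrace A = LinearMap.trace ℝ E (A : E →ₗ[ℝ] E) := rfl

theorem opTrace_eq_sum {ι : Type*} [Fintype ι] (b : OrthonormalBasis ι ℝ E) (A : E →L[ℝ] E) :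
    opTrace A = ∑ i, inner ℝ (b i) (A (b i)) := by
  rw [opTrace_apply, LinearMap.trace_eq_sum_inner _ b]; rfl

theorem opTrace_smulRight (f : E →L[ℝ] ℝ) (x : E) : opTrace (f.smulRight x) = f x := by
  rw [opTrace_apply]
  exact LinearMap.trace_smulRight (f : E →ₗ[ℝ] ℝ) x

/-- The divergence of a vector field. -/
noncomputable def divergence (F : E → E) (x : E) : ℝ := opTrace (fderiv ℝ F x)

variable {e : E}

theorem opTrace_hyperplane_comp (M : (ℝ ∙ e)ᗮ →L[ℝ] E) :
    opTrace (M.comp (hyperProj e)) = opTrace ((hyperProj e).comp M) := by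
  rw [opTrace_apply, opTrace_apply]
  exact LinearMap.trace_comp_comm' ((hyperProj e : E →L[ℝ] _) : E →ₗ[ℝ] _)
    (M : (ℝ ∙ e)ᗮ →ₗ[ℝ] E)

theorem opTrace_eq_hyperplane_add (he : ‖e‖ = 1) (A : E →L[ℝ] E) :
    opTrace A = opTrace ((hyperProj e).comp (A.comp (ℝ ∙ e)ᗮ.subtypeL)) + inner ℝ e (A e) := by
  have h : A = (A.comp (ℝ ∙ e)ᗮ.subtypeL).comp (hyperProj e) + (innerSL ℝ e).smulRight (A e) := by
    ext y
    conv_lhs => rw [← coe_hyperProj_add he y, map_add, map_smul]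
    rfl
  conv_lhs => rw [h, map_add, opTrace_hyperplane_comp, opTrace_smulRight]
  rfl

variable {g : (ℝ ∙ e)ᗮ → ℝ}

theorem opTrace_comp_graphDeriv (L : E →L[ℝ] E) (v : (ℝ ∙ e)ᗮ) :
    opTrace ((hyperProj e).comp (L.comp (graphDeriv e g v))) =
      opTrace ((hyperProj e).comp (L.comp (ℝ ∙ e)ᗮ.subtypeL)) +
        inner ℝ ((gradient g v : (ℝ ∙ e)ᗮ) : E) (L e) := by
  have h : (hyperProj e).comp (L.comp (graphDeriv e g v)) =
      (hyperProj e).comp (L.comp (ℝ ∙ e)ᗮ.subtypeL) +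
        (innerSL ℝ (gradient g v)).smulRight (hyperProj e (L e)) := by
    ext1 k
    simp [graphDeriv_apply]
  rw [h, map_add, opTrace_smulRight, innerSL_apply_apply, inner_hyperProj]

/-- This splits the divergence in coordinates adapted to the graph: the first term is the
divergence, within a sheet of constant depth, of the horizontal part of the field; the second is the
derivative along `e` of its component along `e - ∇g`, since that normal does not depend on the
depth. -/
theorem opTrace_eq_graph (he : ‖e‖ = 1) (L : E →L[ℝ] E) (v : (ℝ ∙ e)ᗮ) :
    opTrace L = opTrace ((hyperProj e).comp (L.comp (graphDeriv e g v))) +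
      inner ℝ (graphNormal e g v) (L e) := by
  rw [opTrace_comp_graphDeriv, opTrace_eq_hyperplane_add he, graphNormal, inner_sub_left]
  ring

end Trace

/-! ### Compactly supported fields on a Euclidean space -/

section FlatDivergence

variable {V : Type*} [NormedAddCommGroup V] [InnerProductSpace ℝ V] [FiniteDimensional ℝ V]
  [MeasurableSpace V] [BorelSpace V]

/-- Each diagonal entry of the trace is a directional derivative of a compactly supported function;
integrating by parts against the constant field `b i` shows that its integral vanishes. -/
theorem integral_opTrace_eq_zero {Z : V → V} {Z' : V → V →L[ℝ] V}
    (h : ∀ v, HasFDerivAt Z (Z' v) v) (hc : HasCompactSupport Z) (hZ' : Continuous Z') :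
    ∫ v, opTrace (Z' v) = 0 := by
  have hZ'c : HasCompactSupport Z' := by
    have : Z' = fderiv ℝ Z := funext fun v => (h v).fderiv.symm
    rw [this]; exact hc.fderiv ℝ
  have hZ : Continuous Z := continuous_iff_continuousAt.2 fun v => (h v).continuousAt
  let b := stdOrthonormalBasis ℝ V
  have hcomp : ∀ i, ∫ v, inner ℝ (b i) (Z' v (b i)) = 0 := by
    intro i
    have hint : Integrable fun v => Z' v (b i) := by
      refine Continuous.integrable_of_hasCompactSupport (by fun_prop) ?_
      exact hZ'c.comp_left (g := fun A : V →L[ℝ] V => A (b i)) (by simp)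
    have h1 := integral_bilinear_hasFDerivAt_right_eq_neg_left_of_integrable (μ := volume)
      (f := fun _ : V => b i) (f' := fun _ => 0) (g := Z) (g' := Z') (v := b i)
      (B := innerSL ℝ) (by simp)
      (hint.const_inner (𝕜 := ℝ) (b i))
      ((hZ.integrable_of_hasCompactSupport hc).const_inner (𝕜 := ℝ) (b i))
      (fun x _ => hasFDerivAt_const _ _) (fun x _ => h x)
    have h2 : ∫ v, inner ℝ (b i) (Z' v (b i)) =
        -∫ v, inner ℝ ((0 : V →L[ℝ] V) (b i)) (Z v) := h1
    simpa using h2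
  have hint : ∀ i, Integrable fun v => inner ℝ (b i) (Z' v (b i)) := by
    intro i
    refine Integrable.const_inner (𝕜 := ℝ) (b i) ?_
    refine Continuous.integrable_of_hasCompactSupport (by fun_prop) ?_
    exact hZ'c.comp_left (g := fun A : V →L[ℝ] V => A (b i)) (by simp)
  simp_rw [opTrace_eq_sum b]
  rw [integral_finsetSum _ fun i _ => hint i]
  exact Finset.sum_eq_zero fun i _ => hcomp i

end FlatDivergence

/-! ### The divergence theorem below a graph -/

section Subgraph

variable {E : Type*} [NormedAddCommGroup E] [InnerProductSpace ℝ E]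

/-- Coordinates `(v, s) ↦ v + (g(v) - s) e` adapted to the region below the graph of `g`. -/
def graphCoord (e : E) (g : (ℝ ∙ e)ᗮ → ℝ) (p : (ℝ ∙ e)ᗮ × ℝ) : E :=
  graphMap e g p.1 - p.2 • e

variable {e : E} {g : (ℝ ∙ e)ᗮ → ℝ}

theorem inner_graphCoord (he : ‖e‖ = 1) (p : (ℝ ∙ e)ᗮ × ℝ) :
    inner ℝ e (graphCoord e g p) = g p.1 - p.2 := by
  rw [graphCoord, inner_sub_right, inner_graphMap he, inner_smul_right,
    inner_self_of_norm_one he, mul_one]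

theorem hyperProj_graphCoord (p : (ℝ ∙ e)ᗮ × ℝ) : hyperProj e (graphCoord e g p) = p.1 := by
  rw [graphCoord, map_sub, hyperProj_graphMap, map_smul, hyperProj_self, smul_zero, sub_zero]

theorem continuous_graphCoord (hg : Continuous g) : Continuous (graphCoord e g) :=
  ((continuous_graphMap hg).comp continuous_fst).sub (continuous_snd.smul continuous_const)

theorem isClosedEmbedding_graphCoord (he : ‖e‖ = 1) (hg : Continuous g) :
    IsClosedEmbedding (graphCoord e g) := by
  refine Function.LeftInverse.isClosedEmbedding
    (f := fun y => (hyperProj e y, g (hyperProj e y) - inner ℝ e y)) (fun p => ?_) ?_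
    (continuous_graphCoord hg)
  · simp only [hyperProj_graphCoord, inner_graphCoord he, sub_sub_cancel]
  · fun_prop

variable [FiniteDimensional ℝ E] [MeasurableSpace E] [BorelSpace E]

/-- For the `L²` norm on the product this map is a linear isometry onto `E`, and passing from the
product to its `L²` version preserves volume. -/
theorem measurePreserving_hyperplane_add (he : ‖e‖ = 1) :
    MeasurePreserving (fun p : (ℝ ∙ e)ᗮ × ℝ => (p.1 : E) + p.2 • e) volume volume := by
  let T : WithLp 2 ((ℝ ∙ e)ᗮ × ℝ) →ₗ[ℝ] E :=
    { toFun := fun p => (p.fst : E) + p.snd • e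
      map_add' := fun p q => by simp [add_smul]; abel
      map_smul' := fun c p => by simp [mul_smul] }
  have hnorm : ∀ p, ‖T p‖ = ‖p‖ := by
    intro p
    rw [← sq_eq_sq₀ (norm_nonneg _) (norm_nonneg _), WithLp.prod_norm_sq_eq_of_L2]
    have : T p = (p.fst : E) + p.snd • e := rfl
    rw [this, norm_add_sq_real, inner_smul_right, inner_coe_hyperplane', norm_smul, he,
      Submodule.coe_norm]
    ring
  have hsurj : Function.Surjective T := fun y =>
    ⟨WithLp.toLp 2 (hyperProj e y, (inner ℝ e y : ℝ)), coe_hyperProj_add he y⟩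
  let Ti : WithLp 2 ((ℝ ∙ e)ᗮ × ℝ) ≃ₗᵢ[ℝ] E :=
    LinearIsometryEquiv.ofSurjective ⟨T, hnorm⟩ hsurj
  exact Ti.measurePreserving.comp (WithLp.volume_preserving_toLp (ℝ ∙ e)ᗮ ℝ)

theorem measurePreserving_graphCoord (he : ‖e‖ = 1) (hg : Continuous g) :
    MeasurePreserving (graphCoord e g) ((volume : Measure (ℝ ∙ e)ᗮ).prod volume) volume := by
  have h1 : MeasurePreserving (fun p : (ℝ ∙ e)ᗮ × ℝ => (p.1, g p.1 - p.2))
      ((volume : Measure (ℝ ∙ e)ᗮ).prod volume) ((volume : Measure (ℝ ∙ e)ᗮ).prod volume) := by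
    refine (MeasurePreserving.id _).skew_product (g := fun v s => g v - s) ?_ ?_
    · exact ((hg.comp continuous_fst).sub continuous_snd).measurable
    · exact ae_of_all _ fun v => (Measure.measurePreserving_sub_left volume (g v)).map_eq
  have h2 := (measurePreserving_hyperplane_add he).comp h1
  convert h2 using 1
  ext p
  simp only [graphCoord, graphMap, Function.comp, sub_smul]
  abel

theorem integrable_of_continuousOn_of_eq_zero {X : Type*} [TopologicalSpace X] [T2Space X]
    [MeasurableSpace X] [OpensMeasurableSpace X] {F : Type*} [NormedAddCommGroup F]
    {μ : Measure X} [IsFiniteMeasureOnCompacts μ] {f : X → F} {s K : Set X}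
    (hs : IsClosed s) (hK : IsCompact K) (hf : ContinuousOn f s) (h0 : ∀ x ∈ s, x ∉ K → f x = 0) :
    IntegrableOn f s μ := by
  have h1 : IntegrableOn f (s ∩ K) μ :=
    (hf.mono inter_subset_left).integrableOn_compact (hK.inter_left hs)
  exact h1.of_forall_sdiff_eq_zero hs.measurableSet fun x hx =>
    h0 x hx.1 fun hxK => hx.2 ⟨hx.1, hxK⟩

/-- The field is `C¹` only strictly below the graph, so the region is first cut at depth `a > 0`. Of
the two terms of `opTrace_eq_graph`, the horizontal one integrates to zero over each sheet and the
vertical one is integrated along each line. -/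
theorem setIntegral_divergence_below_graph_aux (he : ‖e‖ = 1) (hg : ContDiff ℝ 1 g) {F : E → E}
    (hF : HasCompactSupport F)
    (hdiff : ContDiffOn ℝ 1 F {y | inner ℝ e y < g (hyperProj e y)}) {a : ℝ} (ha : 0 < a) :
    ∫ p in univ ×ˢ Ioi a, divergence F (graphCoord e g p)
        ∂((volume : Measure (ℝ ∙ e)ᗮ).prod volume) =
      ∫ v, inner ℝ (graphNormal e g v) (F (graphCoord e g (v, a))) := by
  have hopen : IsOpen {y : E | inner ℝ e y < g (hyperProj e y)} :=
    isOpen_lt (by fun_prop) (hg.continuous.comp (hyperProj e).continuous)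
  have hmem : ∀ p : (ℝ ∙ e)ᗮ × ℝ, 0 < p.2 →
      graphCoord e g p ∈ {y : E | inner ℝ e y < g (hyperProj e y)} := by
    intro p hp
    rw [mem_ofPred_eq, inner_graphCoord he, hyperProj_graphCoord]
    linarith
  have hd : ∀ p : (ℝ ∙ e)ᗮ × ℝ, 0 < p.2 →
      HasFDerivAt F (fderiv ℝ F (graphCoord e g p)) (graphCoord e g p) := fun p hp =>
    ((hdiff.differentiableOn (by norm_num)).differentiableAt
      (hopen.mem_nhds (hmem p hp))).hasFDerivAt
  have hcoord := continuous_graphCoord (e := e) hg.continuous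
  have hDc : ContinuousOn (fun p => fderiv ℝ F (graphCoord e g p)) {p | 0 < p.2} :=
    (hdiff.continuousOn_fderiv_of_isOpen hopen (by norm_num)).comp hcoord.continuousOn
      fun p hp => hmem p hp
  have hgrad : Continuous (gradient g) := by
    have : gradient g = fun v => (toDual ℝ _).symm (fderiv ℝ g v) := rfl
    rw [this]
    exact (toDual ℝ (ℝ ∙ e)ᗮ).symm.continuous.comp (hg.continuous_fderiv (by norm_num))
  have hn : Continuous (graphNormal e g) :=
    continuous_const.sub (continuous_subtype_val.comp hgrad)
  have hgd : Continuous (graphDeriv e g) := by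
    unfold graphDeriv
    refine continuous_const.add ?_
    exact ((ContinuousLinearMap.smulRightL ℝ (ℝ ∙ e)ᗮ E).flip e).continuous.comp
      ((innerSL ℝ).continuous.comp hgrad)
  have hK : IsCompact (graphCoord e g ⁻¹' tsupport F) :=
    (isClosedEmbedding_graphCoord he hg.continuous).isCompact_preimage hF
  have hz : ∀ p, p ∉ graphCoord e g ⁻¹' tsupport F → fderiv ℝ F (graphCoord e g p) = 0 := by
    intro p hp
    by_contra hne
    exact hp (support_fderiv_subset ℝ hne)
  have hcl : IsClosed (univ ×ˢ Ici a : Set ((ℝ ∙ e)ᗮ × ℝ)) := isClosed_univ.prod isClosed_Ici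
  have hsub : (univ ×ˢ Ioi a : Set ((ℝ ∙ e)ᗮ × ℝ)) ⊆ univ ×ˢ Ici a :=
    prod_mono le_rfl Ioi_subset_Ici_self
  have hDa : ContinuousOn (fun p => fderiv ℝ F (graphCoord e g p))
      (univ ×ˢ Ici a : Set ((ℝ ∙ e)ᗮ × ℝ)) := hDc.mono fun p hp => ha.trans_le hp.2
  set G : (ℝ ∙ e)ᗮ × ℝ → ℝ := fun p =>
    opTrace ((hyperProj e).comp ((fderiv ℝ F (graphCoord e g p)).comp (graphDeriv e g p.1)))
  set H : (ℝ ∙ e)ᗮ × ℝ → ℝ := fun p =>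
    inner ℝ (graphNormal e g p.1) (fderiv ℝ F (graphCoord e g p) e)
  have hGi : IntegrableOn G (univ ×ˢ Ioi a) ((volume : Measure (ℝ ∙ e)ᗮ).prod volume) := by
    refine (integrable_of_continuousOn_of_eq_zero hcl hK ?_ fun p _ hp => ?_).mono_set hsub
    · refine opTrace.continuous.comp_continuousOn (continuousOn_const.clm_comp ?_)
      exact hDa.clm_comp (hgd.comp continuous_fst).continuousOn
    · simp only [G, hz p hp, ContinuousLinearMap.zero_comp, ContinuousLinearMap.comp_zero, map_zero]
  have hHi : IntegrableOn H (univ ×ˢ Ioi a) ((volume : Measure (ℝ ∙ e)ᗮ).prod volume) := by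
    refine (integrable_of_continuousOn_of_eq_zero hcl hK ?_ fun p _ hp => ?_).mono_set hsub
    · exact (hn.comp continuous_fst).continuousOn.inner (hDa.clm_apply continuousOn_const)
    · simp only [H, hz p hp, zero_apply, inner_zero_right]
  have hsplit : ∀ p, divergence F (graphCoord e g p) = G p + H p := fun p =>
    opTrace_eq_graph he _ p.1
  simp_rw [hsplit]
  rw [integral_add hGi hHi]
  have hrestr : ((volume : Measure (ℝ ∙ e)ᗮ).prod volume).restrict (univ ×ˢ Ioi a) =
      (volume : Measure (ℝ ∙ e)ᗮ).prod (volume.restrict (Ioi a)) := by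
    rw [← Measure.prod_restrict, Measure.restrict_univ]
  have hline : ∀ v : (ℝ ∙ e)ᗮ, ∀ s : ℝ, HasDerivAt (fun s => graphCoord e g (v, s)) (-e) s := by
    intro v s
    simpa [graphCoord] using ((hasDerivAt_id s).smul_const e).const_sub (graphMap e g v)
  -- Fubini with the depth outermost: on each sheet the integrand is the divergence of a compactly
  -- supported field on the hyperplane.
  have hG0 : ∫ p in univ ×ˢ Ioi a, G p ∂((volume : Measure (ℝ ∙ e)ᗮ).prod volume) = 0 := by
    rw [hrestr, integral_prod_symm _ (by rw [← hrestr]; exact hGi)]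
    refine integral_eq_zero_of_ae ((ae_restrict_mem measurableSet_Ioi).mono fun s hs => ?_)
    have hs0 : 0 < s := ha.trans hs
    refine integral_opTrace_eq_zero (Z := fun v => hyperProj e (F (graphCoord e g (v, s))))
      (fun v => ?_) ?_ ?_
    · have h1 : HasFDerivAt (fun v => graphCoord e g (v, s)) (graphDeriv e g v) v :=
        (hasFDerivAt_graphMap (hg.differentiable (by norm_num) v)).sub_const (s • e)
      exact (hyperProj e).hasFDerivAt.comp v ((hd (v, s) hs0).comp v h1)
    · refine HasCompactSupport.intro (hF.image (hyperProj e).continuous) fun v hv => ?_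
      have : graphCoord e g (v, s) ∉ tsupport F := fun hm =>
        hv ⟨_, hm, hyperProj_graphCoord (v, s)⟩
      simp [image_eq_zero_of_notMem_tsupport this]
    · refine continuous_const.clm_comp (Continuous.clm_comp ?_ hgd)
      exact hDc.comp_continuous (by fun_prop : Continuous fun v : (ℝ ∙ e)ᗮ => (v, s))
        fun v => hs0
  rw [hG0, zero_add, hrestr, integral_prod _ (by rw [← hrestr]; exact hHi)]
  have hHi' : Integrable H ((volume : Measure (ℝ ∙ e)ᗮ).prod (volume.restrict (Ioi a))) := by
    rw [← hrestr]; exact hHi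
  refine integral_congr_ae (hHi'.prod_right_ae.mono fun v hv => ?_)
  -- Fubini in the other order: along a vertical line `H` is minus the derivative of `⟨e - ∇g, F⟩`,
  -- since the depth `s` increases in the direction `-e`; compact support kills the term at
  -- infinity.
  have hder : ∀ s, 0 < s → HasDerivAt
      (fun s => inner ℝ (graphNormal e g v) (F (graphCoord e g (v, s)))) (-H (v, s)) s := by
    intro s hs
    have h1 := (hd (v, s) hs).comp_hasDerivAt s (hline v s)
    have h2 := (hasDerivAt_const s (graphNormal e g v)).inner ℝ h1
    simpa [H] using h2
  have htend : Tendsto (fun s => inner ℝ (graphNormal e g v) (F (graphCoord e g (v, s))))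
      atTop (𝓝 (0 : ℝ)) := by
    obtain ⟨M, hM⟩ := (hK.image continuous_snd).bddAbove
    refine tendsto_const_nhds.congr' ?_
    filter_upwards [eventually_gt_atTop M] with s hs
    have : graphCoord e g (v, s) ∉ tsupport F := fun hm =>
      absurd (hM ⟨(v, s), hm, rfl⟩) (not_le.2 hs)
    rw [image_eq_zero_of_notMem_tsupport this, inner_zero_right]
  have h3 := integral_Ioi_of_hasDerivAt_of_tendsto (a := a)
    (hder a ha).continuousAt.continuousWithinAt (fun s hs => hder s (ha.trans hs)) hv.neg htend
  rw [integral_neg] at h3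
  simp only
  linarith

/-- The divergence theorem for the region below a graph. -/
theorem setIntegral_divergence_below_graph (he : ‖e‖ = 1) (hg : ContDiff ℝ 1 g) {F : E → E}
    (hF : HasCompactSupport F)
    (hcont : ContinuousOn F {y | inner ℝ e y ≤ g (hyperProj e y)})
    (hdiff : ContDiffOn ℝ 1 F {y | inner ℝ e y < g (hyperProj e y)})
    (hint : IntegrableOn (divergence F) {y | inner ℝ e y < g (hyperProj e y)}) :
    ∫ y in {y | inner ℝ e y < g (hyperProj e y)}, divergence F y =
      ∫ v, inner ℝ (graphNormal e g v) (F (graphMap e g v)) := by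
  have hmp := measurePreserving_graphCoord he hg.continuous
  have hemb := (isClosedEmbedding_graphCoord he hg.continuous).measurableEmbedding
  have hpre : graphCoord e g ⁻¹' {y | inner ℝ e y < g (hyperProj e y)} = univ ×ˢ Ioi 0 := by
    ext p
    simp [inner_graphCoord he, hyperProj_graphCoord]
  have hU : (⋃ n : ℕ, (univ ×ˢ Ioi (1 / ((n : ℝ) + 1)) : Set ((ℝ ∙ e)ᗮ × ℝ))) = univ ×ˢ Ioi 0 := by
    ext p
    simp only [mem_iUnion, mem_prod, mem_univ, true_and, mem_Ioi]
    exact ⟨fun ⟨n, hn⟩ => (by positivity : (0 : ℝ) < 1 / ((n : ℝ) + 1)).trans hn,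
      fun hp => exists_nat_one_div_lt hp⟩
  have hint' : IntegrableOn (fun p => divergence F (graphCoord e g p)) (univ ×ˢ Ioi 0)
      ((volume : Measure (ℝ ∙ e)ᗮ).prod volume) := by
    rw [← hpre]
    exact (hmp.integrableOn_comp_preimage hemb).2 hint
  have hlim1 := tendsto_setIntegral_of_monotone
    (s := fun n : ℕ => (univ ×ˢ Ioi (1 / ((n : ℝ) + 1)) : Set ((ℝ ∙ e)ᗮ × ℝ)))
    (f := fun p => divergence F (graphCoord e g p))
    (μ := (volume : Measure (ℝ ∙ e)ᗮ).prod volume)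
    (fun n => MeasurableSet.univ.prod measurableSet_Ioi)
    (fun m n hmn => prod_mono le_rfl (Ioi_subset_Ioi (Nat.one_div_le_one_div hmn)))
    (by rw [hU]; exact hint')
  rw [hU] at hlim1
  have hgrad : Continuous (gradient g) := by
    have : gradient g = fun v => (toDual ℝ _).symm (fderiv ℝ g v) := rfl
    rw [this]
    exact (toDual ℝ (ℝ ∙ e)ᗮ).symm.continuous.comp (hg.continuous_fderiv (by norm_num))
  have hn : Continuous (graphNormal e g) :=
    continuous_const.sub (continuous_subtype_val.comp hgrad)
  -- `F` is known to be continuous only on the closed region below the graph. Truncating the depth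
  -- at `0` makes the integrand continuous for all real `s`, so the boundary integrals at depth
  -- `1/(n+1)` converge to the one on the graph itself.
  let f : ℝ → (ℝ ∙ e)ᗮ → ℝ := fun s v =>
    inner ℝ (graphNormal e g v) (F (graphCoord e g (v, max s 0)))
  have hfc : Continuous (Function.uncurry f) := by
    refine (hn.comp continuous_snd).inner (hcont.comp_continuous
      ((continuous_graphCoord hg.continuous).comp
        (continuous_snd.prodMk (continuous_fst.max continuous_const))) fun p => ?_)
    simp [inner_graphCoord he, hyperProj_graphCoord]
  have hKc : IsCompact (hyperProj e '' tsupport F) := hF.image (hyperProj e).continuous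
  have hcI := continuous_parametric_integral_of_continuous (μ := volume) hfc hKc
  have hfz : ∀ s, ∫ v in hyperProj e '' tsupport F, f s v = ∫ v, f s v := by
    intro s
    refine setIntegral_eq_integral_of_forall_compl_eq_zero fun v hv => ?_
    have : graphCoord e g (v, max s 0) ∉ tsupport F := fun hm =>
      hv ⟨_, hm, hyperProj_graphCoord (v, max s 0)⟩
    simp only [f, image_eq_zero_of_notMem_tsupport this, inner_zero_right]
  simp_rw [hfz] at hcI
  have hlim2 : Tendsto (fun n : ℕ => ∫ v, f (1 / ((n : ℝ) + 1)) v) atTop (𝓝 (∫ v, f 0 v)) :=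
    (hcI.tendsto 0).comp tendsto_one_div_add_atTop_nhds_zero_nat
  have heq : ∀ n : ℕ, ∫ p in univ ×ˢ Ioi (1 / ((n : ℝ) + 1)), divergence F (graphCoord e g p)
      ∂((volume : Measure (ℝ ∙ e)ᗮ).prod volume) = ∫ v, f (1 / ((n : ℝ) + 1)) v := by
    intro n
    have hpos : (0 : ℝ) < 1 / ((n : ℝ) + 1) := by positivity
    rw [setIntegral_divergence_below_graph_aux he hg hF hdiff hpos]
    simp only [f, max_eq_left hpos.le]
  simp_rw [heq] at hlim1
  have h0 := tendsto_nhds_unique hlim1 hlim2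
  rw [← hmp.setIntegral_preimage_emb hemb, hpre, h0]
  simp [f, graphCoord]

end Subgraph

end RobinTorsion

namespace RobinTorsion

open scoped ENNReal NNReal Manifold ContDiff

/-! ### Finite smooth partitions of unity -/

section PartitionOfUnity

variable {E : Type*} [NormedAddCommGroup E] [NormedSpace ℝ E] [FiniteDimensional ℝ E]

theorem exists_finite_smooth_partition {K : Set E} (hK : IsCompact K) {U : E → Set E}
    (hU : ∀ x ∈ K, IsOpen (U x) ∧ x ∈ U x) :
    ∃ (s : Finset E) (φ : E → E → ℝ), (∀ i ∈ s, i ∈ K ∧ ContDiff ℝ ∞ (φ i) ∧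
      HasCompactSupport (φ i) ∧ tsupport (φ i) ⊆ U i) ∧ ∀ x ∈ K, ∑ i ∈ s, φ i x = 1 := by
  classical
  -- Shrinking every `U i` to a unit ball forces compact supports; local finiteness and compactness
  -- of `K` leave finitely many functions.
  obtain ⟨f, hf⟩ := SmoothPartitionOfUnity.exists_isSubordinate 𝓘(ℝ, E) hK.isClosed
    (fun i : K => U i ∩ Metric.ball (i : E) 1)
    (fun i => (hU i i.2).1.inter Metric.isOpen_ball)
    (fun x hx => mem_iUnion.2 ⟨⟨x, hx⟩, (hU x hx).2, Metric.mem_ball_self one_pos⟩)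
  have hfin := f.locallyFinite.finite_nonempty_inter_compact hK
  refine ⟨hfin.toFinset.map (Function.Embedding.subtype _),
    fun x => if hx : x ∈ K then f ⟨x, hx⟩ else 0, ?_, ?_⟩
  · intro i hi
    obtain ⟨j, -, rfl⟩ := Finset.mem_map.1 hi
    have hj : ((Function.Embedding.subtype _) j : E) = (j : E) := rfl
    simp only [hj, Subtype.coe_prop, dif_pos, true_and]
    refine ⟨(f j).contMDiff.contDiff, ?_, (hf j).trans inter_subset_left⟩
    refine HasCompactSupport.of_support_subset_isCompact (isCompact_closedBall (j : E) 1) ?_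
    exact (subset_tsupport _).trans ((hf j).trans (inter_subset_right.trans
      Metric.ball_subset_closedBall))
  · intro x hx
    rw [Finset.sum_map, ← f.sum_eq_one hx]
    rw [finsum_eq_sum_of_support_subset (s := hfin.toFinset)]
    · refine Finset.sum_congr rfl fun j _ => ?_
      have hj : ((Function.Embedding.subtype _) j : E) = (j : E) := rfl
      simp [hj]
    · intro i hi
      simp only [Finite.coe_toFinset, mem_ofPred_eq]
      exact ⟨x, hi, hx⟩

end PartitionOfUnity

/-! ### Outer normal and surface measure in graph charts -/

section Boundary

variable {N : ℕ} {Ω U : Set (EuclideanSpace ℝ (Fin N))} {e : EuclideanSpace ℝ (Fin N)}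
  {g : (ℝ ∙ e)ᗮ → ℝ}

theorem exists_isGraphChart_of_mem_frontier (hC : HasC2Boundary Ω) {x : EuclideanSpace ℝ (Fin N)}
    (hx : x ∈ frontier Ω) :
    ∃ (e : EuclideanSpace ℝ (Fin N)) (g : (ℝ ∙ e)ᗮ → ℝ) (U : Set (EuclideanSpace ℝ (Fin N))),
      IsGraphChart Ω e g U ∧ x ∈ U := by
  obtain ⟨ρ, h⟩ := hC x hx
  exact exists_isGraphChart h.contDiffAt h.gradient_ne_zero h.eq_zero h.eventually_mem_iff

/-- The upward unit normal of the graph of `g`. -/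
noncomputable def unitGraphNormal (e : EuclideanSpace ℝ (Fin N)) (g : (ℝ ∙ e)ᗮ → ℝ) (v : (ℝ ∙ e)ᗮ) :
    EuclideanSpace ℝ (Fin N) :=
  ‖graphNormal e g v‖⁻¹ • graphNormal e g v

theorem contDiff_gradient {V : Type*} [NormedAddCommGroup V] [InnerProductSpace ℝ V]
    [CompleteSpace V] {g : V → ℝ} (hg : ContDiff ℝ 2 g) : ContDiff ℝ 1 (gradient g) :=
  (toDual ℝ V).symm.contDiff.comp (hg.fderiv_right (m := 1) (by norm_num))

theorem contDiff_graphNormal (hg : ContDiff ℝ 2 g) : ContDiff ℝ 1 (graphNormal e g) :=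
  contDiff_const.sub ((ℝ ∙ e)ᗮ.subtypeL.contDiff.comp (contDiff_gradient hg))

theorem contDiff_norm_graphNormal (he : ‖e‖ = 1) (hg : ContDiff ℝ 2 g) :
    ContDiff ℝ 1 fun v => ‖graphNormal e g v‖ :=
  (contDiff_graphNormal hg).norm ℝ fun v => norm_pos_iff.1 (norm_graphNormal_pos he v)

theorem contDiff_unitGraphNormal (he : ‖e‖ = 1) (hg : ContDiff ℝ 2 g) :
    ContDiff ℝ 1 (unitGraphNormal e g) :=
  ((contDiff_norm_graphNormal he hg).inv fun v => (norm_graphNormal_pos he v).ne').smul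
    (contDiff_graphNormal hg)

theorem norm_unitGraphNormal (he : ‖e‖ = 1) (v : (ℝ ∙ e)ᗮ) : ‖unitGraphNormal e g v‖ = 1 := by
  rw [unitGraphNormal, norm_smul, norm_inv, norm_norm,
    inv_mul_cancel₀ (norm_graphNormal_pos he v).ne']

theorem norm_smul_unitGraphNormal (he : ‖e‖ = 1) (v : (ℝ ∙ e)ᗮ) :
    ‖graphNormal e g v‖ • unitGraphNormal e g v = graphNormal e g v := by
  rw [unitGraphNormal, smul_inv_smul₀ (norm_graphNormal_pos he v).ne']

namespace IsGraphChart

/-- The height above the graph is a defining function with gradient `e - ∇g`. As the outer normal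
does not depend on the defining function, every chart computes it as the unit graph normal. -/
theorem isDefiningFunctionAt (h : IsGraphChart Ω e g U) {v : (ℝ ∙ e)ᗮ}
    (hv : graphMap e g v ∈ U) :
    IsDefiningFunctionAt Ω (graphMap e g v) (fun y => inner ℝ e y - g (hyperProj e y)) ∧
      gradient (fun y => inner ℝ e y - g (hyperProj e y)) (graphMap e g v) =
        graphNormal e g v := by
  have hgd : HasFDerivAt g (toDual ℝ _ (gradient g v)) (hyperProj e (graphMap e g v)) := by
    rw [hyperProj_graphMap]
    exact (h.contDiff.differentiable (by norm_num) v).hasGradientAt.hasFDerivAt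
  have hgr : HasGradientAt (fun y => inner ℝ e y - g (hyperProj e y)) (graphNormal e g v)
      (graphMap e g v) := by
    rw [hasGradientAt_iff_hasFDerivAt]
    have h1 := ((innerSL ℝ e).hasFDerivAt (x := graphMap e g v)).sub
      (hgd.comp (graphMap e g v) (hyperProj e).hasFDerivAt)
    convert! h1 using 1
    ext y
    simp only [graphNormal, toDual_apply_apply, inner_sub_left, sub_apply,
      innerSL_apply_apply, ContinuousLinearMap.comp_apply]
    rw [← inner_hyperProj]
  refine ⟨⟨?_, ?_, ?_, ?_⟩, hgr.gradient⟩
  · exact ((innerSL ℝ e).contDiff.sub (h.contDiff.comp (hyperProj e).contDiff)).contDiffAt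
  · rw [hgr.gradient]
    exact norm_pos_iff.1 (norm_graphNormal_pos h.norm_eq_one v)
  · rw [inner_graphMap h.norm_eq_one, hyperProj_graphMap, sub_self]
  · filter_upwards [h.isOpen.mem_nhds hv] with y hy
    rw [h.mem_iff y hy, sub_neg]

theorem outerNormal_graphMap (h : IsGraphChart Ω e g U) {v : (ℝ ∙ e)ᗮ}
    (hv : graphMap e g v ∈ U) : outerNormal Ω (graphMap e g v) = unitGraphNormal e g v := by
  rw [outerNormal_eq (h.isDefiningFunctionAt hv).1, (h.isDefiningFunctionAt hv).2]
  rfl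

theorem graphMap_hyperProj (h : IsGraphChart Ω e g U) (hΩ : IsOpen Ω)
    {y : EuclideanSpace ℝ (Fin N)} (hy : y ∈ frontier Ω) (hyU : y ∈ U) :
    graphMap e g (hyperProj e y) = y := by
  rw [graphMap, ← (h.mem_frontier_iff hΩ hyU).1 hy, coe_hyperProj_add h.norm_eq_one]

theorem outerNormal_eq (h : IsGraphChart Ω e g U) (hΩ : IsOpen Ω)
    {y : EuclideanSpace ℝ (Fin N)} (hy : y ∈ frontier Ω) (hyU : y ∈ U) :
    outerNormal Ω y = unitGraphNormal e g (hyperProj e y) := by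
  have h1 := h.graphMap_hyperProj hΩ hy hyU
  have := h.outerNormal_graphMap (v := hyperProj e y) (by rwa [h1])
  rwa [h1] at this

theorem finrank_hyperplane (he : ‖e‖ = 1) : Module.finrank ℝ (ℝ ∙ e)ᗮ = N - 1 := by
  have h1 := (ℝ ∙ e).finrank_add_finrank_orthogonal
  have h0 : e ≠ 0 := by rintro rfl; simp at he
  rw [finrank_span_singleton h0, finrank_euclideanSpace, Fintype.card_fin] at h1
  omega

theorem surfaceMeasure_restrict (h : IsGraphChart Ω e g U) (hΩ : IsOpen Ω) :
    (surfaceMeasure Ω).restrict U =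
      ((volume.withDensity fun v => ENNReal.ofReal ‖graphNormal e g v‖).map
        (graphMap e g)).restrict U := by
  have hU := h.isOpen.measurableSet
  rw [← euclideanHausdorffMeasure_restrict_range_graphMap h.norm_eq_one
    (h.contDiff.of_le (by norm_num)), finrank_hyperplane h.norm_eq_one, surfaceMeasure,
    Measure.restrict_restrict hU, Measure.restrict_restrict hU, inter_comm, h.frontier_inter hΩ,
    inter_comm]

/-- On `U` the surface measure is the image of the weighted Lebesgue measure of the hyperplane; `f`
vanishes off `U`, so the restriction to `U` can be inserted and removed at will. -/
theorem integral_surfaceMeasure (h : IsGraphChart Ω e g U) (hΩ : IsOpen Ω)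
    {f : EuclideanSpace ℝ (Fin N) → ℝ} (hf : ∀ y, y ∉ U → f y = 0) :
    ∫ y, f y ∂(surfaceMeasure Ω) = ∫ v, ‖graphNormal e g v‖ * f (graphMap e g v) := by
  have hW : Measurable fun v => ‖graphNormal e g v‖ :=
    (contDiff_norm_graphNormal h.norm_eq_one h.contDiff).continuous.measurable
  have hemb := (isClosedEmbedding_graphMap (e := e) h.contDiff.continuous).measurableEmbedding
  rw [← setIntegral_eq_integral_of_forall_compl_eq_zero hf, h.surfaceMeasure_restrict hΩ,
    setIntegral_eq_integral_of_forall_compl_eq_zero hf, hemb.integral_map]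
  have h1 : (fun v => ENNReal.ofReal ‖graphNormal e g v‖) =
      fun v => ((Real.toNNReal ‖graphNormal e g v‖ : ℝ≥0) : ℝ≥0∞) := rfl
  rw [h1, integral_withDensity_eq_integral_smul hW.real_toNNReal]
  refine integral_congr_ae (ae_of_all _ fun v => ?_)
  simp only [NNReal.smul_def, smul_eq_mul, Real.coe_toNNReal _ (norm_nonneg _)]

theorem exists_surfaceMeasure_lt_top (h : IsGraphChart Ω e g U) (hΩ : IsOpen Ω)
    {x : EuclideanSpace ℝ (Fin N)} (hx : x ∈ U) : ∃ B ∈ 𝓝 x, surfaceMeasure Ω B < ⊤ := by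
  obtain ⟨r, hr, hrU⟩ := Metric.nhds_basis_closedBall.mem_iff.1 (h.isOpen.mem_nhds hx)
  refine ⟨Metric.closedBall x r, Metric.closedBall_mem_nhds x hr, ?_⟩
  have hemb := isClosedEmbedding_graphMap (e := e) h.contDiff.continuous
  have h1 : surfaceMeasure Ω (Metric.closedBall x r) =
      (surfaceMeasure Ω).restrict U (Metric.closedBall x r) := by
    rw [Measure.restrict_apply Metric.isClosed_closedBall.measurableSet,
      inter_eq_left.2 hrU]
  have hm : MeasurableSet (graphMap e g ⁻¹' Metric.closedBall x r) :=
    hemb.continuous.measurable Metric.isClosed_closedBall.measurableSet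
  rw [h1, h.surfaceMeasure_restrict hΩ,
    Measure.restrict_apply Metric.isClosed_closedBall.measurableSet, inter_eq_left.2 hrU,
    hemb.measurableEmbedding.map_apply, withDensity_apply _ hm]
  have hK : IsCompact (graphMap e g ⁻¹' Metric.closedBall x r) :=
    hemb.isCompact_preimage (isCompact_closedBall x r)
  have hW : ContinuousOn (fun v => ‖graphNormal e g v‖)
      (graphMap e g ⁻¹' Metric.closedBall x r) :=
    (contDiff_norm_graphNormal h.norm_eq_one h.contDiff).continuous.continuousOn
  have := (hW.integrableOn_compact (μ := volume) hK).hasFiniteIntegral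
  simpa only [HasFiniteIntegral, enorm_norm, ofReal_norm] using this

end IsGraphChart

theorem isFiniteMeasure_surfaceMeasure (hΩ : IsOpen Ω) (hb : Bornology.IsBounded Ω)
    (hC : HasC2Boundary Ω) : IsFiniteMeasure (surfaceMeasure Ω) := by
  have hK : IsCompact (frontier Ω) :=
    Metric.isCompact_of_isClosed_isBounded isClosed_frontier
      (hb.closure.subset frontier_subset_closure)
  have h1 : surfaceMeasure Ω (frontier Ω) < ⊤ := by
    refine hK.measure_lt_top_of_nhdsWithin fun x hx => ?_
    obtain ⟨e, g, U, h, hxU⟩ := exists_isGraphChart_of_mem_frontier hC hx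
    obtain ⟨B, hB, hlt⟩ := h.exists_surfaceMeasure_lt_top hΩ hxU
    exact ⟨B, mem_nhdsWithin_of_mem_nhds hB, hlt⟩
  refine ⟨?_⟩
  rw [surfaceMeasure, Measure.restrict_apply_self] at h1
  rw [surfaceMeasure, Measure.restrict_apply_univ]
  exact h1

theorem continuousOn_outerNormal (hΩ : IsOpen Ω) (hC : HasC2Boundary Ω) :
    ContinuousOn (outerNormal Ω) (frontier Ω) := by
  intro x hx
  obtain ⟨e, g, U, h, hxU⟩ := exists_isGraphChart_of_mem_frontier hC hx
  have hc : Continuous fun y => unitGraphNormal e g (hyperProj e y) :=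
    (contDiff_unitGraphNormal h.norm_eq_one h.contDiff).continuous.comp (hyperProj e).continuous
  refine hc.continuousWithinAt.congr_of_eventuallyEq ?_ (h.outerNormal_eq hΩ hx hxU)
  filter_upwards [self_mem_nhdsWithin, mem_nhdsWithin_of_mem_nhds (h.isOpen.mem_nhds hxU)]
    with y hy hyU using h.outerNormal_eq hΩ hy hyU

theorem norm_outerNormal (hΩ : IsOpen Ω) (hC : HasC2Boundary Ω) {x : EuclideanSpace ℝ (Fin N)}
    (hx : x ∈ frontier Ω) : ‖outerNormal Ω x‖ = 1 := by
  obtain ⟨e, g, U, h, hxU⟩ := exists_isGraphChart_of_mem_frontier hC hx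
  rw [h.outerNormal_eq hΩ hx hxU, norm_unitGraphNormal h.norm_eq_one]

theorem integrable_surfaceMeasure (hΩ : IsOpen Ω) (hb : Bornology.IsBounded Ω)
    (hC : HasC2Boundary Ω) {f : EuclideanSpace ℝ (Fin N) → ℝ}
    (hf : ContinuousOn f (frontier Ω)) : Integrable f (surfaceMeasure Ω) := by
  have hK : IsCompact (frontier Ω) :=
    Metric.isCompact_of_isClosed_isBounded isClosed_frontier
      (hb.closure.subset frontier_subset_closure)
  have := isFiniteMeasure_surfaceMeasure hΩ hb hC
  have h1 : IntegrableOn f (frontier Ω) (surfaceMeasure Ω) := hf.integrableOn_compact hK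
  rw [IntegrableOn, surfaceMeasure, Measure.restrict_restrict isClosed_frontier.measurableSet,
    inter_self] at h1
  exact h1

theorem ae_surfaceMeasure_mem_frontier : ∀ᵐ x ∂(surfaceMeasure Ω), x ∈ frontier Ω :=
  ae_restrict_mem isClosed_frontier.measurableSet

end Boundary

end RobinTorsion

namespace RobinTorsion

open scoped ENNReal NNReal ContDiff

/-! ### Cutting off vector fields -/

section Localization

variable {E : Type*} [NormedAddCommGroup E] [InnerProductSpace ℝ E] [FiniteDimensional ℝ E]

theorem divergence_smul {φ : E → ℝ} {F : E → E} {x : E} (hφ : DifferentiableAt ℝ φ x)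
    (hF : DifferentiableAt ℝ F x) :
    divergence (fun y => φ y • F y) x = φ x * divergence F x + fderiv ℝ φ x (F x) := by
  have h : fderiv ℝ (fun y => φ y • F y) x = φ x • fderiv ℝ F x + (fderiv ℝ φ x).smulRight (F x) :=
    (hφ.hasFDerivAt.smul hF.hasFDerivAt).fderiv
  rw [divergence, h, map_add, map_smul, opTrace_smulRight]
  rfl

theorem divergence_eq_zero_of_notMem_tsupport {F : E → E} {x : E} (hx : x ∉ tsupport F) :
    divergence F x = 0 := by
  have : fderiv ℝ F x = 0 := by
    by_contra hne
    exact hx (support_fderiv_subset ℝ hne)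
  rw [divergence, this, map_zero]

theorem tsupport_smul_subset {X : Type*} [TopologicalSpace X] {F : Type*} [NormedAddCommGroup F]
    [NormedSpace ℝ F] (φ : X → ℝ) (G : X → F) :
    tsupport (fun y => φ y • G y) ⊆ tsupport φ :=
  closure_mono fun y hy h0 => hy (by simp [h0])

theorem continuousOn_smul_of_tsupport {X : Type*} [TopologicalSpace X] {F : Type*}
    [NormedAddCommGroup F] [NormedSpace ℝ F] {φ : X → ℝ} {G : X → F} {s U : Set X}
    (hU : IsOpen U) (hφ : Continuous φ) (hsupp : tsupport φ ⊆ U) (hG : ContinuousOn G (s ∩ U)) :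
    ContinuousOn (fun y => φ y • G y) s := by
  intro x hx
  by_cases hxφ : x ∈ tsupport φ
  · have h1 : ContinuousWithinAt G s x :=
      (hG x ⟨hx, hsupp hxφ⟩).mono_of_mem_nhdsWithin
        (inter_mem_nhdsWithin s (hU.mem_nhds (hsupp hxφ)))
    exact hφ.continuousWithinAt.smul h1
  · have h1 : (fun y => φ y • G y) =ᶠ[𝓝 x] fun _ => 0 := by
      filter_upwards [notMem_tsupport_iff_eventuallyEq.1 hxφ] with y hy
      simp [hy]
    exact (continuousAt_const.congr h1.symm).continuousWithinAt

theorem contDiffOn_smul_of_tsupport {V F : Type*} [NormedAddCommGroup V] [NormedSpace ℝ V]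
    [NormedAddCommGroup F] [NormedSpace ℝ F]
    {n : WithTop ℕ∞} {φ : V → ℝ} {G : V → F} {s U : Set V}
    (hU : IsOpen U) (hφ : ContDiff ℝ n φ) (hsupp : tsupport φ ⊆ U)
    (hG : ContDiffOn ℝ n G (s ∩ U)) :
    ContDiffOn ℝ n (fun y => φ y • G y) s := by
  intro x hx
  by_cases hxφ : x ∈ tsupport φ
  · have h1 : ContDiffWithinAt ℝ n G s x :=
      (hG x ⟨hx, hsupp hxφ⟩).mono_of_mem_nhdsWithin
        (inter_mem_nhdsWithin s (hU.mem_nhds (hsupp hxφ)))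
    exact hφ.contDiffAt.contDiffWithinAt.smul h1
  · have h1 : (fun y => φ y • G y) =ᶠ[𝓝 x] fun _ => 0 := by
      filter_upwards [notMem_tsupport_iff_eventuallyEq.1 hxφ] with y hy
      simp [hy]
    exact (contDiffAt_const.congr_of_eventuallyEq h1).contDiffWithinAt

end Localization

/-! ### The divergence theorem in a bounded `C²` domain -/

section DivergenceTheorem

variable {N : ℕ} {Ω U : Set (EuclideanSpace ℝ (Fin N))} {e : EuclideanSpace ℝ (Fin N)}
  {g : (ℝ ∙ e)ᗮ → ℝ} {F : EuclideanSpace ℝ (Fin N) → EuclideanSpace ℝ (Fin N)}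
  {φ : EuclideanSpace ℝ (Fin N) → ℝ}

/-- On `U`, which contains the support of `φ F`, the domain coincides with the region below the
graph, so the subgraph version applies. The factor `‖e - ∇g‖` relating the two normals is exactly
the area element. -/
theorem IsGraphChart.setIntegral_divergence_smul (h : IsGraphChart Ω e g U) (hΩ : IsOpen Ω)
    (hφ : ContDiff ℝ ∞ φ) (hφc : HasCompactSupport φ) (hφU : tsupport φ ⊆ U)
    (hcont : ContinuousOn F (closure Ω)) (hdiff : ContDiffOn ℝ 1 F Ω)
    (hint : IntegrableOn (divergence fun y => φ y • F y) Ω) :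
    ∫ y in Ω, divergence (fun y => φ y • F y) y =
      ∫ y, φ y * inner ℝ (outerNormal Ω y) (F y) ∂(surfaceMeasure Ω) := by
  set G := fun y => φ y • F y with hG
  have hGφ : tsupport G ⊆ tsupport φ := tsupport_smul_subset φ F
  set S := {y : EuclideanSpace ℝ (Fin N) | inner ℝ e y < g (hyperProj e y)} with hS
  have hSopen : IsOpen S :=
    isOpen_lt (by fun_prop) (h.contDiff.continuous.comp (hyperProj e).continuous)
  have hind : Ω.indicator (divergence G) = S.indicator (divergence G) := by
    ext y
    by_cases hy : y ∈ U
    · by_cases hyΩ : y ∈ Ω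
      · rw [indicator_of_mem hyΩ, indicator_of_mem (show y ∈ S from (h.mem_iff y hy).1 hyΩ)]
      · rw [indicator_of_notMem hyΩ, 
          indicator_of_notMem (show y ∉ S from mt (h.mem_iff y hy).2 hyΩ)]
    · have : divergence G y = 0 :=
        divergence_eq_zero_of_notMem_tsupport fun hm => hy (hφU (hGφ hm))
      simp [indicator_apply, this]
  have hint' : IntegrableOn (divergence G) S := by
    rw [← integrable_indicator_iff hSopen.measurableSet, ← hind,
      integrable_indicator_iff hΩ.measurableSet]
    exact hint
  rw [← integral_indicator hΩ.measurableSet, hind, integral_indicator hSopen.measurableSet,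
    setIntegral_divergence_below_graph h.norm_eq_one (h.contDiff.of_le (by norm_num))
      (hφc.mono' (subset_closure.trans hGφ)) ?_ ?_ hint',
    h.integral_surfaceMeasure hΩ]
  · refine integral_congr_ae (ae_of_all _ fun v => ?_)
    simp only [hG]
    by_cases hv : graphMap e g v ∈ U
    · rw [h.outerNormal_graphMap hv, ← norm_smul_unitGraphNormal h.norm_eq_one v,
        inner_smul_right, inner_smul_left]
      simp [norm_smul, norm_unitGraphNormal h.norm_eq_one]
      ring
    · have : φ (graphMap e g v) = 0 := image_eq_zero_of_notMem_tsupport fun hm => hv (hφU hm)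
      simp [this]
  · intro y hy
    have : φ y = 0 := image_eq_zero_of_notMem_tsupport fun hm => hy (hφU hm)
    simp [this]
  · refine continuousOn_smul_of_tsupport h.isOpen hφ.continuous hφU (hcont.mono ?_)
    rintro y ⟨hy, hyU⟩
    exact (h.mem_closure_iff hyU).2 hy
  · refine contDiffOn_smul_of_tsupport h.isOpen (hφ.of_le (by exact_mod_cast le_top)) hφU (hdiff.mono ?_)
    rintro y ⟨hy, hyU⟩
    exact (h.mem_iff y hyU).2 hy

/-- Both sides vanish: the cut-off field is compactly supported in `Ω`, and `φ` is zero on the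
boundary. -/
theorem setIntegral_divergence_smul_of_tsupport_subset (hΩ : IsOpen Ω)
    (hφ : ContDiff ℝ ∞ φ) (hφc : HasCompactSupport φ) (hφU : tsupport φ ⊆ Ω)
    (hdiff : ContDiffOn ℝ 1 F Ω) :
    ∫ y in Ω, divergence (fun y => φ y • F y) y =
      ∫ y, φ y * inner ℝ (outerNormal Ω y) (F y) ∂(surfaceMeasure Ω) := by
  set G := fun y => φ y • F y with hG
  have hGφ : tsupport G ⊆ tsupport φ := tsupport_smul_subset φ F
  have hGC : ContDiff ℝ 1 G := by
    rw [← contDiffOn_univ]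
    refine contDiffOn_smul_of_tsupport hΩ (hφ.of_le (by exact_mod_cast le_top)) hφU ?_
    rwa [univ_inter]
  have h1 : ∫ y in Ω, divergence G y = 0 := by
    rw [setIntegral_eq_integral_of_forall_compl_eq_zero fun y hy =>
      divergence_eq_zero_of_notMem_tsupport fun hm => hy (hφU (hGφ hm))]
    exact integral_opTrace_eq_zero
      (fun v => (hGC.differentiable (by norm_num) v).hasFDerivAt)
      (hφc.mono' (subset_closure.trans hGφ)) (hGC.continuous_fderiv (by norm_num))
  have h2 : ∫ y, φ y * inner ℝ (outerNormal Ω y) (F y) ∂(surfaceMeasure Ω) = 0 := by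
    refine integral_eq_zero_of_ae (ae_surfaceMeasure_mem_frontier.mono fun y hy => ?_)
    have : φ y = 0 := image_eq_zero_of_notMem_tsupport fun hm => by
      rw [hΩ.frontier_eq] at hy
      exact hy.2 (hφU hm)
    simp [this]
  rw [h1, h2]

/-- A finite smooth partition of unity on `closure Ω`, each member of which is supported either
inside `Ω` or in a boundary chart. -/
theorem exists_boundary_partition (hΩ : IsOpen Ω) (hb : Bornology.IsBounded Ω)
    (hC : HasC2Boundary Ω) :
    ∃ (s : Finset (EuclideanSpace ℝ (Fin N)))
      (φ : EuclideanSpace ℝ (Fin N) → EuclideanSpace ℝ (Fin N) → ℝ),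
      (∀ i ∈ s, ContDiff ℝ ∞ (φ i) ∧ HasCompactSupport (φ i) ∧
        (tsupport (φ i) ⊆ Ω ∨ ∃ (e : EuclideanSpace ℝ (Fin N)) (g : (ℝ ∙ e)ᗮ → ℝ)
          (U : Set (EuclideanSpace ℝ (Fin N))), IsGraphChart Ω e g U ∧ tsupport (φ i) ⊆ U)) ∧
      (∀ x ∈ closure Ω, ∑ i ∈ s, φ i x = 1) ∧
      ∀ x ∈ closure Ω, ∑ i ∈ s, fderiv ℝ (φ i) x = 0 := by
  have hK : IsCompact (closure Ω) :=
    Metric.isCompact_of_isClosed_isBounded isClosed_closure hb.closure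
  have hch : ∀ x : EuclideanSpace ℝ (Fin N), ∃ U : Set (EuclideanSpace ℝ (Fin N)),
      x ∈ closure Ω → IsOpen U ∧ x ∈ U ∧ (U = Ω ∨ ∃ (e : EuclideanSpace ℝ (Fin N))
        (g : (ℝ ∙ e)ᗮ → ℝ), IsGraphChart Ω e g U) := by
    intro x
    by_cases hx : x ∈ Ω
    · exact ⟨Ω, fun _ => ⟨hΩ, hx, Or.inl rfl⟩⟩
    · by_cases hxc : x ∈ closure Ω
      · have hxf : x ∈ frontier Ω := by rw [hΩ.frontier_eq]; exact ⟨hxc, hx⟩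
        obtain ⟨e, g, U, h, hxU⟩ := exists_isGraphChart_of_mem_frontier hC hxf
        exact ⟨U, fun _ => ⟨h.isOpen, hxU, Or.inr ⟨e, g, h⟩⟩⟩
      · exact ⟨∅, fun hh => absurd hh hxc⟩
  choose U hU using hch
  obtain ⟨s, φ, hφ, hsum⟩ := exists_finite_smooth_partition hK (U := U)
    fun x hx => ⟨(hU x hx).1, (hU x hx).2.1⟩
  refine ⟨s, φ, fun i hi => ?_, hsum, ?_⟩
  · obtain ⟨h1, h2, h3, h4⟩ := hφ i hi
    refine ⟨h2, h3, ?_⟩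
    rcases (hU i h1).2.2 with h5 | ⟨e, g, h5⟩
    · exact Or.inl (h5 ▸ h4)
    · exact Or.inr ⟨e, g, U i, h5, h4⟩
  · have hd : ∀ i ∈ s, ∀ x, DifferentiableAt ℝ (φ i) x := fun i hi x =>
      (hφ i hi).2.1.differentiable (by simp) x
    -- The sum of the `φ i` is known to be `1` only on the closure, so it can be differentiated only
    -- in the open set; continuity of the derivatives carries the conclusion to the boundary.
    have hz : ∀ x ∈ Ω, ∑ i ∈ s, fderiv ℝ (φ i) x = 0 := by
      intro x hx
      have h1 : HasFDerivAt (fun y => ∑ i ∈ s, φ i y) (∑ i ∈ s, fderiv ℝ (φ i) x) x :=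
        HasFDerivAt.fun_sum fun i hi => (hd i hi x).hasFDerivAt
      have h2 : (fun y => ∑ i ∈ s, φ i y) =ᶠ[𝓝 x] fun _ => 1 := by
        filter_upwards [hΩ.mem_nhds hx] with y hy using hsum y (subset_closure hy)
      exact h1.unique ((hasFDerivAt_const (1 : ℝ) x).congr_of_eventuallyEq h2)
    have hc : Continuous fun x => ∑ i ∈ s, fderiv ℝ (φ i) x :=
      continuous_finsetSum _ fun i hi => (hφ i hi).2.1.continuous_fderiv (by simp)
    intro x hx
    exact closure_minimal (t := {x | ∑ i ∈ s, fderiv ℝ (φ i) x = 0}) hz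
      (isClosed_eq hc continuous_const) hx

/-- The divergence theorem in a bounded `C²` domain, for vector fields that are continuous up to the
boundary and `C¹` inside with integrable divergence. -/
theorem setIntegral_divergence (hΩ : IsOpen Ω) (hb : Bornology.IsBounded Ω)
    (hC : HasC2Boundary Ω) (hcont : ContinuousOn F (closure Ω)) (hdiff : ContDiffOn ℝ 1 F Ω)
    (hint : IntegrableOn (divergence F) Ω) :
    ∫ y in Ω, divergence F y = ∫ y, inner ℝ (outerNormal Ω y) (F y) ∂(surfaceMeasure Ω) := by
  have hK : IsCompact (closure Ω) :=
    Metric.isCompact_of_isClosed_isBounded isClosed_closure hb.closure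
  obtain ⟨s, φ, hφ, hsum, hdsum⟩ := exists_boundary_partition hΩ hb hC
  have hφd : ∀ i ∈ s, Differentiable ℝ (φ i) := fun i hi => (hφ i hi).1.differentiable (by simp)
  have hFd : ∀ y ∈ Ω, DifferentiableAt ℝ F y := fun y hy =>
    (hdiff.differentiableOn (by norm_num)).differentiableAt (hΩ.mem_nhds hy)
  have hdiv : ∀ i ∈ s, ∀ y ∈ Ω, divergence (fun y => φ i y • F y) y =
      φ i y * divergence F y + fderiv ℝ (φ i) y (F y) := fun i hi y hy =>
    divergence_smul (hφd i hi y) (hFd y hy)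
  have hinti : ∀ i ∈ s, IntegrableOn (divergence fun y => φ i y • F y) Ω := by
    intro i hi
    have h1 : IntegrableOn (fun y => φ i y * divergence F y) Ω := by
      obtain ⟨c, hc⟩ := (hφ i hi).1.continuous.bounded_above_of_compact_support (hφ i hi).2.1
      exact hint.bdd_mul (c := c) (hφ i hi).1.continuous.aestronglyMeasurable
        (ae_of_all _ hc)
    have h2 : IntegrableOn (fun y => fderiv ℝ (φ i) y (F y)) Ω := by
      refine IntegrableOn.mono_set (ContinuousOn.integrableOn_compact hK ?_) subset_closure
      exact ((hφ i hi).1.continuous_fderiv (by simp)).continuousOn.clm_apply hcont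
    exact (integrableOn_congr_fun (hdiv i hi) hΩ.measurableSet).2 (h1.add h2)
  -- The product rule leaves the extra terms `⟨∇φ i, F⟩`, which cancel in the sum.
  have hleft : ∫ y in Ω, divergence F y =
      ∑ i ∈ s, ∫ y in Ω, divergence (fun y => φ i y • F y) y := by
    rw [← integral_finsetSum s fun i hi => hinti i hi]
    refine setIntegral_congr_fun hΩ.measurableSet fun y hy => ?_
    rw [Finset.sum_congr rfl fun i hi => hdiv i hi y hy, Finset.sum_add_distrib,
      ← Finset.sum_mul, hsum y (subset_closure hy), one_mul, ← sum_apply,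
      hdsum y (subset_closure hy), zero_apply, add_zero]
  have hFf : ContinuousOn F (frontier Ω) := hcont.mono frontier_subset_closure
  have hright : ∫ y, inner ℝ (outerNormal Ω y) (F y) ∂(surfaceMeasure Ω) =
      ∑ i ∈ s, ∫ y, φ i y * inner ℝ (outerNormal Ω y) (F y) ∂(surfaceMeasure Ω) := by
    have hri : ∀ i ∈ s, Integrable (fun y => φ i y * inner ℝ (outerNormal Ω y) (F y))
        (surfaceMeasure Ω) := fun i hi => integrable_surfaceMeasure hΩ hb hC
      ((hφ i hi).1.continuous.continuousOn.mul ((continuousOn_outerNormal hΩ hC).inner hFf))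
    rw [← integral_finsetSum s hri]
    refine integral_congr_ae (ae_surfaceMeasure_mem_frontier.mono fun y hy => ?_)
    simp only
    rw [← Finset.sum_mul, hsum y (frontier_subset_closure hy), one_mul]
  rw [hleft, hright]
  refine Finset.sum_congr rfl fun i hi => ?_
  obtain ⟨h1, h2, h3 | ⟨e, g, U, h, h3⟩⟩ := hφ i hi
  · exact setIntegral_divergence_smul_of_tsupport_subset hΩ h1 h2 h3 hdiff
  · exact h.setIntegral_divergence_smul hΩ h1 h2 h3 hcont hdiff (hinti i hi)

end DivergenceTheorem

end RobinTorsion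

namespace RobinTorsion

open scoped ENNReal NNReal ContDiff

/-! ### Differential geometry of a graph -/

section GraphGeometry

theorem inner_fderiv_gradient {V : Type*} [NormedAddCommGroup V] [InnerProductSpace ℝ V]
    [CompleteSpace V] {g : V → ℝ} {v : V} (hg : ContDiffAt ℝ 2 g v) (k l : V) :
    inner ℝ (fderiv ℝ (gradient g) v k) l = fderiv ℝ (fderiv ℝ g) v k l := by
  have h1 : HasFDerivAt (fderiv ℝ g) (fderiv ℝ (fderiv ℝ g) v) v :=
    ((hg.fderiv_right (m := 1) (by norm_num)).differentiableAt (by norm_num)).hasFDerivAt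
  have h2 : HasFDerivAt (gradient g) (fderiv ℝ (gradient g) v) v := by
    refine (DifferentiableAt.comp v ?_ h1.differentiableAt).hasFDerivAt
    exact (toDual ℝ V).symm.contDiff.differentiable one_ne_zero _
  have h4 := h2.inner ℝ (hasFDerivAt_const l v)
  have h5 : HasFDerivAt (fun w => fderiv ℝ g w l)
      ((ContinuousLinearMap.apply ℝ ℝ l).comp (fderiv ℝ (fderiv ℝ g) v)) v :=
    (ContinuousLinearMap.apply ℝ ℝ l).hasFDerivAt.comp v h1
  simp_rw [inner_gradient_left] at h4
  have h6 := congrArg (fun A => A k) (h4.unique h5)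
  simpa [fderivInnerCLM_apply] using h6

theorem inner_fderiv_gradient_comm {V : Type*} [NormedAddCommGroup V] [InnerProductSpace ℝ V]
    [CompleteSpace V] {g : V → ℝ} {v : V} (hg : ContDiffAt ℝ 2 g v) (k l : V) :
    inner ℝ (fderiv ℝ (gradient g) v k) l = (inner ℝ (fderiv ℝ (gradient g) v l) k : ℝ) := by
  rw [inner_fderiv_gradient hg, inner_fderiv_gradient hg]
  exact hg.isSymmSndFDerivAt (by simp) k l

variable {N : ℕ} {e : EuclideanSpace ℝ (Fin N)} {g : (ℝ ∙ e)ᗮ → ℝ}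

theorem hasFDerivAt_unitGraphNormal (he : ‖e‖ = 1) (hg : ContDiff ℝ 2 g) (v : (ℝ ∙ e)ᗮ) :
    HasFDerivAt (unitGraphNormal e g) (fderiv ℝ (unitGraphNormal e g) v) v :=
  ((contDiff_unitGraphNormal he hg).differentiable (by norm_num) v).hasFDerivAt

theorem inner_unitGraphNormal_graphDeriv (he : ‖e‖ = 1) (v k : (ℝ ∙ e)ᗮ) :
    inner ℝ (unitGraphNormal e g v) (graphDeriv e g v k) = (0 : ℝ) := by
  rw [unitGraphNormal, real_inner_smul_left, inner_graphNormal_graphDeriv he, mul_zero]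

/-- Orthogonality to `e - ∇g` says that the height of `w` is the slope of `g` along its horizontal
part. Thus every tangent vector is the image of its horizontal projection, and tangential identities
can be checked on `graphDeriv`. -/
theorem eq_graphDeriv_of_inner_eq_zero (he : ‖e‖ = 1) {v : (ℝ ∙ e)ᗮ}
    {w : EuclideanSpace ℝ (Fin N)} (hw : inner ℝ (unitGraphNormal e g v) w = (0 : ℝ)) :
    graphDeriv e g v (hyperProj e w) = w := by
  have h1 : inner ℝ (graphNormal e g v) w = (0 : ℝ) := by
    rw [← norm_smul_unitGraphNormal he, real_inner_smul_left, hw, mul_zero]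
  rw [graphNormal, inner_sub_left, ← inner_hyperProj, sub_eq_zero] at h1
  rw [graphDeriv_apply, ← h1, coe_hyperProj_add he]

theorem hyperProj_graphDeriv (v k : (ℝ ∙ e)ᗮ) : hyperProj e (graphDeriv e g v k) = k := by
  rw [graphDeriv_apply, map_add, hyperProj_coe, map_smul, hyperProj_self, smul_zero, add_zero]

theorem inner_unitGraphNormal_self (he : ‖e‖ = 1) (v : (ℝ ∙ e)ᗮ) :
    inner ℝ (unitGraphNormal e g v) (unitGraphNormal e g v) = (1 : ℝ) := by
  rw [real_inner_self_eq_norm_sq, norm_unitGraphNormal he, one_pow]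

theorem inner_fderiv_unitGraphNormal (he : ‖e‖ = 1) (hg : ContDiff ℝ 2 g) (v k : (ℝ ∙ e)ᗮ) :
    inner ℝ (fderiv ℝ (unitGraphNormal e g) v k) (unitGraphNormal e g v) = (0 : ℝ) := by
  have h := hasFDerivAt_unitGraphNormal he hg v
  have h1 := h.inner ℝ h
  have h2 : (fun v => inner ℝ (unitGraphNormal e g v) (unitGraphNormal e g v)) =
      fun _ => (1 : ℝ) := funext fun v => inner_unitGraphNormal_self he v
  rw [h2] at h1
  have h3 := congrArg (fun A => A k) (h1.unique (hasFDerivAt_const (1 : ℝ) v))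
  simp [fderivInnerCLM_apply] at h3
  rw [real_inner_comm] at h3
  linarith

theorem norm_graphNormal_mul_inner (he : ‖e‖ = 1) (v : (ℝ ∙ e)ᗮ) :
    ‖graphNormal e g v‖ * inner ℝ e (unitGraphNormal e g v) = (1 : ℝ) := by
  rw [← real_inner_smul_right, norm_smul_unitGraphNormal he, graphNormal, inner_sub_right,
    inner_coe_hyperplane, inner_self_of_norm_one he, sub_zero]

/-- The second fundamental form of a graph is symmetric. -/
theorem inner_fderiv_unitGraphNormal_graphDeriv_comm (he : ‖e‖ = 1) (hg : ContDiff ℝ 2 g)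
    (v k l : (ℝ ∙ e)ᗮ) :
    inner ℝ (fderiv ℝ (unitGraphNormal e g) v k) (graphDeriv e g v l) =
      (inner ℝ (fderiv ℝ (unitGraphNormal e g) v l) (graphDeriv e g v k) : ℝ) := by
  have hN := hasFDerivAt_unitGraphNormal he hg v
  have ha : HasFDerivAt (gradient g) (fderiv ℝ (gradient g) v) v :=
    ((contDiff_gradient hg).differentiable (by norm_num) v).hasFDerivAt
  -- Differentiating `⟨ν, graphDeriv l⟩ = 0` shows that the second fundamental form is `-⟨ν, e⟩`
  -- times the Hessian of `g`, which is symmetric.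
  have key : ∀ k l, inner ℝ (fderiv ℝ (unitGraphNormal e g) v k) (graphDeriv e g v l) =
      -((inner ℝ (unitGraphNormal e g v) e : ℝ) * inner ℝ (fderiv ℝ (gradient g) v k) l) := by
    intro k l
    have hd : HasFDerivAt (fun v => graphDeriv e g v l)
        (((innerSL ℝ l).comp (fderiv ℝ (gradient g) v)).smulRight e) v := by
      have h1 : HasFDerivAt (fun v => (inner ℝ l (gradient g v) : ℝ) • e)
          (((innerSL ℝ l).comp (fderiv ℝ (gradient g) v)).smulRight e) v :=
        ((innerSL ℝ l).hasFDerivAt.comp v ha).smul_const e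
      have h2 := h1.const_add (l : EuclideanSpace ℝ (Fin N))
      refine h2.congr_of_eventuallyEq (Eventually.of_forall fun w => ?_)
      simp only [graphDeriv_apply]
      rw [real_inner_comm]
    have h1 := hN.inner ℝ hd
    have h2 : (fun v => inner ℝ (unitGraphNormal e g v) (graphDeriv e g v l)) =
        fun _ => (0 : ℝ) := funext fun v => inner_unitGraphNormal_graphDeriv he v l
    rw [h2] at h1
    have h3 := congrArg (fun A => A k) (h1.unique (hasFDerivAt_const (0 : ℝ) v))
    simp [fderivInnerCLM_apply, real_inner_smul_right] at h3
    rw [← Submodule.coe_inner] at h3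
    have h4 := real_inner_comm l (fderiv ℝ (gradient g) v k)
    linear_combination h3 + (inner ℝ (unitGraphNormal e g v) e : ℝ) * h4
  rw [key, key, inner_fderiv_gradient_comm hg.contDiffAt]

/-- Differentiate `‖e - ∇g‖ ⟨e, ν⟩ = 1` and multiply by the area element. -/
theorem fderiv_norm_graphNormal (he : ‖e‖ = 1) (hg : ContDiff ℝ 2 g) (v k : (ℝ ∙ e)ᗮ) :
    fderiv ℝ (fun v => ‖graphNormal e g v‖) v k =
      -(‖graphNormal e g v‖ ^ 2 * inner ℝ e (fderiv ℝ (unitGraphNormal e g) v k)) := by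
  have hW : HasFDerivAt (fun v => ‖graphNormal e g v‖)
      (fderiv ℝ (fun v => ‖graphNormal e g v‖) v) v :=
    ((contDiff_norm_graphNormal he hg).differentiable (by norm_num) v).hasFDerivAt
  have hN : HasFDerivAt (fun v => inner ℝ e (unitGraphNormal e g v))
      ((innerSL ℝ e).comp (fderiv ℝ (unitGraphNormal e g) v)) v :=
    (innerSL ℝ e).hasFDerivAt.comp v (hasFDerivAt_unitGraphNormal he hg v)
  have h1 := hW.mul hN
  have h2 : (fun v => ‖graphNormal e g v‖) * (fun v => inner ℝ e (unitGraphNormal e g v)) =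
      fun _ => (1 : ℝ) := funext fun v => norm_graphNormal_mul_inner he v
  rw [h2] at h1
  have h3 := congrArg (fun A => A k) (h1.unique (hasFDerivAt_const (1 : ℝ) v))
  simp at h3
  have h4 := norm_graphNormal_mul_inner (g := g) he v
  set W := ‖graphNormal e g v‖
  set c := fderiv ℝ (fun v => ‖graphNormal e g v‖) v k
  set d : ℝ := inner ℝ e (fderiv ℝ (unitGraphNormal e g) v k)
  linear_combination W * h3 - c * h4

/-- With `W = ‖e - ∇g‖`, the relation `W ⟨e, ν⟩ = 1` makes `ν - W e` a tangent vector, and its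
horizontal part is that of `ν`. -/
theorem graphDeriv_hyperProj_unitGraphNormal (he : ‖e‖ = 1) (v : (ℝ ∙ e)ᗮ) :
    graphDeriv e g v (hyperProj e (unitGraphNormal e g v)) =
      unitGraphNormal e g v - ‖graphNormal e g v‖ • e := by
  have h1 : inner ℝ (unitGraphNormal e g v) (unitGraphNormal e g v - ‖graphNormal e g v‖ • e) =
      (0 : ℝ) := by
    rw [inner_sub_right, inner_unitGraphNormal_self he, real_inner_smul_right,
      real_inner_comm, norm_graphNormal_mul_inner he, sub_self]
  have h2 := eq_graphDeriv_of_inner_eq_zero he h1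
  rwa [map_sub (hyperProj e), map_smul (hyperProj e), hyperProj_self, smul_zero, sub_zero] at h2

/-- The tangential divergence `tr L - ⟨Lν, ν⟩` depends only on the restriction of `L` to tangent
vectors. -/
theorem opTrace_sub_inner_eq (he : ‖e‖ = 1) {v : (ℝ ∙ e)ᗮ}
    {L : EuclideanSpace ℝ (Fin N) →L[ℝ] EuclideanSpace ℝ (Fin N)}
    {M : (ℝ ∙ e)ᗮ →L[ℝ] EuclideanSpace ℝ (Fin N)} (h : ∀ k, L (graphDeriv e g v k) = M k) :
    opTrace L - inner ℝ (L (unitGraphNormal e g v)) (unitGraphNormal e g v) =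
      opTrace ((hyperProj e).comp M) -
        inner ℝ (M (hyperProj e (unitGraphNormal e g v))) (unitGraphNormal e g v) := by
  set ν := unitGraphNormal e g v with hν
  -- `A` kills all tangent vectors, so it is the rank-one map `⟨ν, ·⟩ A ν`, and its trace is `⟨ν, A
  -- ν⟩`.
  set A := L - M.comp (hyperProj e) with hA
  have hA0 : ∀ k, A (graphDeriv e g v k) = 0 := by
    intro k
    rw [hA, sub_apply, ContinuousLinearMap.comp_apply, hyperProj_graphDeriv, h, sub_self]
  have hA1 : A = (innerSL ℝ ν).smulRight (A ν) := by
    ext1 y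
    have h1 : inner ℝ ν (y - (inner ℝ ν y : ℝ) • ν) = (0 : ℝ) := by
      rw [inner_sub_right, real_inner_smul_right, inner_unitGraphNormal_self he, mul_one, sub_self]
    have h2 := hA0 (hyperProj e (y - (inner ℝ ν y : ℝ) • ν))
    rw [eq_graphDeriv_of_inner_eq_zero he h1, map_sub, map_smul, sub_eq_zero] at h2
    rw [h2]; rfl
  have h1 : opTrace A = inner ℝ ν (A ν) := by
    conv_lhs => rw [hA1, opTrace_smulRight]
    rfl
  have h2 : opTrace A = opTrace L - opTrace ((hyperProj e).comp M) := by
    rw [hA, map_sub, opTrace_hyperplane_comp]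
  have h3 : inner ℝ ν (A ν) = (inner ℝ (L ν) ν : ℝ) - inner ℝ (M (hyperProj e ν)) ν := by
    rw [real_inner_comm, hA, ← inner_sub_left]; rfl
  linarith

/-- The tangential part of the field `X` along the graph, in graph coordinates and weighted by the
area element. -/
noncomputable def graphTangentField (e : EuclideanSpace ℝ (Fin N)) (g : (ℝ ∙ e)ᗮ → ℝ)
    (X : (ℝ ∙ e)ᗮ → EuclideanSpace ℝ (Fin N)) (v : (ℝ ∙ e)ᗮ) : (ℝ ∙ e)ᗮ :=
  ‖graphNormal e g v‖ •
    hyperProj e (X v - (inner ℝ (unitGraphNormal e g v) (X v) : ℝ) • unitGraphNormal e g v)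

set_option maxHeartbeats 1000000 in
-- This is what makes the first variation formula exact in a chart: the right side is the area
-- element times the tangential divergence of `X` minus curvature times its normal component, and
-- the left side is a flat divergence. The derivative of the area element cancels the term in which
-- `⟨ν, X⟩` is differentiated through `ν`.
theorem opTrace_fderiv_graphTangentField (he : ‖e‖ = 1) (hg : ContDiff ℝ 2 g)
    {X : (ℝ ∙ e)ᗮ → EuclideanSpace ℝ (Fin N)} {v : (ℝ ∙ e)ᗮ}
    {M : (ℝ ∙ e)ᗮ →L[ℝ] EuclideanSpace ℝ (Fin N)} (hX : HasFDerivAt X M v) :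
    opTrace (fderiv ℝ (graphTangentField e g X) v) = ‖graphNormal e g v‖ *
      (opTrace ((hyperProj e).comp M) -
        inner ℝ (M (hyperProj e (unitGraphNormal e g v))) (unitGraphNormal e g v) -
        opTrace ((hyperProj e).comp (fderiv ℝ (unitGraphNormal e g) v)) *
          inner ℝ (unitGraphNormal e g v) (X v)) := by
  have hN := hasFDerivAt_unitGraphNormal he hg v
  have hW : HasFDerivAt (fun v => ‖graphNormal e g v‖)
      (fderiv ℝ (fun v => ‖graphNormal e g v‖) v) v :=
    ((contDiff_norm_graphNormal he hg).differentiable (by norm_num) v).hasFDerivAt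
  set ν := unitGraphNormal e g v with hν
  set D := fderiv ℝ (unitGraphNormal e g) v with hD
  set W := ‖graphNormal e g v‖ with hWdef
  set W' := fderiv ℝ (fun v => ‖graphNormal e g v‖) v with hW'
  have hi : HasFDerivAt (fun v => (inner ℝ (unitGraphNormal e g v) (X v) : ℝ))
      ((innerSL ℝ ν).comp M + (innerSL ℝ (X v)).comp D) v := by
    refine (hN.inner ℝ hX).congr_fderiv ?_
    ext k
    simp [fderivInnerCLM_apply, real_inner_comm]
    rfl
  set T := X v - (inner ℝ ν (X v) : ℝ) • ν with hT
  have hZ := hW.smul ((hyperProj e).hasFDerivAt.comp v (hX.sub (hi.smul hN)))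
  have hZ' : fderiv ℝ (graphTangentField e g X) v =
      W • ((hyperProj e).comp M - ((inner ℝ ν (X v) : ℝ) • (hyperProj e).comp D +
        ((innerSL ℝ ν).comp M + (innerSL ℝ (X v)).comp D).smulRight (hyperProj e ν))) +
      W'.smulRight (hyperProj e T) := by
    rw [show graphTangentField e g X = _ from rfl]
    refine (hZ.congr_fderiv ?_).fderiv
    have h1 : (hyperProj e).comp ((inner ℝ ν (X v) : ℝ) • D +
        ((innerSL ℝ ν).comp M + (innerSL ℝ (X v)).comp D).smulRight ν) =
        (inner ℝ ν (X v) : ℝ) • (hyperProj e).comp D +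
          ((innerSL ℝ ν).comp M + (innerSL ℝ (X v)).comp D).smulRight (hyperProj e ν) := by
      ext1 k
      simp only [ContinuousLinearMap.comp_apply, add_apply, smul_apply,
        ContinuousLinearMap.smulRight_apply, map_add, map_smul]
    rw [← h1, ← ContinuousLinearMap.comp_sub]
    rfl
  -- `W'` involves `⟨e, Dν⟩`. Symmetry of the second fundamental form, applied to `T` and to the
  -- tangent vector `ν - W e`, converts it into the derivative of `ν` in the direction of the
  -- horizontal part of `ν`.
  have h1 : W' (hyperProj e T) = W * inner ℝ (X v) (D (hyperProj e ν)) := by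
    have ht : inner ℝ ν T = (0 : ℝ) := by
      rw [hT, inner_sub_right, real_inner_smul_right, inner_unitGraphNormal_self he]; ring
    have hNν : ∀ k, inner ℝ (D k) ν = (0 : ℝ) := inner_fderiv_unitGraphNormal he hg v
    clear_value T
    have h2 : inner ℝ (X v) (D (hyperProj e ν)) = (inner ℝ T (D (hyperProj e ν)) : ℝ) := by
      rw [hT, inner_sub_left, real_inner_smul_left,
        real_inner_comm (D (hyperProj e ν)) ν, hNν, mul_zero, sub_zero]
    have h3 := inner_fderiv_unitGraphNormal_graphDeriv_comm he hg v (hyperProj e ν)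
      (hyperProj e T)
    rw [eq_graphDeriv_of_inner_eq_zero he ht, graphDeriv_hyperProj_unitGraphNormal he,
      ← hD, ← hν, ← hWdef, inner_sub_right, hNν, real_inner_smul_right, zero_sub] at h3
    have h4 := fderiv_norm_graphNormal he hg v (hyperProj e T)
    rw [← hD] at h4
    rw [h2, real_inner_comm, h3, hW', h4, real_inner_comm e]
    ring
  rw [hZ', map_add, map_smul, map_sub, map_add, map_smul, opTrace_smulRight, opTrace_smulRight, h1]
  simp only [add_apply, ContinuousLinearMap.comp_apply, innerSL_apply_apply, smul_eq_mul]
  rw [real_inner_comm ν (M _)]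
  ring

end GraphGeometry

end RobinTorsion

namespace RobinTorsion

open scoped ENNReal NNReal ContDiff

/-! ### The shape operator and mean curvature -/

section ShapeOperator

variable {N : ℕ} {Ω U : Set (EuclideanSpace ℝ (Fin N))} {e : EuclideanSpace ℝ (Fin N)}
  {g : (ℝ ∙ e)ᗮ → ℝ}

theorem gradNormal_outerNormal (x : EuclideanSpace ℝ (Fin N)) :
    gradNormal Ω x (outerNormal Ω x) = 0 := by
  have h : (tangentSpace Ω x).starProjection (outerNormal Ω x) = 0 :=
    Submodule.starProjection_orthogonalComplement_singleton_eq_zero (outerNormal Ω x)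
  rw [gradNormal, ContinuousLinearMap.comp_apply, h, map_zero]

namespace IsGraphChart

theorem gradNormal_graphDeriv (h : IsGraphChart Ω e g U) (hΩ : IsOpen Ω) {v : (ℝ ∙ e)ᗮ}
    (hv : graphMap e g v ∈ U) (k : (ℝ ∙ e)ᗮ) :
    gradNormal Ω (graphMap e g v) (graphDeriv e g v k) = fderiv ℝ (unitGraphNormal e g) v k := by
  set y := graphMap e g v with hy
  have hyf : y ∈ frontier Ω := h.graphMap_mem_frontier hΩ hv
  have hN := hasFDerivAt_unitGraphNormal h.norm_eq_one h.contDiff v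
  -- Extending `ν` constantly along `e` proves differentiability along the boundary. A derivative
  -- within a hypersurface is not unique as a linear map on the whole space, but composition with
  -- the parametrization fixes its values on tangent vectors, so `fderivWithin` has the right ones.
  have h1 : HasFDerivWithinAt (outerNormal Ω)
      ((fderiv ℝ (unitGraphNormal e g) v).comp (hyperProj e)) (frontier Ω) y := by
    have hN' : HasFDerivAt (unitGraphNormal e g) (fderiv ℝ (unitGraphNormal e g) v)
        (hyperProj e y) := by rw [hy, hyperProj_graphMap]; exact hN
    refine (hN'.comp y (hyperProj e).hasFDerivAt).hasFDerivWithinAt.congr_of_eventuallyEq ?_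
      (h.outerNormal_eq hΩ hyf hv)
    filter_upwards [self_mem_nhdsWithin, mem_nhdsWithin_of_mem_nhds (h.isOpen.mem_nhds hv)]
      with z hz hzU using h.outerNormal_eq hΩ hz hzU
  have h2 := h1.differentiableWithinAt.hasFDerivWithinAt
  have h3 := h2.comp_hasFDerivAt v
    (hasFDerivAt_graphMap (h.contDiff.differentiable (by norm_num) v))
    ((h.eventually_mem hv).mono fun w hw => h.graphMap_mem_frontier hΩ hw)
  have h4 : outerNormal Ω ∘ graphMap e g =ᶠ[𝓝 v] unitGraphNormal e g :=
    (h.eventually_mem hv).mono fun w hw => h.outerNormal_graphMap hw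
  have h5 := congrArg (fun A => A k) ((h3.congr_of_eventuallyEq h4.symm).unique hN)
  have h6 : graphDeriv e g v k ∈ tangentSpace Ω y := by
    rw [tangentSpace, Submodule.mem_orthogonal_singleton_iff_inner_right, hy,
      h.outerNormal_graphMap hv, inner_unitGraphNormal_graphDeriv h.norm_eq_one]
  rw [gradNormal, ContinuousLinearMap.comp_apply,
    Submodule.starProjection_eq_self_iff.2 h6]
  exact h5

theorem opTrace_gradNormal (h : IsGraphChart Ω e g U) (hΩ : IsOpen Ω) {v : (ℝ ∙ e)ᗮ}
    (hv : graphMap e g v ∈ U) :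
    opTrace (gradNormal Ω (graphMap e g v)) =
      opTrace ((hyperProj e).comp (fderiv ℝ (unitGraphNormal e g) v)) := by
  have h1 := opTrace_sub_inner_eq h.norm_eq_one
    (fun k => h.gradNormal_graphDeriv hΩ hv k)
  rw [inner_fderiv_unitGraphNormal h.norm_eq_one h.contDiff, sub_zero] at h1
  rw [← h1]
  have h2 : gradNormal Ω (graphMap e g v) (unitGraphNormal e g v) = 0 := by
    rw [← h.outerNormal_graphMap hv, gradNormal_outerNormal]
  rw [h2, inner_zero_left, sub_zero]

end IsGraphChart

theorem exists_graphMap_eq (hΩ : IsOpen Ω) (hC : HasC2Boundary Ω)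
    {x : EuclideanSpace ℝ (Fin N)} (hx : x ∈ frontier Ω) :
    ∃ (e : EuclideanSpace ℝ (Fin N)) (g : (ℝ ∙ e)ᗮ → ℝ) (U : Set (EuclideanSpace ℝ (Fin N)))
      (v : (ℝ ∙ e)ᗮ), IsGraphChart Ω e g U ∧ graphMap e g v ∈ U ∧ graphMap e g v = x := by
  obtain ⟨e, g, U, h, hxU⟩ := exists_isGraphChart_of_mem_frontier hC hx
  have h1 := h.graphMap_hyperProj hΩ hx hxU
  exact ⟨e, g, U, hyperProj e x, h, by rwa [h1], h1⟩

theorem inner_gradNormal_outerNormal (hΩ : IsOpen Ω) (hC : HasC2Boundary Ω)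
    {x : EuclideanSpace ℝ (Fin N)} (hx : x ∈ frontier Ω) {w : EuclideanSpace ℝ (Fin N)}
    (hw : inner ℝ (outerNormal Ω x) w = (0 : ℝ)) :
    inner ℝ (gradNormal Ω x w) (outerNormal Ω x) = (0 : ℝ) := by
  obtain ⟨e, g, U, v, h, hv, rfl⟩ := exists_graphMap_eq hΩ hC hx
  rw [h.outerNormal_graphMap hv] at hw ⊢
  rw [← eq_graphDeriv_of_inner_eq_zero h.norm_eq_one hw, h.gradNormal_graphDeriv hΩ hv,
    inner_fderiv_unitGraphNormal h.norm_eq_one h.contDiff]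

theorem inner_gradNormal_comm (hΩ : IsOpen Ω) (hC : HasC2Boundary Ω)
    {x : EuclideanSpace ℝ (Fin N)} (hx : x ∈ frontier Ω) {w z : EuclideanSpace ℝ (Fin N)}
    (hw : inner ℝ (outerNormal Ω x) w = (0 : ℝ)) (hz : inner ℝ (outerNormal Ω x) z = (0 : ℝ)) :
    inner ℝ (gradNormal Ω x w) z = (inner ℝ w (gradNormal Ω x z) : ℝ) := by
  obtain ⟨e, g, U, v, h, hv, rfl⟩ := exists_graphMap_eq hΩ hC hx
  rw [h.outerNormal_graphMap hv] at hw hz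
  rw [← eq_graphDeriv_of_inner_eq_zero h.norm_eq_one hw,
    ← eq_graphDeriv_of_inner_eq_zero h.norm_eq_one hz, h.gradNormal_graphDeriv hΩ hv,
    h.gradNormal_graphDeriv hΩ hv,
    inner_fderiv_unitGraphNormal_graphDeriv_comm h.norm_eq_one h.contDiff, real_inner_comm]

/-- The sum of the principal curvatures is the trace of the shape operator. -/
theorem sub_one_mul_meanCurvature (hN : 2 ≤ N) (hΩ : IsOpen Ω) (hC : HasC2Boundary Ω)
    {x : EuclideanSpace ℝ (Fin N)} (hx : x ∈ frontier Ω) :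
    ((N : ℝ) - 1) * meanCurvature Ω x = opTrace (gradNormal Ω x) := by
  have hN1 : ((N : ℝ) - 1) ≠ 0 := by
    have : (2 : ℝ) ≤ N := by exact_mod_cast hN
    linarith
  -- A symmetric operator has a characteristic polynomial that splits over `ℝ`, so the sum of its
  -- roots is the full trace. Since `(∇ν)ν = 0`, restricting to the tangent space loses nothing of
  -- the trace.
  have hsym : (shapeOperator Ω x).IsSymmetric := by
    intro w z
    have hw := Submodule.mem_orthogonal_singleton_iff_inner_right.1 w.2
    have hz := Submodule.mem_orthogonal_singleton_iff_inner_right.1 z.2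
    have h1 : inner ℝ (shapeOperator Ω x w) z =
        (inner ℝ (gradNormal Ω x w) (z : EuclideanSpace ℝ (Fin N)) : ℝ) :=
      Submodule.inner_orthogonalProjectionOnto_eq_of_mem_right z _
    have h2 : inner ℝ w (shapeOperator Ω x z) =
        (inner ℝ (w : EuclideanSpace ℝ (Fin N)) (gradNormal Ω x z) : ℝ) :=
      Submodule.inner_orthogonalProjectionOnto_eq_of_mem_left w _
    rw [h1, h2, inner_gradNormal_comm hΩ hC hx hw hz]
  have htr := opTrace_eq_hyperplane_add (norm_outerNormal hΩ hC hx) (gradNormal Ω x)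
  rw [gradNormal_outerNormal, inner_zero_right, add_zero] at htr
  have htr2 : opTrace (gradNormal Ω x) = LinearMap.trace ℝ _ (shapeOperator Ω x) := htr
  rw [htr2, Module.End.trace_eq_sum_roots_charpoly_of_splits hsym.splits_charpoly, meanCurvature,
    principalCurvatures, ← mul_assoc, mul_one_div_cancel hN1, one_mul]

theorem continuousOn_opTrace_gradNormal (hΩ : IsOpen Ω) (hC : HasC2Boundary Ω) :
    ContinuousOn (fun x => opTrace (gradNormal Ω x)) (frontier Ω) := by
  intro x hx
  obtain ⟨e, g, U, h, hxU⟩ := exists_isGraphChart_of_mem_frontier hC hx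
  have hc : Continuous fun y => opTrace ((hyperProj e).comp
      (fderiv ℝ (unitGraphNormal e g) (hyperProj e y))) := by
    refine opTrace.continuous.comp (continuous_const.clm_comp ?_)
    exact ((contDiff_unitGraphNormal h.norm_eq_one h.contDiff).continuous_fderiv
      (by norm_num)).comp (hyperProj e).continuous
  have heq : ∀ y ∈ frontier Ω, y ∈ U → opTrace (gradNormal Ω y) = opTrace ((hyperProj e).comp
      (fderiv ℝ (unitGraphNormal e g) (hyperProj e y))) := by
    intro y hy hyU
    have h1 := h.graphMap_hyperProj hΩ hy hyU
    have h2 := h.opTrace_gradNormal hΩ (v := hyperProj e y) (by rwa [h1])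
    rwa [h1] at h2
  refine hc.continuousWithinAt.congr_of_eventuallyEq ?_ (heq x hx hxU)
  filter_upwards [self_mem_nhdsWithin, mem_nhdsWithin_of_mem_nhds (h.isOpen.mem_nhds hxU)]
    with y hy hyU using heq y hy hyU

theorem continuousOn_gradNormal_apply (hΩ : IsOpen Ω) (hC : HasC2Boundary Ω)
    {T : EuclideanSpace ℝ (Fin N) → EuclideanSpace ℝ (Fin N)} (hT : ContinuousOn T (frontier Ω))
    (hTt : ∀ x ∈ frontier Ω, inner ℝ (outerNormal Ω x) (T x) = (0 : ℝ)) :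
    ContinuousOn (fun x => gradNormal Ω x (T x)) (frontier Ω) := by
  intro x hx
  obtain ⟨e, g, U, h, hxU⟩ := exists_isGraphChart_of_mem_frontier hC hx
  have hc : ContinuousWithinAt (fun y => fderiv ℝ (unitGraphNormal e g) (hyperProj e y)
      (hyperProj e (T y))) (frontier Ω) x := by
    refine ContinuousWithinAt.clm_apply (Continuous.continuousWithinAt ?_)
      ((hyperProj e).continuous.continuousAt.comp_continuousWithinAt (hT x hx))
    exact ((contDiff_unitGraphNormal h.norm_eq_one h.contDiff).continuous_fderiv
      (by norm_num)).comp (hyperProj e).continuous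
  have heq : ∀ y ∈ frontier Ω, y ∈ U → gradNormal Ω y (T y) =
      fderiv ℝ (unitGraphNormal e g) (hyperProj e y) (hyperProj e (T y)) := by
    intro y hy hyU
    have h1 := h.graphMap_hyperProj hΩ hy hyU
    have hyU' : graphMap e g (hyperProj e y) ∈ U := by rwa [h1]
    have h2 := h.gradNormal_graphDeriv hΩ hyU' (hyperProj e (T y))
    have h3 := hTt y hy
    rw [h.outerNormal_eq hΩ hy hyU] at h3
    rw [h1, eq_graphDeriv_of_inner_eq_zero h.norm_eq_one h3] at h2
    exact h2
  refine hc.congr_of_eventuallyEq ?_ (heq x hx hxU)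
  filter_upwards [self_mem_nhdsWithin, mem_nhdsWithin_of_mem_nhds (h.isOpen.mem_nhds hxU)]
    with y hy hyU using heq y hy hyU

end ShapeOperator

/-! ### The first variation formula on the boundary -/

section FirstVariation

variable {N : ℕ} {Ω U : Set (EuclideanSpace ℝ (Fin N))} {e : EuclideanSpace ℝ (Fin N)}
  {g : (ℝ ∙ e)ᗮ → ℝ} {X : EuclideanSpace ℝ (Fin N) → EuclideanSpace ℝ (Fin N)}
  {L : EuclideanSpace ℝ (Fin N) → EuclideanSpace ℝ (Fin N) →L[ℝ] EuclideanSpace ℝ (Fin N)}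
  {φ : EuclideanSpace ℝ (Fin N) → ℝ}

/-- The derivative of `φ X` when `L` is the derivative of `X`. -/
noncomputable def smulDeriv (φ : EuclideanSpace ℝ (Fin N) → ℝ)
    (X : EuclideanSpace ℝ (Fin N) → EuclideanSpace ℝ (Fin N))
    (L : EuclideanSpace ℝ (Fin N) → EuclideanSpace ℝ (Fin N) →L[ℝ] EuclideanSpace ℝ (Fin N))
    (x : EuclideanSpace ℝ (Fin N)) : EuclideanSpace ℝ (Fin N) →L[ℝ] EuclideanSpace ℝ (Fin N) :=
  φ x • L x + (fderiv ℝ φ x).smulRight (X x)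

/-- The integrand of the first variation formula. -/
noncomputable def firstVariation (Ω : Set (EuclideanSpace ℝ (Fin N)))
    (X : EuclideanSpace ℝ (Fin N) → EuclideanSpace ℝ (Fin N))
    (L : EuclideanSpace ℝ (Fin N) → EuclideanSpace ℝ (Fin N) →L[ℝ] EuclideanSpace ℝ (Fin N))
    (x : EuclideanSpace ℝ (Fin N)) : ℝ :=
  opTrace (L x) - inner ℝ (L x (outerNormal Ω x)) (outerNormal Ω x) -
    opTrace (gradNormal Ω x) * inner ℝ (outerNormal Ω x) (X x)

theorem smulDeriv_eq_zero {x : EuclideanSpace ℝ (Fin N)} (hx : x ∉ tsupport φ) :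
    φ x = 0 ∧ smulDeriv φ X L x = 0 := by
  have h1 : φ x = 0 := image_eq_zero_of_notMem_tsupport hx
  have h2 : fderiv ℝ φ x = 0 := by
    by_contra hne
    exact hx (support_fderiv_subset ℝ hne)
  refine ⟨h1, ?_⟩
  rw [smulDeriv, h1, h2]
  ext1 k
  simp

theorem firstVariation_smul_eq_zero {x : EuclideanSpace ℝ (Fin N)} (hx : x ∉ tsupport φ) :
    firstVariation Ω (fun y => φ y • X y) (smulDeriv φ X L) x = 0 := by
  obtain ⟨h1, h2⟩ := smulDeriv_eq_zero (X := X) (L := L) hx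
  simp [firstVariation, h1, h2]

/-- The error in the product rule is the tangential derivative of `φ` along `X`. It is linear in the
derivative of `φ` and therefore sums to zero over the partition of unity. -/
theorem firstVariation_smul (x : EuclideanSpace ℝ (Fin N)) :
    firstVariation Ω (fun y => φ y • X y) (smulDeriv φ X L) x =
      φ x * firstVariation Ω X L x + (fderiv ℝ φ x (X x) -
        fderiv ℝ φ x (outerNormal Ω x) * inner ℝ (X x) (outerNormal Ω x)) := by
  simp only [firstVariation, smulDeriv, map_add, map_smul, opTrace_smulRight, add_apply,
    smul_apply, ContinuousLinearMap.smulRight_apply, inner_add_left, real_inner_smul_left,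
    real_inner_smul_right, smul_eq_mul]
  ring

/-- In the chart, the integrand times the area element is the divergence of `graphTangentField` for
the pulled-back field `φ X`. That field is `C¹` with compact support on the hyperplane, even though
`X` is differentiated only along the boundary. -/
theorem IsGraphChart.integral_firstVariation_smul (h : IsGraphChart Ω e g U) (hΩ : IsOpen Ω)
    (hφ : ContDiff ℝ ∞ φ) (hφc : HasCompactSupport φ) (hφU : tsupport φ ⊆ U)
    (hX : ∀ x ∈ frontier Ω, HasFDerivWithinAt X (L x) (frontier Ω) x)
    (hL : ContinuousOn L (frontier Ω)) :
    ∫ x, firstVariation Ω (fun y => φ y • X y) (smulDeriv φ X L) x ∂(surfaceMeasure Ω) = 0 := by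
  rw [h.integral_surfaceMeasure hΩ
    fun y hy => firstVariation_smul_eq_zero fun hm => hy (hφU hm)]
  have hemb := isClosedEmbedding_graphMap (e := e) h.contDiff.continuous
  have hφd : ∀ x, DifferentiableAt ℝ φ x := fun x => hφ.differentiable (by simp) x
  have hgd : Continuous (graphDeriv e g) := by
    unfold graphDeriv
    refine continuous_const.add ?_
    exact ((ContinuousLinearMap.smulRightL ℝ (ℝ ∙ e)ᗮ (EuclideanSpace ℝ (Fin N))).flip
      e).continuous.comp ((innerSL ℝ).continuous.comp (contDiff_gradient h.contDiff).continuous)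
  set Xh : (ℝ ∙ e)ᗮ → EuclideanSpace ℝ (Fin N) :=
    fun v => φ (graphMap e g v) • X (graphMap e g v) with hXh
  set M : (ℝ ∙ e)ᗮ → (ℝ ∙ e)ᗮ →L[ℝ] EuclideanSpace ℝ (Fin N) :=
    fun v => (smulDeriv φ X L (graphMap e g v)).comp (graphDeriv e g v) with hM
  have hmaps : ∀ v, graphMap e g v ∈ U → ∀ᶠ w in 𝓝 v, graphMap e g w ∈ frontier Ω :=
    fun v hv => (h.eventually_mem hv).mono fun w hw => h.graphMap_mem_frontier hΩ hw
  have hout : ∀ v, graphMap e g v ∉ U → ∀ᶠ w in 𝓝 v, graphMap e g w ∉ tsupport φ := by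
    intro v hv
    exact hemb.continuous.continuousAt.eventually
      ((isClosed_tsupport φ).isOpen_compl.mem_nhds fun hm => hv (hφU hm))
  -- Inside the chart this is the chain rule along the boundary; at a point outside `U`, which is
  -- off the support of `φ`, the field vanishes in a neighbourhood. The continuity of `M` splits in
  -- the same way.
  have hXd : ∀ v, HasFDerivAt Xh (M v) v := by
    intro v
    by_cases hv : graphMap e g v ∈ U
    · have hG := hasFDerivAt_graphMap (h.contDiff.differentiable (by norm_num) v)
      have h1 := (hX _ (h.graphMap_mem_frontier hΩ hv)).comp_hasFDerivAt v hG (hmaps v hv)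
      have h2 := ((hφd (graphMap e g v)).hasFDerivAt.comp v hG).smul h1
      refine h2.congr_fderiv ?_
      ext1 k
      rfl
    · have h0 : M v = 0 := by
        rw [hM]
        simp only
        rw [(smulDeriv_eq_zero fun hm => hv (hφU hm)).2, ContinuousLinearMap.zero_comp]
      rw [h0]
      refine (hasFDerivAt_const (0 : EuclideanSpace ℝ (Fin N)) v).congr_of_eventuallyEq ?_
      filter_upwards [hout v hv] with w hw
      rw [hXh]
      simp only
      rw [(smulDeriv_eq_zero (X := X) (L := L) hw).1, zero_smul]
  have hMc : Continuous M := by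
    refine continuous_iff_continuousAt.2 fun v => ?_
    by_cases hv : graphMap e g v ∈ U
    · have hvf := h.graphMap_mem_frontier hΩ hv
      have ht : Tendsto (graphMap e g) (𝓝 v) (𝓝[frontier Ω] (graphMap e g v)) :=
        tendsto_nhdsWithin_iff.2 ⟨hemb.continuous.continuousAt, hmaps v hv⟩
      have hLc : ContinuousAt (fun w => L (graphMap e g w)) v := (hL _ hvf).tendsto.comp ht
      have hXc : ContinuousAt (fun w => X (graphMap e g w)) v :=
        (hX _ hvf).continuousWithinAt.tendsto.comp ht
      have hφc' : ContinuousAt (fun w => φ (graphMap e g w)) v :=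
        (hφ.continuous.comp hemb.continuous).continuousAt
      have hDφ : ContinuousAt (fun w => fderiv ℝ φ (graphMap e g w)) v :=
        ((hφ.continuous_fderiv (by simp)).comp hemb.continuous).continuousAt
      refine ContinuousAt.clm_comp ((hφc'.smul hLc).add ?_) hgd.continuousAt
      have hb := (ContinuousLinearMap.smulRightL ℝ (EuclideanSpace ℝ (Fin N))
        (EuclideanSpace ℝ (Fin N))).isBoundedBilinearMap.continuous
      exact hb.continuousAt.comp (hDφ.prodMk hXc)
    · have h0 : M =ᶠ[𝓝 v] fun _ => 0 := by
        filter_upwards [hout v hv] with w hw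
        rw [hM]
        simp only
        rw [(smulDeriv_eq_zero hw).2, ContinuousLinearMap.zero_comp]
      exact continuousAt_const.congr h0.symm
  have hXC : ContDiff ℝ 1 Xh := contDiff_one_iff_hasFDerivAt.2 ⟨M, hMc, hXd⟩
  have hν := contDiff_unitGraphNormal h.norm_eq_one h.contDiff
  have hZC : ContDiff ℝ 1 (graphTangentField e g Xh) :=
    (contDiff_norm_graphNormal h.norm_eq_one h.contDiff).smul
      ((hyperProj e).contDiff.comp (hXC.sub ((hν.inner ℝ hXC).smul hν)))
  have hZs : HasCompactSupport (graphTangentField e g Xh) := by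
    refine HasCompactSupport.intro (hemb.isCompact_preimage hφc) fun v hv => ?_
    have h1 : Xh v = 0 := by
      rw [hXh]
      simp only
      rw [(smulDeriv_eq_zero (X := X) (L := L) hv).1, zero_smul]
    rw [graphTangentField, h1, inner_zero_right, zero_smul, sub_zero, map_zero, smul_zero]
  rw [← integral_opTrace_eq_zero (fun v => (hZC.differentiable (by norm_num) v).hasFDerivAt) hZs
    (hZC.continuous_fderiv (by norm_num))]
  refine integral_congr_ae (ae_of_all _ fun v => ?_)
  simp only
  rw [opTrace_fderiv_graphTangentField h.norm_eq_one h.contDiff (hXd v)]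
  by_cases hv : graphMap e g v ∈ U
  · rw [firstVariation, h.outerNormal_graphMap hv, h.opTrace_gradNormal hΩ hv,
      opTrace_sub_inner_eq h.norm_eq_one (M := M v) fun k => rfl]
  · have h0 : M v = 0 := by
      rw [hM]
      simp only
      rw [(smulDeriv_eq_zero fun hm => hv (hφU hm)).2, ContinuousLinearMap.zero_comp]
    have h1 : Xh v = 0 := by
      rw [hXh]
      simp only
      rw [(smulDeriv_eq_zero (X := X) (L := L) fun hm => hv (hφU hm)).1, zero_smul]
    rw [firstVariation_smul_eq_zero fun hm => hv (hφU hm), h0, h1]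
    simp

theorem continuousOn_firstVariation (hΩ : IsOpen Ω) (hC : HasC2Boundary Ω)
    (hX : ContinuousOn X (frontier Ω)) (hL : ContinuousOn L (frontier Ω)) :
    ContinuousOn (firstVariation Ω X L) (frontier Ω) := by
  have hν := continuousOn_outerNormal hΩ hC
  exact ((opTrace.continuous.comp_continuousOn hL).sub ((hL.clm_apply hν).inner hν)).sub
    ((continuousOn_opTrace_gradNormal hΩ hC).mul (hν.inner hX))

/-- The first variation formula on the closed hypersurface `∂Ω`: the integral of the tangential
divergence of `X` is the integral of the normal component times the sum of the principal
curvatures. -/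
theorem integral_firstVariation (hΩ : IsOpen Ω) (hb : Bornology.IsBounded Ω)
    (hC : HasC2Boundary Ω)
    (hX : ∀ x ∈ frontier Ω, HasFDerivWithinAt X (L x) (frontier Ω) x)
    (hL : ContinuousOn L (frontier Ω)) :
    ∫ x, firstVariation Ω X L x ∂(surfaceMeasure Ω) = 0 := by
  obtain ⟨s, φ, hφ, hsum, hdsum⟩ := exists_boundary_partition hΩ hb hC
  have hXc : ContinuousOn X (frontier Ω) := fun x hx => (hX x hx).continuousWithinAt
  have hν := continuousOn_outerNormal hΩ hC
  have hri : ∀ i ∈ s, Integrable (firstVariation Ω (fun y => φ i y • X y)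
      (smulDeriv (φ i) X L)) (surfaceMeasure Ω) := by
    intro i hi
    refine integrable_surfaceMeasure hΩ hb hC ?_
    have hD : ContinuousOn (fderiv ℝ (φ i)) (frontier Ω) :=
      ((hφ i hi).1.continuous_fderiv (by simp)).continuousOn
    have h1 := ((hφ i hi).1.continuous.continuousOn.mul
      (continuousOn_firstVariation hΩ hC hXc hL)).add
      ((hD.clm_apply hXc).sub ((hD.clm_apply hν).mul (hXc.inner hν)))
    exact h1.congr fun x _ => firstVariation_smul x
  have hright : ∫ x, firstVariation Ω X L x ∂(surfaceMeasure Ω) =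
      ∑ i ∈ s, ∫ x, firstVariation Ω (fun y => φ i y • X y) (smulDeriv (φ i) X L) x
        ∂(surfaceMeasure Ω) := by
    rw [← integral_finsetSum s hri]
    refine integral_congr_ae (ae_surfaceMeasure_mem_frontier.mono fun y hy => ?_)
    have hyc := frontier_subset_closure hy
    simp only [firstVariation_smul]
    rw [Finset.sum_add_distrib, Finset.sum_sub_distrib, ← Finset.sum_mul, ← Finset.sum_mul,
      hsum y hyc, ← sum_apply, ← sum_apply, hdsum y hyc]
    simp
  rw [hright]
  refine Finset.sum_eq_zero fun i hi => ?_
  obtain ⟨h1, h2, h3 | ⟨e, g, U, h, h3⟩⟩ := hφ i hi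
  · refine integral_eq_zero_of_ae (ae_surfaceMeasure_mem_frontier.mono fun y hy => ?_)
    refine firstVariation_smul_eq_zero fun hm => ?_
    rw [hΩ.frontier_eq] at hy
    exact hy.2 (h3 hm)
  · exact h.integral_firstVariation_smul hΩ h1 h2 h3 hX hL

end FirstVariation

end RobinTorsion

namespace RobinTorsion

open scoped ENNReal NNReal ContDiff

/-! ### Gradient and Hessian up to the boundary -/

section Hessian

theorem laplacian_eq_divergence_gradient {E : Type*} [NormedAddCommGroup E]
    [InnerProductSpace ℝ E] [FiniteDimensional ℝ E] {f : E → ℝ} {x : E}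
    (hf : ContDiffAt ℝ 2 f x) : Laplacian.laplacian f x = divergence (gradient f) x := by
  rw [laplacian_eq_iteratedFDeriv_stdOrthonormalBasis, divergence,
    opTrace_eq_sum (stdOrthonormalBasis ℝ E)]
  refine Finset.sum_congr rfl fun i _ => ?_
  rw [iteratedFDeriv_two_apply, real_inner_comm, inner_fderiv_gradient hf]
  rfl

variable {N : ℕ} {Ω : Set (EuclideanSpace ℝ (Fin N))} {u : EuclideanSpace ℝ (Fin N) → ℝ}

theorem IsDefiningFunctionAt.mem_tangentConeAt {x w : EuclideanSpace ℝ (Fin N)}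
    {ρ : EuclideanSpace ℝ (Fin N) → ℝ} (h : IsDefiningFunctionAt Ω x ρ)
    (hw : inner ℝ (gradient ρ x) w < (0 : ℝ)) : w ∈ tangentConeAt ℝ (closure Ω) x := by
  have h1 := (hasDerivAt_iff_tendsto_slope.1 (h.hasDerivAt_line w)).eventually_lt_const hw
  have hle : 𝓝[>] (0 : ℝ) ≤ 𝓝[≠] 0 := nhdsWithin_mono _ (fun t ht => ne_of_gt ht)
  refine mem_tangentConeAt_of_add_smul_mem (l := 𝓝[>] (0 : ℝ)) (c := id) hle ?_
  have hcont : Tendsto (fun t : ℝ => x + t • w) (𝓝[>] 0) (𝓝 x) :=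
    (IsGraphChart.tendsto_add_smul w x).mono_left nhdsWithin_le_nhds
  filter_upwards [hle h1, hcont.eventually h.eventually_mem_iff, self_mem_nhdsWithin]
    with t ht1 ht2 ht
  refine subset_closure (ht2.2 ?_)
  have ht : 0 < t := ht
  simp only [slope_def_field, zero_smul, add_zero, sub_zero, h.eq_zero] at ht1
  by_contra! hh
  exact absurd ht1 (not_lt.2 (div_nonneg hh ht.le))

/-- At a boundary point the tangent cone contains the open inward half-space, which spans. Hence
derivatives within the closure are uniquely determined, so the gradient and Hessian extend
continuously to the boundary. -/
theorem uniqueDiffOn_closure (hΩ : IsOpen Ω) (hC : HasC2Boundary Ω) :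
    UniqueDiffOn ℝ (closure Ω) := by
  intro x hx
  by_cases hxΩ : x ∈ Ω
  · exact (hΩ.uniqueDiffWithinAt hxΩ).mono subset_closure
  obtain ⟨ρ, h⟩ := hC x (by rw [hΩ.frontier_eq]; exact ⟨hx, hxΩ⟩)
  refine ⟨?_, subset_closure hx⟩
  set n := gradient ρ x with hn
  have hnn : (0 : ℝ) < inner ℝ n n := real_inner_self_pos.2 h.gradient_ne_zero
  have htop : Submodule.span ℝ (tangentConeAt ℝ (closure Ω) x) = ⊤ := by
    refine eq_top_iff.2 fun z _ => ?_
    -- `c` is taken large enough for `z - c n` to point inward; then `z` is a combination of the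
    -- inward vectors `z - c n` and `-n`.
    obtain ⟨c, hc⟩ : ∃ c : ℝ, inner ℝ n z < c * (inner ℝ n n : ℝ) :=
      ⟨(inner ℝ n z + 1) / inner ℝ n n, by rw [div_mul_cancel₀ _ hnn.ne']; linarith⟩
    have h1 : -n ∈ tangentConeAt ℝ (closure Ω) x :=
      h.mem_tangentConeAt (by rw [inner_neg_right]; linarith)
    have h2 : z - c • n ∈ tangentConeAt ℝ (closure Ω) x :=
      h.mem_tangentConeAt (by rw [inner_sub_right, inner_smul_right]; linarith)
    have h3 : z = (z - c • n) - c • (-n) := by simp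
    rw [h3]
    exact Submodule.sub_mem _ (Submodule.subset_span h2)
      (Submodule.smul_mem _ _ (Submodule.subset_span h1))
  rw [htop]
  exact dense_univ

/-- The Hessian matrix of a function on `closure Ω`, up to the boundary. -/
noncomputable def hess (Ω : Set (EuclideanSpace ℝ (Fin N))) (u : EuclideanSpace ℝ (Fin N) → ℝ)
    (x : EuclideanSpace ℝ (Fin N)) : EuclideanSpace ℝ (Fin N) →L[ℝ] EuclideanSpace ℝ (Fin N) :=
  fderivWithin ℝ (grad Ω u) (closure Ω) x

theorem contDiffOn_grad (hΩ : IsOpen Ω) (hC : HasC2Boundary Ω)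
    (hu : ContDiffOn ℝ 2 u (closure Ω)) : ContDiffOn ℝ 1 (grad Ω u) (closure Ω) :=
  (toDual ℝ (EuclideanSpace ℝ (Fin N))).symm.contDiff.comp_contDiffOn
    (hu.fderivWithin (uniqueDiffOn_closure hΩ hC) (m := 1) (by norm_num))

theorem hasFDerivWithinAt_closure (hu : ContDiffOn ℝ 2 u (closure Ω))
    {x : EuclideanSpace ℝ (Fin N)} (hx : x ∈ closure Ω) :
    HasFDerivWithinAt u (innerSL ℝ (grad Ω u x)) (closure Ω) x := by
  have h1 := (hu.differentiableOn (by norm_num) x hx).hasFDerivWithinAt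
  refine h1.congr_fderiv ?_
  ext w
  simp [grad, gradientWithin, toDual_symm_apply]

theorem hasFDerivWithinAt_grad (hΩ : IsOpen Ω) (hC : HasC2Boundary Ω)
    (hu : ContDiffOn ℝ 2 u (closure Ω)) {x : EuclideanSpace ℝ (Fin N)} (hx : x ∈ closure Ω) :
    HasFDerivWithinAt (grad Ω u) (hess Ω u x) (closure Ω) x :=
  ((contDiffOn_grad hΩ hC hu).differentiableOn (by norm_num) x hx).hasFDerivWithinAt

theorem continuousOn_hess (hΩ : IsOpen Ω) (hC : HasC2Boundary Ω)
    (hu : ContDiffOn ℝ 2 u (closure Ω)) : ContinuousOn (hess Ω u) (closure Ω) :=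
  (contDiffOn_grad hΩ hC hu).continuousOn_fderivWithin (uniqueDiffOn_closure hΩ hC) (by norm_num)

theorem closure_mem_nhds (hΩ : IsOpen Ω) {x : EuclideanSpace ℝ (Fin N)} (hx : x ∈ Ω) :
    closure Ω ∈ 𝓝 x :=
  mem_of_superset (hΩ.mem_nhds hx) subset_closure

theorem grad_eq_gradient (hΩ : IsOpen Ω) {x : EuclideanSpace ℝ (Fin N)} (hx : x ∈ Ω) :
    grad Ω u x = gradient u x := by
  rw [grad, gradientWithin, gradient, fderivWithin_of_mem_nhds (closure_mem_nhds hΩ hx)]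

theorem grad_eventuallyEq_gradient (hΩ : IsOpen Ω) {x : EuclideanSpace ℝ (Fin N)} (hx : x ∈ Ω) :
    grad Ω u =ᶠ[𝓝 x] gradient u :=
  (hΩ.eventually_mem hx).mono fun _ hy => grad_eq_gradient hΩ hy

theorem hess_eq_fderiv (hΩ : IsOpen Ω) {x : EuclideanSpace ℝ (Fin N)} (hx : x ∈ Ω) :
    hess Ω u x = fderiv ℝ (gradient u) x := by
  rw [hess, fderivWithin_of_mem_nhds (closure_mem_nhds hΩ hx),
    (grad_eventuallyEq_gradient hΩ hx).fderiv_eq]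

/-- Symmetry of the Hessian and the equation for its trace hold a priori only inside `Ω`; density
and continuity bring them to the boundary, where they are needed. -/
theorem eq_on_closure {f g : EuclideanSpace ℝ (Fin N) → ℝ} (hf : ContinuousOn f (closure Ω))
    (hg : ContinuousOn g (closure Ω)) (h : ∀ x ∈ Ω, f x = g x) {x : EuclideanSpace ℝ (Fin N)}
    (hx : x ∈ closure Ω) : f x = g x :=
  (show EqOn f g Ω from h).of_subset_closure hf hg subset_closure subset_rfl hx

theorem inner_hess_comm (hΩ : IsOpen Ω) (hC : HasC2Boundary Ω)
    (hu : ContDiffOn ℝ 2 u (closure Ω)) {x : EuclideanSpace ℝ (Fin N)} (hx : x ∈ closure Ω)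
    (v w : EuclideanSpace ℝ (Fin N)) :
    inner ℝ (hess Ω u x v) w = (inner ℝ v (hess Ω u x w) : ℝ) := by
  have hc := continuousOn_hess hΩ hC hu
  refine eq_on_closure (f := fun x => inner ℝ (hess Ω u x v) w)
    (g := fun x => inner ℝ v (hess Ω u x w))
    ((hc.clm_apply continuousOn_const).inner continuousOn_const)
    (continuousOn_const.inner (hc.clm_apply continuousOn_const)) (fun y hy => ?_) hx
  rw [hess_eq_fderiv hΩ hy, inner_fderiv_gradient_comm
    (hu.contDiffAt (closure_mem_nhds hΩ hy)), real_inner_comm]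

theorem opTrace_hess (hΩ : IsOpen Ω) (hC : HasC2Boundary Ω)
    (hu : ContDiffOn ℝ 2 u (closure Ω)) {c : ℝ}
    (hc : ∀ x ∈ Ω, Laplacian.laplacian u x = c) {x : EuclideanSpace ℝ (Fin N)}
    (hx : x ∈ closure Ω) : opTrace (hess Ω u x) = c := by
  refine eq_on_closure (f := fun x => opTrace (hess Ω u x)) (g := fun _ => c)
    (opTrace.continuous.comp_continuousOn (continuousOn_hess hΩ hC hu)) continuousOn_const
    (fun y hy => ?_) hx
  rw [hess_eq_fderiv hΩ hy, ← hc y hy, laplacian_eq_divergence_gradient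
    (hu.contDiffAt (closure_mem_nhds hΩ hy)), divergence]

end Hessian

end RobinTorsion

namespace RobinTorsion

open scoped ENNReal NNReal ContDiff

/-! ### Interior smoothness for constant Laplacian -/

section InteriorRegularity

variable {E : Type*} [NormedAddCommGroup E] [InnerProductSpace ℝ E] [FiniteDimensional ℝ E]
  [MeasurableSpace E] [BorelSpace E]

/-- A smooth bump `φ` such that `φ(y) y` is the gradient of a compactly supported function. -/
theorem exists_radial_bump {r : ℝ} (hr : 0 < r) :
    ∃ φ κ : E → ℝ, ContDiff ℝ ∞ φ ∧ (∀ y, r ≤ ‖y‖ → φ y = 0 ∧ κ y = 0) ∧ 0 < ∫ y, φ y ∧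
      ∀ y, HasFDerivAt κ (φ y • innerSL ℝ y) y := by
  let η : ContDiffBump (0 : ℝ) := ⟨r ^ 2 / 2, r ^ 2, by positivity, by linarith [sq_pos_of_pos hr]⟩
  have h0 : ∀ s : ℝ, r ^ 2 ≤ s → η s = 0 := fun s hs =>
    η.zero_of_le_dist (by rw [Real.dist_0_eq_abs]; exact hs.trans (le_abs_self s))
  have hφ : ContDiff ℝ ∞ fun y : E => η (‖y‖ ^ 2) := η.contDiff.comp (contDiff_norm_sq ℝ)
  have hφ0 : ∀ y : E, r ≤ ‖y‖ → η (‖y‖ ^ 2) = 0 := fun y hy => h0 _ (by gcongr)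
  -- `κ` is half a primitive of `η`, evaluated at `‖y‖²`, so its gradient is `η(‖y‖²) y`. Starting
  -- the primitive at `r²` makes it vanish for `‖y‖ ≥ r`.
  refine ⟨fun y => η (‖y‖ ^ 2), fun y => 1 / 2 * ∫ s in (r ^ 2)..(‖y‖ ^ 2), η s, hφ,
    fun y hy => ⟨hφ0 y hy, ?_⟩, ?_, fun y => ?_⟩
  · have : ∫ s in (r ^ 2)..(‖y‖ ^ 2), η s = ∫ s in (r ^ 2)..(‖y‖ ^ 2), (0 : ℝ) := by
      refine intervalIntegral.integral_congr fun s hs => h0 s ?_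
      rw [uIcc_of_le (by gcongr)] at hs
      exact hs.1
    simp [this]
  · refine hφ.continuous.integral_pos_of_hasCompactSupport_nonneg_nonzero (x := 0) ?_
      (fun y => η.nonneg) ?_
    · refine HasCompactSupport.intro (isCompact_closedBall (0 : E) r) fun y hy => hφ0 y ?_
      rw [mem_closedBall_zero_iff, not_le] at hy
      exact hy.le
    · have : η (‖(0 : E)‖ ^ 2) = 1 :=
        η.one_of_mem_closedBall (by simpa using (by positivity : (0 : ℝ) ≤ r ^ 2 / 2))
      rw [this]
      exact one_ne_zero
  · have h1 : HasDerivAt (fun t => ∫ s in (r ^ 2)..t, η s) (η (‖y‖ ^ 2)) (‖y‖ ^ 2) :=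
      (η.continuous.integral_hasStrictDerivAt _ _).hasDerivAt
    have h2 := (h1.comp_hasFDerivAt y (hasStrictFDerivAt_norm_sq y).hasFDerivAt).const_mul (1 / 2)
    refine h2.congr_fderiv ?_
    ext k
    simp
    ring

variable {w φ κ : E → ℝ} {c r : ℝ} {x : E}

/-- Differentiating a spherical average of `w` in the radius gives the average of `Δw`. -/
theorem integral_mul_fderiv_sub_smul (hw : ContDiff ℝ 2 w) (hφ : Continuous φ)
    (hsupp : ∀ y, r ≤ ‖y‖ → φ y = 0 ∧ κ y = 0) (hκ : ∀ y, HasFDerivAt κ (φ y • innerSL ℝ y) y)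
    (hc : ∀ z, ‖x - z‖ < r → divergence (gradient w) z = c) {ε : ℝ} (hε : |ε| ≤ 1) :
    ∫ y, φ y * fderiv ℝ w (x - ε • y) y = ε * c * ∫ y, κ y := by
  have hgw := contDiff_gradient hw
  have hl : ∀ y, HasFDerivAt (fun y : E => x - ε • y) (-(ε • ContinuousLinearMap.id ℝ E)) y :=
    fun y => ((hasFDerivAt_id y).const_smul ε).const_sub x
  have hκc : Continuous κ := continuous_iff_continuousAt.2 fun y => (hκ y).continuousAt
  have hcs : ∀ {f : E → ℝ}, (∀ y, r ≤ ‖y‖ → f y = 0) → HasCompactSupport f := fun hf =>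
    HasCompactSupport.intro (isCompact_closedBall (0 : E) r) fun y hy => hf y (by
      rw [mem_closedBall_zero_iff, not_le] at hy
      exact hy.le)
  -- The compactly supported field `κ(y) ∇w(x - ε y)` has divergence `φ(y) ⟨∇w(x - ε y), y⟩ - ε κ(y)
  -- Δw(x - ε y)`. Since `|ε| ≤ 1`, the Laplacian is evaluated where it equals `c` whenever `κ` is
  -- nonzero.
  have hZ := fun y => (hκ y).smul (((hgw.differentiable (by norm_num) _).hasFDerivAt).comp y (hl y))
  have h1 := integral_opTrace_eq_zero hZ
    (HasCompactSupport.smul_right (hcs fun y hy => (hsupp y hy).2)) (by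
      have h2 := hgw.continuous_fderiv (by norm_num)
      have h3 := hgw.continuous
      have h4 : Continuous fun y => (ContinuousLinearMap.smulRightL ℝ E E) (φ y • innerSL ℝ y)
        (gradient w (x - ε • y)) := by
        have hb := (ContinuousLinearMap.smulRightL ℝ E E).isBoundedBilinearMap.continuous
        exact hb.comp ((hφ.smul (innerSL ℝ).continuous).prodMk (h3.comp (by fun_prop)))
      refine Continuous.add ?_ h4
      refine hκc.smul (Continuous.clm_comp (h2.comp (by fun_prop)) continuous_const))
  have h5 : ∀ y, opTrace (κ y • (fderiv ℝ (gradient w) (x - ε • y)).comp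
      (-(ε • ContinuousLinearMap.id ℝ E)) + (φ y • innerSL ℝ y).smulRight
        (gradient w (x - ε • y))) =
      φ y * fderiv ℝ w (x - ε • y) y - ε * c * κ y := by
    intro y
    have h6 : (fderiv ℝ (gradient w) (x - ε • y)).comp (-(ε • ContinuousLinearMap.id ℝ E)) =
        -(ε • fderiv ℝ (gradient w) (x - ε • y)) := by ext1 k; simp
    rw [map_add, map_smul, h6, map_neg, map_smul, opTrace_smulRight, smul_apply,
      innerSL_apply_apply, real_inner_comm, inner_gradient_left]
    by_cases hy : r ≤ ‖y‖
    · simp [hsupp y hy]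
    · have h7 := hc (x - ε • y) (by
        rw [sub_sub_cancel, norm_smul, Real.norm_eq_abs]
        nlinarith [norm_nonneg y])
      rw [divergence] at h7
      rw [h7]
      simp only [smul_eq_mul]
      ring
  have h8 : ∫ y, (φ y * fderiv ℝ w (x - ε • y) y - ε * c * κ y) = 0 := by
    rw [← h1]
    exact integral_congr_ae (ae_of_all _ fun y => (h5 y).symm)
  have hi1 : Integrable fun y => φ y * fderiv ℝ w (x - ε • y) y := by
    refine Continuous.integrable_of_hasCompactSupport ?_ (hcs fun y hy => by
      rw [(hsupp y hy).1, zero_mul])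
    have := hw.continuous_fderiv (by norm_num)
    exact hφ.mul ((this.comp (by fun_prop)).clm_apply continuous_id)
  have hi2 : Integrable κ := hκc.integrable_of_hasCompactSupport (hcs fun y hy => (hsupp y hy).2)
  rw [integral_sub hi1 (hi2.const_mul _), integral_const_mul, sub_eq_zero] at h8
  exact h8

/-- A mean value formula for functions of constant Laplacian. -/
theorem integral_mul_sub_eq (hw : ContDiff ℝ 2 w) (hwc : HasCompactSupport w) (hφ : Continuous φ)
    (hsupp : ∀ y, r ≤ ‖y‖ → φ y = 0 ∧ κ y = 0) (hκ : ∀ y, HasFDerivAt κ (φ y • innerSL ℝ y) y)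
    (hc : ∀ z, ‖x - z‖ < r → divergence (gradient w) z = c) :
    (∫ y, φ y) * w x = (∫ y, φ y * w (x - y)) + c * (∫ y, κ y) / 2 := by
  have hcs : ∀ {f : E → ℝ}, (∀ y, r ≤ ‖y‖ → f y = 0) → HasCompactSupport f := fun hf =>
    HasCompactSupport.intro (isCompact_closedBall (0 : E) r) fun y hy => hf y (by
      rw [mem_closedBall_zero_iff, not_le] at hy
      exact hy.le)
  have hfw := hw.continuous_fderiv (by norm_num)
  obtain ⟨C, hC⟩ := (hwc.fderiv ℝ).exists_bound_of_continuous hfw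
  have hder : ∀ ε : ℝ, HasDerivAt (fun ε : ℝ => ∫ y, φ y * w (x - ε • y))
      (∫ y, -(φ y * fderiv ℝ w (x - ε • y) y)) ε := by
    intro ε
    refine (hasDerivAt_integral_of_dominated_loc_of_deriv_le (s := univ)
      (F := fun ε y => φ y * w (x - ε • y))
      (F' := fun ε y => -(φ y * fderiv ℝ w (x - ε • y) y))
      (bound := fun y => |φ y| * (C * ‖y‖)) univ_mem ?_ ?_ ?_ ?_ ?_ ?_).2
    · refine Eventually.of_forall fun ε => Continuous.aestronglyMeasurable ?_
      exact hφ.mul (hw.continuous.comp (by fun_prop))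
    · refine Continuous.integrable_of_hasCompactSupport
        (hφ.mul (hw.continuous.comp (by fun_prop))) (hcs fun y hy => ?_)
      rw [(hsupp y hy).1, zero_mul]
    · refine Continuous.aestronglyMeasurable ?_
      exact (hφ.mul ((hfw.comp (by fun_prop)).clm_apply continuous_id)).neg
    · refine ae_of_all _ fun y ε _ => ?_
      rw [norm_neg, norm_mul, Real.norm_eq_abs]
      gcongr
      exact (ContinuousLinearMap.le_opNorm _ _).trans (by gcongr; exact hC _)
    · refine Continuous.integrable_of_hasCompactSupport (by fun_prop) (hcs fun y hy => ?_)
      rw [(hsupp y hy).1, abs_zero, zero_mul]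
    · refine ae_of_all _ fun y ε _ => ?_
      have h1 : HasDerivAt (fun ε : ℝ => x - ε • y) (-y) ε := by
        simpa using ((hasDerivAt_id ε).smul_const y).const_sub x
      have h2 := (((hw.differentiable (by norm_num) (x - ε • y)).hasFDerivAt.comp_hasDerivAt ε
        h1).const_mul (φ y))
      simpa using h2
  -- The average of `w(x - ε y)` against `φ` has derivative `-ε c ∫ κ`, which the quadratic
  -- correction cancels. The corrected average is thus constant, and its values at `ε = 0` and `ε =
  -- 1` give the formula.
  have hder2 : ∀ ε ∈ Icc (0 : ℝ) 1, HasDerivAt (fun ε : ℝ => (∫ y, φ y * w (x - ε • y)) +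
      c * (∫ y, κ y) / 2 * ε ^ 2) 0 ε := by
    intro ε hε
    have h1 := (hder ε).add ((hasDerivAt_pow 2 ε).const_mul (c * (∫ y, κ y) / 2))
    refine h1.congr_deriv ?_
    rw [integral_neg, integral_mul_fderiv_sub_smul hw hφ hsupp hκ hc
      (abs_le.2 ⟨by linarith [hε.1], hε.2⟩)]
    simp
    ring
  have h3 := constant_of_has_deriv_right_zero
    (fun ε hε => (hder2 ε hε).continuousAt.continuousWithinAt)
    (fun ε hε => (hder2 ε (Ico_subset_Icc_self hε)).hasDerivWithinAt) 1
    (right_mem_Icc.2 zero_le_one)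
  simp only [one_smul, zero_smul, sub_zero, one_pow, mul_one, integral_mul_const] at h3
  rw [h3]
  simp

/-- By the mean value formula, near `x` the function is a multiple of its convolution with a smooth
kernel plus a constant, so it inherits the smoothness of the kernel. -/
theorem contDiffAt_of_laplacian_eq_const {Ω : Set E} (hΩ : IsOpen Ω) {u : E → ℝ}
    (hu : ContDiffOn ℝ 2 u Ω) (hc : ∀ z ∈ Ω, Laplacian.laplacian u z = c) (hx : x ∈ Ω) :
    ContDiffAt ℝ ∞ u x := by
  obtain ⟨R, hR, hRΩ⟩ := Metric.isOpen_iff.1 hΩ x hx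
  -- The kernel has radius `R/4`. For `z` within `R/4` of `x`, it only sees the ball of radius
  -- `R/2`, where the cutoff is `1` and `w = u`; the outer radius `2R/3` keeps the support in `Ω`.
  let χ : ContDiffBump x := ⟨R / 2, 2 * R / 3, by positivity, by linarith⟩
  have hχs : tsupport χ ⊆ Ω := by
    rw [χ.tsupport_eq]
    exact (Metric.closedBall_subset_ball (by change 2 * R / 3 < R; linarith)).trans hRΩ
  set w : E → ℝ := fun y => χ y • u y with hw
  have hw2 : ContDiff ℝ 2 w := by
    rw [← contDiffOn_univ]
    exact contDiffOn_smul_of_tsupport hΩ χ.contDiff hχs (by rwa [univ_inter])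
  have hwc : HasCompactSupport w := χ.hasCompactSupport.smul_right
  have hwu : ∀ z ∈ Metric.ball x (R / 2), w =ᶠ[𝓝 z] u := by
    intro z hz
    filter_upwards [Metric.isOpen_ball.mem_nhds hz] with y hy
    simp only [hw]
    rw [χ.one_of_mem_closedBall (Metric.ball_subset_closedBall hy), one_smul]
  obtain ⟨φ, κ, hφ, hsupp, hpos, hκ⟩ := exists_radial_bump (E := E) (r := R / 4) (by positivity)
  have hφc : HasCompactSupport φ :=
    HasCompactSupport.intro (isCompact_closedBall (0 : E) (R / 4)) fun y hy => (hsupp y (by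
      rw [mem_closedBall_zero_iff, not_le] at hy
      exact hy.le)).1
  have hconv : ContDiff ℝ ∞ (convolution φ w (ContinuousLinearMap.lsmul ℝ ℝ) volume) :=
    hφc.contDiff_convolution_left (n := (⊤ : ℕ∞)) _ hφ hw2.continuous.locallyIntegrable
  have hcongr : u =ᶠ[𝓝 x] fun z => (∫ y, φ y)⁻¹ *
      (convolution φ w (ContinuousLinearMap.lsmul ℝ ℝ) volume z + c * (∫ y, κ y) / 2) := by
    filter_upwards [Metric.ball_mem_nhds x (show 0 < R / 4 by positivity)] with z hz
    have h1 := integral_mul_sub_eq (x := z) hw2 hwc hφ.continuous hsupp hκ (c := c) (by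
      intro y hy
      have hyb : y ∈ Metric.ball x (R / 2) := by
        rw [← dist_eq_norm, dist_comm] at hy
        rw [Metric.mem_ball] at hz ⊢
        linarith [dist_triangle y z x]
      have hyΩ : y ∈ Ω := hRΩ (Metric.ball_subset_ball (by linarith) hyb)
      rw [← laplacian_eq_divergence_gradient hw2.contDiffAt, ← hc y hyΩ]
      exact (laplacian_congr_nhds (hwu y hyb)).self_of_nhds)
    have h2 : w z = u z :=
      (hwu z (Metric.ball_subset_ball (by linarith) hz)).self_of_nhds
    rw [eq_inv_mul_iff_mul_eq₀ hpos.ne', ← h2, h1]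
    rfl
  exact (contDiff_const.mul (hconv.add contDiff_const)).contDiffAt.congr_of_eventuallyEq hcongr

end InteriorRegularity

end RobinTorsion

namespace RobinTorsion

open scoped ENNReal NNReal ContDiff

/-! ### The function `P`: gradient and Laplacian -/

section PFunction

/-- The product rule also produces the trace of `k ↦ D²G(k, G)`. By symmetry of the second
derivative this is the derivative of `div G` along `G`, which is zero because `div G` is constant.
-/
theorem divergence_fderiv_apply_self {E : Type*} [NormedAddCommGroup E] [InnerProductSpace ℝ E]
    [FiniteDimensional ℝ E] {G : E → E} {x : E} {c : ℝ} (hG : ContDiffAt ℝ 2 G x)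
    (hc : ∀ᶠ y in 𝓝 x, divergence G y = c) :
    divergence (fun y => fderiv ℝ G y (G y)) x = opTrace ((fderiv ℝ G x).comp (fderiv ℝ G x)) := by
  have h1 : HasFDerivAt (fderiv ℝ G) (fderiv ℝ (fderiv ℝ G) x) x :=
    ((hG.fderiv_right (m := 1) (by norm_num)).differentiableAt (by norm_num)).hasFDerivAt
  have h2 := h1.clm_apply (hG.differentiableAt (by norm_num)).hasFDerivAt
  have h3 : (fderiv ℝ (fderiv ℝ G) x).flip (G x) = fderiv ℝ (fderiv ℝ G) x (G x) := by
    ext1 k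
    exact hG.isSymmSndFDerivAt (by simp) k (G x)
  have h4 : opTrace (fderiv ℝ (fderiv ℝ G) x (G x)) = 0 := by
    have h5 : HasFDerivAt (divergence G) (opTrace.comp (fderiv ℝ (fderiv ℝ G) x)) x :=
      (opTrace (E := E)).hasFDerivAt (x := fderiv ℝ G x) |>.comp x h1
    have h6 : divergence G =ᶠ[𝓝 x] fun _ => c := hc
    have h7 := h5.unique ((hasFDerivAt_const c x).congr_of_eventuallyEq h6)
    exact congrArg (fun A => A (G x)) h7
  rw [divergence, h2.fderiv, map_add, h3, h4, add_zero]

variable {N : ℕ} {Ω : Set (EuclideanSpace ℝ (Fin N))} {u : EuclideanSpace ℝ (Fin N) → ℝ} {c : ℝ}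
  {x : EuclideanSpace ℝ (Fin N)}

theorem contDiffOn_pFunction (hΩ : IsOpen Ω) (hu : ContDiffOn ℝ ∞ u Ω) :
    ContDiffOn ℝ 2 (pFunction Ω u) Ω := by
  have h1 : ContDiffOn ℝ 2 (gradient u) Ω :=
    (toDual ℝ (EuclideanSpace ℝ (Fin N))).symm.contDiff.comp_contDiffOn
      (hu.fderiv_of_isOpen hΩ (m := 2) (by norm_cast))
  have h2 : ContDiffOn ℝ 2 (fun x => 1 / 2 * ‖gradient u x‖ ^ 2 - u x) Ω :=
    (contDiffOn_const.mul (h1.norm_sq ℝ)).sub (hu.of_le (by norm_cast))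
  exact h2.congr fun y hy => by rw [pFunction, grad_eq_gradient hΩ hy]

/-- The gradient of `P`, up to the boundary. -/
noncomputable def pGradient (Ω : Set (EuclideanSpace ℝ (Fin N)))
    (u : EuclideanSpace ℝ (Fin N) → ℝ) (x : EuclideanSpace ℝ (Fin N)) :
    EuclideanSpace ℝ (Fin N) :=
  hess Ω u x (grad Ω u x) - grad Ω u x

theorem gradient_pFunction (hΩ : IsOpen Ω) (hC : HasC2Boundary Ω)
    (hu : ContDiffOn ℝ 2 u (closure Ω)) (hx : x ∈ Ω) :
    gradient (pFunction Ω u) x = pGradient Ω u x := by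
  have hxc := subset_closure hx
  have h1 := (hasFDerivWithinAt_grad hΩ hC hu hxc).hasFDerivAt (closure_mem_nhds hΩ hx)
  have h2 := (hasFDerivWithinAt_closure hu hxc).hasFDerivAt (closure_mem_nhds hΩ hx)
  have h3 : HasFDerivAt (pFunction Ω u) _ x := (h1.norm_sq.const_mul (1 / 2)).sub h2
  refine HasGradientAt.gradient (hasGradientAt_iff_hasFDerivAt.2 (h3.congr_fderiv ?_))
  ext k
  simp [pGradient, inner_hess_comm hΩ hC hu hxc]

theorem continuousOn_pGradient (hΩ : IsOpen Ω) (hC : HasC2Boundary Ω)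
    (hu : ContDiffOn ℝ 2 u (closure Ω)) : ContinuousOn (pGradient Ω u) (closure Ω) :=
  have h := (contDiffOn_grad hΩ hC hu).continuousOn
  ((continuousOn_hess hΩ hC hu).clm_apply h).sub h

theorem contDiffOn_pGradient (hΩ : IsOpen Ω) (hC : HasC2Boundary Ω)
    (hu : ContDiffOn ℝ 2 u (closure Ω)) (hu' : ContDiffOn ℝ ∞ u Ω) :
    ContDiffOn ℝ 1 (pGradient Ω u) Ω := by
  have h1 : ContDiffOn ℝ 1 (gradient (pFunction Ω u)) Ω :=
    (toDual ℝ (EuclideanSpace ℝ (Fin N))).symm.contDiff.comp_contDiffOn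
      ((contDiffOn_pFunction hΩ hu').fderiv_of_isOpen hΩ (m := 1) (by norm_num))
  exact h1.congr fun y hy => (gradient_pFunction hΩ hC hu hy).symm

theorem laplacian_pFunction (hΩ : IsOpen Ω) (hC : HasC2Boundary Ω)
    (hu : ContDiffOn ℝ 2 u (closure Ω)) (hu' : ContDiffOn ℝ ∞ u Ω) (hx : x ∈ Ω) :
    Laplacian.laplacian (pFunction Ω u) x = divergence (pGradient Ω u) x := by
  have h : gradient (pFunction Ω u) =ᶠ[𝓝 x] pGradient Ω u :=
    (hΩ.eventually_mem hx).mono fun y hy => gradient_pFunction hΩ hC hu hy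
  rw [laplacian_eq_divergence_gradient ((contDiffOn_pFunction hΩ hu').contDiffAt
    (hΩ.mem_nhds hx)), divergence, divergence, h.fderiv_eq]

theorem divergence_grad (hΩ : IsOpen Ω) (hC : HasC2Boundary Ω)
    (hu : ContDiffOn ℝ 2 u (closure Ω)) (hc : ∀ x ∈ Ω, Laplacian.laplacian u x = c)
    (hx : x ∈ Ω) : divergence (grad Ω u) x = c := by
  rw [← opTrace_hess hΩ hC hu hc (subset_closure hx), hess,
    fderivWithin_of_mem_nhds (closure_mem_nhds hΩ hx), divergence]

theorem divergence_pGradient (hΩ : IsOpen Ω) (hu : ContDiffOn ℝ 2 u (closure Ω)) (hu' : ContDiffOn ℝ ∞ u Ω)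
    (hc : ∀ x ∈ Ω, Laplacian.laplacian u x = c) (hx : x ∈ Ω) :
    divergence (pGradient Ω u) x = opTrace ((hess Ω u x).comp (hess Ω u x)) - c := by
  have hG : ContDiffAt ℝ 2 (gradient u) x :=
    (toDual ℝ (EuclideanSpace ℝ (Fin N))).symm.contDiff.contDiffAt.comp x
      ((hu'.contDiffAt (hΩ.mem_nhds hx)).fderiv_right (m := 2) (by norm_cast))
  have h1 : ∀ᶠ y in 𝓝 x, divergence (gradient u) y = c :=
    (hΩ.eventually_mem hx).mono fun y hy => by
      rw [← laplacian_eq_divergence_gradient (hu.contDiffAt (closure_mem_nhds hΩ hy)), hc y hy]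
  have h2 : pGradient Ω u =ᶠ[𝓝 x] fun y => fderiv ℝ (gradient u) y (gradient u y) - gradient u y :=
    (hΩ.eventually_mem hx).mono fun y hy => by
      rw [pGradient, hess_eq_fderiv hΩ hy, grad_eq_gradient hΩ hy]
  have h3 : DifferentiableAt ℝ (fun y => fderiv ℝ (gradient u) y (gradient u y)) x :=
    ((hG.fderiv_right (m := 1) (by norm_num)).differentiableAt (by norm_num)).clm_apply
      (hG.differentiableAt (by norm_num))
  rw [divergence, h2.fderiv_eq, fderiv_fun_sub h3 (hG.differentiableAt (by norm_num)), map_sub,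
    hess_eq_fderiv hΩ hx, ← divergence_fderiv_apply_self hG h1, ← h1.self_of_nhds, divergence,
    divergence]

/-- No third derivative of `u` survives in the divergence, so it agrees inside `Ω` with a function
continuous on the compact closure. -/
theorem integrableOn_divergence_pGradient (hΩ : IsOpen Ω) (hb : Bornology.IsBounded Ω)
    (hC : HasC2Boundary Ω) (hu : ContDiffOn ℝ 2 u (closure Ω)) (hu' : ContDiffOn ℝ ∞ u Ω)
    (hc : ∀ x ∈ Ω, Laplacian.laplacian u x = c) :
    IntegrableOn (divergence (pGradient Ω u)) Ω := by
  have hK : IsCompact (closure Ω) :=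
    Metric.isCompact_of_isClosed_isBounded isClosed_closure hb.closure
  have hD := continuousOn_hess hΩ hC hu
  have h1 : IntegrableOn (fun x => opTrace ((hess Ω u x).comp (hess Ω u x)) - c) Ω :=
    (((opTrace.continuous.comp_continuousOn (hD.clm_comp hD)).sub
      continuousOn_const).integrableOn_compact hK).mono_set subset_closure
  exact h1.congr_fun (fun y hy => (divergence_pGradient hΩ hu hu' hc hy).symm)
    hΩ.measurableSet

end PFunction

/-! ### Boundary identities from the Robin condition -/

section Boundary

variable {N : ℕ} {Ω : Set (EuclideanSpace ℝ (Fin N))} {u : EuclideanSpace ℝ (Fin N) → ℝ} {β : ℝ}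
  {x : EuclideanSpace ℝ (Fin N)}

theorem inner_outerNormal_self (hΩ : IsOpen Ω) (hC : HasC2Boundary Ω) (hx : x ∈ frontier Ω) :
    inner ℝ (outerNormal Ω x) (outerNormal Ω x) = (1 : ℝ) := by
  rw [real_inner_self_eq_norm_sq, norm_outerNormal hΩ hC hx, one_pow]

theorem inner_outerNormal_tangentialGrad (hΩ : IsOpen Ω) (hC : HasC2Boundary Ω)
    (hx : x ∈ frontier Ω) : inner ℝ (outerNormal Ω x) (tangentialGrad Ω u x) = (0 : ℝ) := by
  rw [tangentialGrad, inner_sub_right, inner_smul_right, inner_outerNormal_self hΩ hC hx,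
    normalDeriv, real_inner_comm]
  ring

theorem grad_eq_add : grad Ω u x = normalDeriv Ω u x • outerNormal Ω x + tangentialGrad Ω u x := by
  rw [tangentialGrad, add_sub_cancel]

theorem inner_grad_tangentialGrad (hΩ : IsOpen Ω) (hC : HasC2Boundary Ω) (hx : x ∈ frontier Ω) :
    inner ℝ (grad Ω u x) (tangentialGrad Ω u x) = ‖tangentialGrad Ω u x‖ ^ 2 := by
  rw [grad_eq_add, inner_add_left, real_inner_smul_left,
    inner_outerNormal_tangentialGrad hΩ hC hx, real_inner_self_eq_norm_sq]
  ring

theorem inner_grad_self (hΩ : IsOpen Ω) (hC : HasC2Boundary Ω) (hx : x ∈ frontier Ω) :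
    (inner ℝ (grad Ω u x) (grad Ω u x) : ℝ) =
      normalDeriv Ω u x ^ 2 + ‖tangentialGrad Ω u x‖ ^ 2 := by
  have h : (inner ℝ (grad Ω u x) (normalDeriv Ω u x • outerNormal Ω x + tangentialGrad Ω u x) : ℝ) =
      normalDeriv Ω u x ^ 2 + ‖tangentialGrad Ω u x‖ ^ 2 := by
    rw [inner_add_right, inner_grad_tangentialGrad hΩ hC hx, inner_smul_right, ← normalDeriv,
      sq (normalDeriv Ω u x)]
  rwa [← grad_eq_add] at h

/-- The Robin condition differentiated in a tangential direction. -/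
theorem IsRobinTorsionSolution.tangential_deriv_eq_zero (hu : IsRobinTorsionSolution Ω β u)
    (hΩ : IsOpen Ω) (hC : HasC2Boundary Ω) (hx : x ∈ frontier Ω) {k : EuclideanSpace ℝ (Fin N)}
    (hk : inner ℝ (outerNormal Ω x) k = (0 : ℝ)) :
    inner ℝ (hess Ω u x k) (outerNormal Ω x) + inner ℝ (grad Ω u x) (gradNormal Ω x k) +
      β * inner ℝ (grad Ω u x) k = (0 : ℝ) := by
  obtain ⟨e, g, U, v, h, hv, rfl⟩ := exists_graphMap_eq hΩ hC hx
  have hxc := frontier_subset_closure hx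
  have hG := hasFDerivAt_graphMap (h.contDiff.differentiable (by norm_num) v)
  have hmem : ∀ᶠ w in 𝓝 v, graphMap e g w ∈ closure Ω :=
    (h.eventually_mem hv).mono fun w hw =>
      frontier_subset_closure (h.graphMap_mem_frontier hΩ hw)
  have h1 := (hasFDerivWithinAt_grad hΩ hC hu.contDiffOn hxc).comp_hasFDerivAt v hG hmem
  have h2 := (hasFDerivWithinAt_closure hu.contDiffOn hxc).comp_hasFDerivAt v hG hmem
  have h3 := (h1.inner ℝ (hasFDerivAt_unitGraphNormal h.norm_eq_one h.contDiff v)).add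
    (h2.const_mul β)
  -- In the chart the Robin condition is an identity near `v`, so its derivative vanishes; the
  -- direction projecting from `k` corresponds to the tangent vector `k` itself.
  have h4 : (fun w => (inner ℝ ((grad Ω u ∘ graphMap e g) w) (unitGraphNormal e g w) : ℝ) +
      β * (u ∘ graphMap e g) w) =ᶠ[𝓝 v] fun _ => 0 :=
    (h.eventually_mem hv).mono fun w hw => by
      simp only [Function.comp_apply]
      rw [← h.outerNormal_graphMap hw]
      exact hu.robin _ (h.graphMap_mem_frontier hΩ hw)
  have h5 := congrArg (fun A => A (hyperProj e k))
    (h3.unique ((hasFDerivAt_const (0 : ℝ) v).congr_of_eventuallyEq h4))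
  rw [h.outerNormal_graphMap hv] at hk ⊢
  have h6 := eq_graphDeriv_of_inner_eq_zero h.norm_eq_one hk
  have h7 := h.gradNormal_graphDeriv hΩ hv (hyperProj e k)
  rw [h6] at h7
  simp only [add_apply, smul_apply, ContinuousLinearMap.comp_apply, fderivInnerCLM_apply,
    ContinuousLinearMap.prod_apply, Function.comp_apply, innerSL_apply_apply, zero_apply,
    smul_eq_mul, h6, ← h7] at h5
  linarith

/-- Differentiate the Robin condition along `∇^τ u`. As `(∇ν)∇^τ u` is tangential, pairing it with
`∇u` only sees `∇^τ u`. -/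
theorem IsRobinTorsionSolution.inner_hess_tangentialGrad (hu : IsRobinTorsionSolution Ω β u)
    (hΩ : IsOpen Ω) (hC : HasC2Boundary Ω) (hx : x ∈ frontier Ω) :
    inner ℝ (hess Ω u x (tangentialGrad Ω u x)) (outerNormal Ω x) =
      -inner ℝ (gradNormal Ω x (tangentialGrad Ω u x)) (tangentialGrad Ω u x) -
        β * ‖tangentialGrad Ω u x‖ ^ 2 := by
  have hτ := inner_outerNormal_tangentialGrad (u := u) hΩ hC hx
  have h1 := hu.tangential_deriv_eq_zero hΩ hC hx hτ
  have h2 : (inner ℝ (grad Ω u x) (gradNormal Ω x (tangentialGrad Ω u x)) : ℝ) =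
      inner ℝ (gradNormal Ω x (tangentialGrad Ω u x)) (tangentialGrad Ω u x) := by
    rw [real_inner_comm, grad_eq_add, inner_add_right, inner_smul_right,
      inner_gradNormal_outerNormal hΩ hC hx hτ, mul_zero, zero_add]
  rw [h2, inner_grad_tangentialGrad hΩ hC hx] at h1
  linarith

theorem continuous_innerSL_smulRight {E : Type*} [NormedAddCommGroup E] [InnerProductSpace ℝ E] :
    Continuous fun y : E => (innerSL ℝ y).smulRight y :=
  (ContinuousLinearMap.smulRightL ℝ E E).isBoundedBilinearMap.continuous.comp
    ((innerSL ℝ).continuous.prodMk continuous_id)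

/-- The integrand of the first variation formula for the field `u ∇u`, multiplied by `β`. -/
noncomputable def robinVariation (Ω : Set (EuclideanSpace ℝ (Fin N))) (β : ℝ)
    (u : EuclideanSpace ℝ (Fin N) → ℝ) (x : EuclideanSpace ℝ (Fin N)) : ℝ :=
  normalDeriv Ω u x * inner ℝ (hess Ω u x (outerNormal Ω x)) (outerNormal Ω x) +
    opTrace (gradNormal Ω x) * normalDeriv Ω u x ^ 2 + β * ‖tangentialGrad Ω u x‖ ^ 2 -
    N * normalDeriv Ω u x

/-- The first variation formula for `u ∇u` plays the role of `∫ u Δ_τ u = -∫ |∇^τ u|²`. It needs no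
second tangential derivatives on the boundary, since `u ∇u` is `C¹` on the closure. -/
theorem IsRobinTorsionSolution.integral_robinVariation (hu : IsRobinTorsionSolution Ω β u)
    (hΩ : IsOpen Ω) (hb : Bornology.IsBounded Ω) (hC : HasC2Boundary Ω) :
    ∫ x, robinVariation Ω β u x ∂(surfaceMeasure Ω) = 0 := by
  have hc := hu.contDiffOn
  have hg := (contDiffOn_grad hΩ hC hc).continuousOn.mono (frontier_subset_closure (s := Ω))
  have hD := (continuousOn_hess hΩ hC hc).mono (frontier_subset_closure (s := Ω))
  have huc := hc.continuousOn.mono (frontier_subset_closure (s := Ω))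
  have hL : ContinuousOn (fun x => u x • hess Ω u x +
      (innerSL ℝ (grad Ω u x)).smulRight (grad Ω u x)) (frontier Ω) :=
    (huc.smul hD).add (continuous_innerSL_smulRight.comp_continuousOn hg)
  have hX : ∀ x ∈ frontier Ω, HasFDerivWithinAt (fun x => u x • grad Ω u x)
      (u x • hess Ω u x + (innerSL ℝ (grad Ω u x)).smulRight (grad Ω u x)) (frontier Ω) x :=
    fun x hx => ((hasFDerivWithinAt_closure hc (frontier_subset_closure hx)).smul
      (hasFDerivWithinAt_grad hΩ hC hc (frontier_subset_closure hx))).mono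
        frontier_subset_closure
  have h1 := integral_firstVariation hΩ hb hC hX hL
  have h2 : ∫ x, robinVariation Ω β u x ∂(surfaceMeasure Ω) =
      ∫ x, β * firstVariation Ω (fun x => u x • grad Ω u x)
        (fun x => u x • hess Ω u x + (innerSL ℝ (grad Ω u x)).smulRight (grad Ω u x)) x
        ∂(surfaceMeasure Ω) := by
    refine integral_congr_ae (ae_surfaceMeasure_mem_frontier.mono fun x hx => ?_)
    have hr := hu.robin x hx
    have hcomm' : (inner ℝ (grad Ω u x) (outerNormal Ω x) : ℝ) = normalDeriv Ω u x := rfl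
    have hcomm : (inner ℝ (outerNormal Ω x) (grad Ω u x) : ℝ) = normalDeriv Ω u x :=
      real_inner_comm _ _
    simp only [robinVariation, firstVariation, map_add, map_smul, opTrace_smulRight, add_apply,
      smul_apply, ContinuousLinearMap.smulRight_apply, innerSL_apply_apply, inner_add_left,
      real_inner_smul_left, real_inner_smul_right, smul_eq_mul, hcomm,
      opTrace_hess hΩ hC hc hu.laplacian_eq (frontier_subset_closure hx),
      inner_grad_self hΩ hC hx, hcomm']
    -- The Robin condition trades each `β u` for `-u_ν`; the term `|∇^τ u|²` arises as `|∇u|² -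
    -- u_ν²`.
    have h3 : normalDeriv Ω u x = -(β * u x) := by linarith
    linear_combination (inner ℝ (hess Ω u x (outerNormal Ω x)) (outerNormal Ω x) +
      opTrace (gradNormal Ω x) * normalDeriv Ω u x - N) * h3
  rw [h2, integral_const_mul, h1, mul_zero]

/-- Everything containing `u_νν` is collected in `robinVariation`, whose integral is zero. This
costs another `β |∇^τ u|²`, hence the factor `2`, and turns `-u_ν` into `(N - 1) u_ν`. -/
theorem IsRobinTorsionSolution.inner_outerNormal_pGradient (hu : IsRobinTorsionSolution Ω β u)
    (hN : 2 ≤ N) (hΩ : IsOpen Ω) (hC : HasC2Boundary Ω) (hx : x ∈ frontier Ω) :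
    inner ℝ (outerNormal Ω x) (pGradient Ω u x) =
      robinVariation Ω β u x -
        inner ℝ (gradNormal Ω x (tangentialGrad Ω u x)) (tangentialGrad Ω u x) -
        2 * β * ‖tangentialGrad Ω u x‖ ^ 2 + (N - 1) * normalDeriv Ω u x -
        (N - 1) * (normalDeriv Ω u x ^ 2 * meanCurvature Ω x) := by
  have h1 : (inner ℝ (outerNormal Ω x) (hess Ω u x (grad Ω u x)) : ℝ) =
      normalDeriv Ω u x * inner ℝ (hess Ω u x (outerNormal Ω x)) (outerNormal Ω x) +
        inner ℝ (hess Ω u x (tangentialGrad Ω u x)) (outerNormal Ω x) := by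
    conv_lhs => rw [grad_eq_add, map_add, map_smul, real_inner_comm, inner_add_left,
      real_inner_smul_left]
  have h2 : (inner ℝ (outerNormal Ω x) (grad Ω u x) : ℝ) = normalDeriv Ω u x :=
    real_inner_comm _ _
  rw [pGradient, inner_sub_right, h1, h2, hu.inner_hess_tangentialGrad hΩ hC hx, robinVariation,
    ← sub_one_mul_meanCurvature hN hΩ hC hx]
  ring

theorem opTrace_id : opTrace (ContinuousLinearMap.id ℝ (EuclideanSpace ℝ (Fin N))) = N := by
  rw [opTrace_apply]
  simp

theorem integral_inner_outerNormal (hΩ : IsOpen Ω) (hb : Bornology.IsBounded Ω)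
    (hC : HasC2Boundary Ω) :
    ∫ x, inner ℝ (outerNormal Ω x) x ∂(surfaceMeasure Ω) = N * volume.real Ω := by
  have hd : divergence (id : EuclideanSpace ℝ (Fin N) → _) = fun _ => (N : ℝ) := by
    funext x
    rw [divergence, fderiv_id, opTrace_id]
  have h := setIntegral_divergence hΩ hb hC continuousOn_id contDiffOn_id (by
    rw [hd]
    exact integrableOn_const hb.measure_lt_top.ne)
  rw [hd, setIntegral_const, smul_eq_mul, mul_comm] at h
  exact h.symm

theorem IsRobinTorsionSolution.integral_normalDeriv (hu : IsRobinTorsionSolution Ω β u)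
    (hΩ : IsOpen Ω) (hb : Bornology.IsBounded Ω) (hC : HasC2Boundary Ω) :
    ∫ x, normalDeriv Ω u x ∂(surfaceMeasure Ω) = N * volume.real Ω := by
  have hg := contDiffOn_grad hΩ hC hu.contDiffOn
  have hd : ∀ x ∈ Ω, (N : ℝ) = divergence (grad Ω u) x := fun x hx =>
    (divergence_grad hΩ hC hu.contDiffOn hu.laplacian_eq hx).symm
  have h := setIntegral_divergence hΩ hb hC hg.continuousOn (hg.mono subset_closure)
    ((integrableOn_const hb.measure_lt_top.ne).congr_fun hd hΩ.measurableSet)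
  rw [← setIntegral_congr_fun hΩ.measurableSet hd, setIntegral_const, smul_eq_mul, mul_comm] at h
  rw [h]
  exact integral_congr_ae (ae_of_all _ fun x => real_inner_comm _ _)

/-- A null boundary would make the flux of the position field vanish, whereas it equals `N|Ω| > 0`.
-/
theorem surfaceMeasure_univ_pos (hN : 2 ≤ N) (hΩ : IsOpen Ω) (hne : Ω.Nonempty)
    (hb : Bornology.IsBounded Ω) (hC : HasC2Boundary Ω) : 0 < surfaceMeasure Ω univ := by
  have hvol : 0 < volume.real Ω :=
    ENNReal.toReal_pos (hΩ.measure_pos volume hne).ne' hb.measure_lt_top.ne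
  refine pos_iff_ne_zero.2 fun h0 => ?_
  have h1 := integral_inner_outerNormal hΩ hb hC
  rw [Measure.measure_univ_eq_zero.1 h0, integral_zero_measure] at h1
  have h2 : (0 : ℝ) < N := by exact_mod_cast (by omega : 0 < N)
  exact (mul_pos h2 hvol).ne h1

end Boundary

end RobinTorsion

/-! ### The integral identity -/

theorem mainTheorem5 {N : ℕ} (hN : 2 ≤ N) (Ω : Set (EuclideanSpace ℝ (Fin N)))
    (hΩ_open : IsOpen Ω) (hΩ_conn : IsConnected Ω) (hΩ_bdd : Bornology.IsBounded Ω)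
    (hΩ_C2 : RobinTorsion.HasC2Boundary Ω) (β : ℝ) (hβ : β ≠ 0)
    (u : EuclideanSpace ℝ (Fin N) → ℝ) (hu : RobinTorsion.IsRobinTorsionSolution Ω β u) :
    -- `ΔP` and `R`, `𝓜₀` make sense
    ContDiffOn ℝ 2 (RobinTorsion.pFunction Ω u) Ω ∧
    0 < RobinTorsion.surfaceMeasure Ω univ ∧ RobinTorsion.surfaceMeasure Ω univ < ⊤ ∧
    0 < RobinTorsion.refRadius Ω ∧
    -- all the integrals exist
    IntegrableOn (fun x => Laplacian.laplacian (RobinTorsion.pFunction Ω u) x) Ω volume ∧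
    Integrable (fun x => (RobinTorsion.normalDeriv Ω u x - RobinTorsion.refRadius Ω) ^ 2 *
      RobinTorsion.refCurvature Ω) (RobinTorsion.surfaceMeasure Ω) ∧
    Integrable (fun x => inner ℝ
      (RobinTorsion.gradNormal Ω x (RobinTorsion.tangentialGrad Ω u x))
      (RobinTorsion.tangentialGrad Ω u x)) (RobinTorsion.surfaceMeasure Ω) ∧
    Integrable (fun x => ‖RobinTorsion.tangentialGrad Ω u x‖ ^ 2)
      (RobinTorsion.surfaceMeasure Ω) ∧
    Integrable (fun x => RobinTorsion.normalDeriv Ω u x ^ 2 *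
      (RobinTorsion.meanCurvature Ω x - RobinTorsion.refCurvature Ω))
      (RobinTorsion.surfaceMeasure Ω) ∧
    -- the identity
    (∫ x in Ω, Laplacian.laplacian (RobinTorsion.pFunction Ω u) x) +
      ((N : ℝ) - 1) * (∫ x, (RobinTorsion.normalDeriv Ω u x - RobinTorsion.refRadius Ω) ^ 2 *
        RobinTorsion.refCurvature Ω ∂(RobinTorsion.surfaceMeasure Ω))
    = -(∫ x, inner ℝ
          (RobinTorsion.gradNormal Ω x (RobinTorsion.tangentialGrad Ω u x))
          (RobinTorsion.tangentialGrad Ω u x) ∂(RobinTorsion.surfaceMeasure Ω))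
      - 2 * β * (∫ x, ‖RobinTorsion.tangentialGrad Ω u x‖ ^ 2
          ∂(RobinTorsion.surfaceMeasure Ω))
      - ((N : ℝ) - 1) * (∫ x, RobinTorsion.normalDeriv Ω u x ^ 2 *
          (RobinTorsion.meanCurvature Ω x - RobinTorsion.refCurvature Ω)
          ∂(RobinTorsion.surfaceMeasure Ω)) := by
  have hc := hu.contDiffOn
  have hu' : ContDiffOn ℝ ((⊤ : ℕ∞) : WithTop ℕ∞) u Ω := fun x hx =>
    (RobinTorsion.contDiffAt_of_laplacian_eq_const hΩ_open (hc.mono subset_closure)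
      hu.laplacian_eq hx).contDiffWithinAt
  have hfin := RobinTorsion.isFiniteMeasure_surfaceMeasure hΩ_open hΩ_bdd hΩ_C2
  have hpos := RobinTorsion.surfaceMeasure_univ_pos hN hΩ_open hΩ_conn.nonempty hΩ_bdd hΩ_C2
  have hvol : 0 < volume.real Ω :=
    ENNReal.toReal_pos (hΩ_open.measure_pos volume hΩ_conn.nonempty).ne'
      hΩ_bdd.measure_lt_top.ne
  have hσ : 0 < (RobinTorsion.surfaceMeasure Ω).real univ :=
    ENNReal.toReal_pos hpos.ne' (measure_lt_top _ _).ne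
  have hN0 : (0 : ℝ) < N := by exact_mod_cast (by omega : 0 < N)
  have hN1 : ((N : ℝ) - 1) ≠ 0 := by
    have : (2 : ℝ) ≤ N := by exact_mod_cast hN
    linarith
  have hR : 0 < RobinTorsion.refRadius Ω := div_pos (mul_pos hN0 hvol) hσ
  have hRσ : RobinTorsion.refRadius Ω * (RobinTorsion.surfaceMeasure Ω).real univ =
      N * volume.real Ω := div_mul_cancel₀ _ hσ.ne'
  have hRM : RobinTorsion.refRadius Ω * RobinTorsion.refCurvature Ω = 1 :=
    mul_one_div_cancel hR.ne'
  have hdiv := RobinTorsion.integrableOn_divergence_pGradient hΩ_open hΩ_bdd hΩ_C2 hc hu'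
    hu.laplacian_eq
  have hlap : ∀ x ∈ Ω, RobinTorsion.divergence (RobinTorsion.pGradient Ω u) x =
      Laplacian.laplacian (RobinTorsion.pFunction Ω u) x := fun x hx =>
    (RobinTorsion.laplacian_pFunction hΩ_open hΩ_C2 hc hu' hx).symm
  have hν := RobinTorsion.continuousOn_outerNormal hΩ_open hΩ_C2
  have hg := (RobinTorsion.contDiffOn_grad hΩ_open hΩ_C2 hc).continuousOn.mono
    (frontier_subset_closure (s := Ω))
  have hD := (RobinTorsion.continuousOn_hess hΩ_open hΩ_C2 hc).mono
    (frontier_subset_closure (s := Ω))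
  have hh : ContinuousOn (RobinTorsion.normalDeriv Ω u) (frontier Ω) := hg.inner hν
  have hτ : ContinuousOn (RobinTorsion.tangentialGrad Ω u) (frontier Ω) := hg.sub (hh.smul hν)
  have hSτ := RobinTorsion.continuousOn_gradNormal_apply hΩ_open hΩ_C2 hτ fun x hx =>
    RobinTorsion.inner_outerNormal_tangentialGrad hΩ_open hΩ_C2 hx
  have htr := RobinTorsion.continuousOn_opTrace_gradNormal hΩ_open hΩ_C2
  have hM : ContinuousOn (RobinTorsion.meanCurvature Ω) (frontier Ω) :=
    (htr.div_const ((N : ℝ) - 1)).congr fun x hx => by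
      simp only
      rw [← RobinTorsion.sub_one_mul_meanCurvature hN hΩ_open hΩ_C2 hx,
        mul_div_cancel_left₀ _ hN1]
  have hint {f : EuclideanSpace ℝ (Fin N) → ℝ} (hf : ContinuousOn f (frontier Ω)) :=
    RobinTorsion.integrable_surfaceMeasure hΩ_open hΩ_bdd hΩ_C2 hf
  have hI1 : Integrable (fun x => (RobinTorsion.normalDeriv Ω u x - RobinTorsion.refRadius Ω) ^ 2 *
      RobinTorsion.refCurvature Ω) (RobinTorsion.surfaceMeasure Ω) :=
    hint (((hh.sub continuousOn_const).pow 2).mul continuousOn_const)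
  have hI2 : Integrable (fun x => inner ℝ
      (RobinTorsion.gradNormal Ω x (RobinTorsion.tangentialGrad Ω u x))
      (RobinTorsion.tangentialGrad Ω u x)) (RobinTorsion.surfaceMeasure Ω) :=
    hint (hSτ.inner hτ)
  have hI3 : Integrable (fun x => ‖RobinTorsion.tangentialGrad Ω u x‖ ^ 2)
      (RobinTorsion.surfaceMeasure Ω) := hint (hτ.norm.pow 2)
  have hI4 : Integrable (fun x => RobinTorsion.normalDeriv Ω u x ^ 2 *
      (RobinTorsion.meanCurvature Ω x - RobinTorsion.refCurvature Ω))
      (RobinTorsion.surfaceMeasure Ω) := hint ((hh.pow 2).mul (hM.sub continuousOn_const))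
  have hI5 : Integrable (fun x => RobinTorsion.robinVariation Ω β u x)
      (RobinTorsion.surfaceMeasure Ω) :=
    hint ((((hh.mul ((hD.clm_apply hν).inner hν)).add (htr.mul (hh.pow 2))).add
      (continuousOn_const.mul (hτ.norm.pow 2))).sub (continuousOn_const.mul hh))
  have hI6 : Integrable (fun x => RobinTorsion.refRadius Ω - RobinTorsion.normalDeriv Ω u x)
      (RobinTorsion.surfaceMeasure Ω) := hint (continuousOn_const.sub hh)
  have hI7 : Integrable (fun x => inner ℝ (RobinTorsion.outerNormal Ω x)
      (RobinTorsion.pGradient Ω u x)) (RobinTorsion.surfaceMeasure Ω) :=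
    hint (hν.inner ((RobinTorsion.continuousOn_pGradient hΩ_open hΩ_C2 hc).mono
      frontier_subset_closure))
  refine ⟨RobinTorsion.contDiffOn_pFunction hΩ_open hu', hpos, measure_lt_top _ _, hR,
    hdiv.congr_fun hlap hΩ_open.measurableSet, hI1, hI2, hI3, hI4, ?_⟩
  -- The divergence theorem for `∇u` gives total flux `N|Ω|`; `R` is precisely the mean of `u_ν`
  -- over the boundary.
  have hmean : ∫ x, (RobinTorsion.refRadius Ω - RobinTorsion.normalDeriv Ω u x)
      ∂(RobinTorsion.surfaceMeasure Ω) = 0 := by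
    rw [integral_sub (integrable_const _) (hint hh), integral_const, smul_eq_mul,
      hu.integral_normalDeriv hΩ_open hΩ_bdd hΩ_C2, mul_comm, hRσ, sub_self]
  have hvar := hu.integral_robinVariation hΩ_open hΩ_bdd hΩ_C2
  rw [← setIntegral_congr_fun hΩ_open.measurableSet hlap,
    RobinTorsion.setIntegral_divergence hΩ_open hΩ_bdd hΩ_C2
      (RobinTorsion.continuousOn_pGradient hΩ_open hΩ_C2 hc)
      (RobinTorsion.contDiffOn_pGradient hΩ_open hΩ_C2 hc hu') hdiv]
  have hlin : ∫ x, (inner ℝ (RobinTorsion.outerNormal Ω x) (RobinTorsion.pGradient Ω u x) +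
      ((N : ℝ) - 1) * ((RobinTorsion.normalDeriv Ω u x - RobinTorsion.refRadius Ω) ^ 2 *
        RobinTorsion.refCurvature Ω)) ∂(RobinTorsion.surfaceMeasure Ω) =
      ∫ x, (-inner ℝ (RobinTorsion.gradNormal Ω x (RobinTorsion.tangentialGrad Ω u x))
          (RobinTorsion.tangentialGrad Ω u x) -
        2 * β * ‖RobinTorsion.tangentialGrad Ω u x‖ ^ 2 -
        ((N : ℝ) - 1) * (RobinTorsion.normalDeriv Ω u x ^ 2 *
          (RobinTorsion.meanCurvature Ω x - RobinTorsion.refCurvature Ω)) +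
        (RobinTorsion.robinVariation Ω β u x + ((N : ℝ) - 1) *
          (RobinTorsion.refRadius Ω - RobinTorsion.normalDeriv Ω u x)))
        ∂(RobinTorsion.surfaceMeasure Ω) := by
    refine integral_congr_ae (RobinTorsion.ae_surfaceMeasure_mem_frontier.mono fun x hx => ?_)
    simp only
    rw [hu.inner_outerNormal_pGradient hN hΩ_open hΩ_C2 hx]
    -- Here `(u_ν - R)² 𝓜₀ = u_ν² 𝓜₀ - 2 u_ν + R` by `R 𝓜₀ = 1`. Adding `u_ν` leaves `u_ν² 𝓜₀` and
    -- the mean-zero remainder `R - u_ν`.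
    linear_combination ((N : ℝ) - 1) * (RobinTorsion.refRadius Ω -
      2 * RobinTorsion.normalDeriv Ω u x) * hRM
  have hJ2 : Integrable (fun x => -inner ℝ
      (RobinTorsion.gradNormal Ω x (RobinTorsion.tangentialGrad Ω u x))
      (RobinTorsion.tangentialGrad Ω u x) - 2 * β * ‖RobinTorsion.tangentialGrad Ω u x‖ ^ 2)
      (RobinTorsion.surfaceMeasure Ω) := hI2.neg.sub (hI3.const_mul _)
  have hJ3 : Integrable (fun x => -inner ℝ
      (RobinTorsion.gradNormal Ω x (RobinTorsion.tangentialGrad Ω u x))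
      (RobinTorsion.tangentialGrad Ω u x) - 2 * β * ‖RobinTorsion.tangentialGrad Ω u x‖ ^ 2 -
      ((N : ℝ) - 1) * (RobinTorsion.normalDeriv Ω u x ^ 2 *
        (RobinTorsion.meanCurvature Ω x - RobinTorsion.refCurvature Ω)))
      (RobinTorsion.surfaceMeasure Ω) := hJ2.sub (hI4.const_mul _)
  have hJ5 : Integrable (fun x => RobinTorsion.robinVariation Ω β u x + ((N : ℝ) - 1) *
      (RobinTorsion.refRadius Ω - RobinTorsion.normalDeriv Ω u x))
      (RobinTorsion.surfaceMeasure Ω) := hI5.add (hI6.const_mul _)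
  rw [integral_add hI7 (hI1.const_mul _), integral_const_mul,
    integral_add hJ3 hJ5, integral_add hI5 (hI6.const_mul _),
    integral_sub hJ2 (hI4.const_mul _), integral_sub hI2.fun_neg (hI3.const_mul _), integral_neg,
    integral_const_mul, integral_const_mul, integral_const_mul, hmean, hvar, mul_zero, add_zero,
    add_zero] at hlin
  exact hlin
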